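/- Let $\mathfrak q(y,z|x)$ be a discrete memoryless broadcast channel with finite alphabets $\mathcal X\neq\emptyset,\mathcal Y,\mathcal Z$. All informations are in bits, auxiliary random variables $U,V,W$ range over all finite alphabets, and $(U,V,W)\to X\to(Y,Z)$ is a Markov chain with $(Y,Z)$ the output of $\mathfrak q$ on input $X$. For $\lambda\in[0,1]$ put $$\lambda\text{-}SR(\mathfrak q,p(u,v,w,x))=\lambda I(W;Y)+(1-\lambda)I(W;Z)+I(U;Y|W)+I(V;Z|W)-I(U;V|W),$$ let $\lambda\text{-}SR(\mathfrak q,p(x))$ be its supremum over all $p(u,v,w|x)$ and $\lambda\text{-}SR(\mathfrak q)$ its supremum over all $p(u,v,w,x)$. Marton's sum rate is $$SR(\mathfrak q)=\sup_{p(u,v,w,x)}\ \min\{I(W;Y),I(W;Z)\}+I(U;Y|W)+I(V;Z|W)-I(U;V|W).$$ A pair $(R_1,R_2)$ of nonnegative reals is achievable if there are deterministic codes of block lengths $n=0,1,2,\dots$ (an encoder $(m_1,m_2)\mapsto x^n$ and decoders $y^n\mapsto\hat m_1$, $z^n\mapsto\hat m_2$) such that $\mathrm P(\hat M_1\ne M_1)\to0$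 and $\mathrm P(\hat M_2\neq M_2)\to 0$ as $n\to\infty$ when $(M_1,M_2)$ is uniform on $\{1,\dots,\lfloor 2^{nR_1}\rfloor\}\times\{1,\dots,\lfloor 2^{nR_2}\rfloor\}$. The capacity region is the closure of the set of achievable pairs, and the optimal sum rate $SR^*(\mathfrak q)$ is the maximum of $R_1+R_2$ over the capacity region. All these suprema are finite, the maximum defining $SR^*(\mathfrak q)$ exists, and: 1. For every $p(x)$, the suprema defining $0\text{-}SR(\mathfrak q,p(x))$ and $1\text{-}SR(\mathfrak q,p(x))$ are attained, and $$0\text{-}SR(\mathfrak q,p(x))=\max_{p(w|x)}\{I(W;Z)+I(X;Y|W)\},\qquad 1\text{-}SR(\mathfrak q,p(x))=\max_{p(w|x)}\{I(W;Y)+I(X;Z|W)\}.$$ Likewise the suprema defining $0\text{-}SR(\mathfrak q)$ and $1\text{-}SR(\mathfrak q)$ are attained, and $0\text{-}SR(\mathfrak q)=\max_{p(w,x)}\{I(W;Z)+I(X;Y|W)\}$, $1\text{-}SR(\mathfrak q)=\max_{p(w,x)}\{I(W;Y)+I(X;Z|W)\}$. 2. $\min_{\lambda\in\{0,1\}}\lambda\text{-}SR(\mathfrak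 q)\ \ge\ SR^*(\mathfrak q)$. 3. If the minimum of $\lambda\text{-}SR(\mathfrak q)$ over $\lambda\in[0,1]$ is attained at $\lambda=0$ or $\lambda=1$, then $SR(\mathfrak q)=SR^*(\mathfrak q)$. -/

import Mathlib

namespace BC

/-- A discrete memoryless broadcast channel `q(y,z|x)` with finite alphabets. -/
structure Channel (X Y Z : Type*) [Fintype Y] [Fintype Z] where
  prob : X → Y → Z → ℝ
  prob_nonneg : ∀ x y z, 0 ≤ prob x y z
  sum_prob : ∀ x, ∑ y, ∑ z, prob x y z = 1

section Information

variable {Ω A B C : Type*} [Fintype Ω] [Fintype A] [Fintype B] [Fintype C]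

open Classical in
/-- The probability that the random variable `f` takes the value `a`, where the finite sample
space `Ω` carries the mass function `P`. -/
noncomputable def law (P : Ω → ℝ) (f : Ω → A) (a : A) : ℝ :=
  ∑ ω, if f ω = a then P ω else 0

/-- Shannon entropy `H(f)`, in bits. -/
noncomputable def entropy (P : Ω → ℝ) (f : Ω → A) : ℝ :=
  (∑ a, Real.negMulLog (law P f a)) / Real.log 2

/-- Conditional entropy `H(f|g) = H(f,g) - H(g)`. -/
noncomputable def condEntropy (P : Ω → ℝ) (f : Ω → A) (g : Ω → B) : ℝ :=
  entropy P (fun ω => (f ω, g ω)) - entropy P g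

/-- Mutual information `I(f;g) = H(f) - H(f|g)`. -/
noncomputable def mutualInfo (P : Ω → ℝ) (f : Ω → A) (g : Ω → B) : ℝ :=
  entropy P f - condEntropy P f g

/-- Conditional mutual information `I(f;g|h) = H(f|h) - H(f|g,h)`. -/
noncomputable def condMutualInfo (P : Ω → ℝ) (f : Ω → A) (g : Ω → B) (h : Ω → C) : ℝ :=
  condEntropy P f h - condEntropy P f (fun ω => (g ω, h ω))

end Information

section SumRates

variable {X Y Z : Type*} [Fintype X] [Fintype Y] [Fintype Z]

/-- The joint mass function of an auxiliary variable (with values in `A`), the input and the two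
outputs, when the auxiliary variable and the input have joint mass function `p`:
auxiliary → input → outputs is a Markov chain. -/
def joint {A : Type*} (q : Channel X Y Z) (p : A × X → ℝ) : (A × X) × (Y × Z) → ℝ :=
  fun ω => p ω.1 * q.prob ω.1.2 ω.2.1 ω.2.2

/-- The joint mass function `p(x) p(a|x)`. -/
def inputJoint {A : Type*} (p : X → ℝ) (κ : X → A → ℝ) : A × X → ℝ :=
  fun s => p s.2 * κ s.2 s.1

section Values

variable {U V W : Type*} [Fintype U] [Fintype V] [Fintype W]

/-- `I(U;Y|W) + I(V;Z|W) - I(U;V|W)` at `p(u,v,w,x)`. -/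
noncomputable def privateTerm (q : Channel X Y Z) (p : (U × V × W) × X → ℝ) : ℝ :=
  condMutualInfo (joint q p) (fun ω => ω.1.1.1) (fun ω => ω.2.1) (fun ω => ω.1.1.2.2)
    + condMutualInfo (joint q p) (fun ω => ω.1.1.2.1) (fun ω => ω.2.2) (fun ω => ω.1.1.2.2)
    - condMutualInfo (joint q p) (fun ω => ω.1.1.1) (fun ω => ω.1.1.2.1) (fun ω => ω.1.1.2.2)

/-- `I(W;Y)` at `p(u,v,w,x)`. -/
noncomputable def infoWY (q : Channel X Y Z) (p : (U × V × W) × X → ℝ) : ℝ :=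
  mutualInfo (joint q p) (fun ω => ω.1.1.2.2) (fun ω => ω.2.1)

/-- `I(W;Z)` at `p(u,v,w,x)`. -/
noncomputable def infoWZ (q : Channel X Y Z) (p : (U × V × W) × X → ℝ) : ℝ :=
  mutualInfo (joint q p) (fun ω => ω.1.1.2.2) (fun ω => ω.2.2)

/-- The `t`-sum rate at `p(u,v,w,x)`:
`t I(W;Y) + (1-t) I(W;Z) + I(U;Y|W) + I(V;Z|W) - I(U;V|W)`. -/
noncomputable def lamValue (t : ℝ) (q : Channel X Y Z) (p : (U × V × W) × X → ℝ) : ℝ :=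
  t * infoWY q p + (1 - t) * infoWZ q p + privateTerm q p

/-- Marton's sum rate expression at `p(u,v,w,x)`:
`min {I(W;Y), I(W;Z)} + I(U;Y|W) + I(V;Z|W) - I(U;V|W)`. -/
noncomputable def martonValue (q : Channel X Y Z) (p : (U × V × W) × X → ℝ) : ℝ :=
  min (infoWY q p) (infoWZ q p) + privateTerm q p

/-- `I(W;Z) + I(X;Y|W)` at `p(w,x)`. -/
noncomputable def boundZY (q : Channel X Y Z) (p : W × X → ℝ) : ℝ :=
  mutualInfo (joint q p) (fun ω => ω.1.1) (fun ω => ω.2.2)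
    + condMutualInfo (joint q p) (fun ω => ω.1.2) (fun ω => ω.2.1) (fun ω => ω.1.1)

/-- `I(W;Y) + I(X;Z|W)` at `p(w,x)`. -/
noncomputable def boundYZ (q : Channel X Y Z) (p : W × X → ℝ) : ℝ :=
  mutualInfo (joint q p) (fun ω => ω.1.1) (fun ω => ω.2.1)
    + condMutualInfo (joint q p) (fun ω => ω.1.2) (fun ω => ω.2.2) (fun ω => ω.1.1)

end Values

/-- The values of the `t`-sum rate over all `p(u,v,w|x)`, for a given input law `p(x)`. The
auxiliary alphabets range over all finite sets. -/
def lamSetAt (t : ℝ) (q : Channel X Y Z) (p : X → ℝ) : Set ℝ :=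
  {r | ∃ (a b c : ℕ) (κ : X → Fin a × Fin b × Fin c → ℝ),
    (∀ x, κ x ∈ stdSimplex ℝ (Fin a × Fin b × Fin c)) ∧ r = lamValue t q (inputJoint p κ)}

/-- `t-SR(q, p(x))`. -/
noncomputable def lamSRAt (t : ℝ) (q : Channel X Y Z) (p : X → ℝ) : ℝ :=
  sSup (lamSetAt t q p)

/-- The values of the `t`-sum rate over all `p(u,v,w,x)`. -/
def lamSet (t : ℝ) (q : Channel X Y Z) : Set ℝ :=
  {r | ∃ (a b c : ℕ) (p : (Fin a × Fin b × Fin c) × X → ℝ),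
    p ∈ stdSimplex ℝ ((Fin a × Fin b × Fin c) × X) ∧ r = lamValue t q p}

/-- `t-SR(q)`. -/
noncomputable def lamSR (t : ℝ) (q : Channel X Y Z) : ℝ :=
  sSup (lamSet t q)

/-- The values of Marton's sum rate expression over all `p(u,v,w,x)`. -/
def martonSet (q : Channel X Y Z) : Set ℝ :=
  {r | ∃ (a b c : ℕ) (p : (Fin a × Fin b × Fin c) × X → ℝ),
    p ∈ stdSimplex ℝ ((Fin a × Fin b × Fin c) × X) ∧ r = martonValue q p}

/-- Marton's sum rate. -/
noncomputable def martonSumRate (q : Channel X Y Z) : ℝ :=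
  sSup (martonSet q)

end SumRates

section Capacity

variable {X Y Z : Type*} [Fintype Y] [Fintype Z]

/-- A code of block length `n` with `M₁` messages for `Y` and `M₂` messages for `Z`. -/
structure Code (X Y Z : Type*) (n M₁ M₂ : ℕ) where
  enc : Fin M₁ × Fin M₂ → Fin n → X
  dec₁ : (Fin n → Y) → Fin M₁
  dec₂ : (Fin n → Z) → Fin M₂

/-- The error probability of receiver `Y` for independent uniform messages. -/
noncomputable def Code.err₁ {n M₁ M₂ : ℕ} (c : Code X Y Z n M₁ M₂) (q : Channel X Y Z) : ℝ :=
  (∑ m : Fin M₁ × Fin M₂, ∑ y : Fin n → Y, ∑ z : Fin n → Z,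
    if c.dec₁ y = m.1 then 0 else ∏ i, q.prob (c.enc m i) (y i) (z i)) / ((M₁ : ℝ) * (M₂ : ℝ))

/-- The error probability of receiver `Z` for independent uniform messages. -/
noncomputable def Code.err₂ {n M₁ M₂ : ℕ} (c : Code X Y Z n M₁ M₂) (q : Channel X Y Z) : ℝ :=
  (∑ m : Fin M₁ × Fin M₂, ∑ y : Fin n → Y, ∑ z : Fin n → Z,
    if c.dec₂ z = m.2 then 0 else ∏ i, q.prob (c.enc m i) (y i) (z i)) / ((M₁ : ℝ) * (M₂ : ℝ))

/-- The nonnegative rate pair `R` is achievable: there are codes with message sets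
`[1 : 2^(n R₁)] × [1 : 2^(n R₂)]`, one for each block length `n`, whose two error probabilities
tend to zero. -/
def IsAchievable (q : Channel X Y Z) (R : ℝ × ℝ) : Prop :=
  0 ≤ R.1 ∧ 0 ≤ R.2 ∧
    ∃ c : ∀ n : ℕ, Code X Y Z n ⌊(2 : ℝ) ^ ((n : ℝ) * R.1)⌋₊ ⌊(2 : ℝ) ^ ((n : ℝ) * R.2)⌋₊,
      Filter.Tendsto (fun n => (c n).err₁ q) Filter.atTop (nhds 0) ∧
      Filter.Tendsto (fun n => (c n).err₂ q) Filter.atTop (nhds 0)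

/-- The capacity region: the closure of the set of achievable rate pairs. -/
def capacityRegion (q : Channel X Y Z) : Set (ℝ × ℝ) :=
  closure {R | IsAchievable q R}

/-- The sum rates of the points of the capacity region. -/
def sumRates (q : Channel X Y Z) : Set ℝ :=
  (fun R : ℝ × ℝ => R.1 + R.2) '' capacityRegion q

/-- The optimal sum rate `SR*(q)`. -/
noncomputable def optimalSumRate (q : Channel X Y Z) : ℝ :=
  sSup (sumRates q)

end Capacity

end BC

set_option linter.unusedSectionVars false

namespace BC

/-! ### Entropy of functions on a finite sample space. -/

section EntropyCalculus

variable {Ω Ω' A B C D : Type*} [Fintype Ω] [Fintype Ω'] [Fintype A] [Fintype B] [Fintype C]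
  [Fintype D]

/-! Three inequalities carry the theorem: SR* is at most 0-SR and 1-SR (converse), SR is at most SR*
(achievability), and if the minimum of λ-SR over [0,1] is at an endpoint t₀ then t₀-SR is at most
SR. Together they force equality. Exchanging the receivers turns λ = 1 into λ = 0, so only one
endpoint is treated.

Endpoint formula. At λ = 0 the chain rule merges I(W;Z) + I(V;Z|W) into I(V,W;Z), while I(U;Y|W) -
I(U;V|W) ≤ I(U;Y|V,W) ≤ I(X;Y|V,W); hence (V,W) serves as a new W (`lamValue_zero_le_boundZY`), with
equality for U = X and V constant. The maximum exists although the alphabet of W is unbounded: the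
expression is H(Z), a function of p(x), plus the average over W of a continuous function of the
input law given W. So it is a continuous function on the convex hull of a compact graph, which is
compact by Carathéodory.

Converse. Fano's inequality bounds log M₁ + log M₂ by I(M₂;Z^n) + I(M₁;Y^n|M₂) up to small terms.
With W_i = (M₂, Z_1..Z_{i-1}, Y_{i+1}..Y_n) this is at most the sum over i of I(W_i;Z_i) +
I(X_i;Y_i|W_i) (`Code.sum_info_le`); Csiszár's sum identity appears as a telescoping sum of
entropies.

Achievability. No typical sequences are used. A random codebook has clouds w with satellites u and v
independent given w. The encoder draws a bin member with probability proportional to the density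
p(u,v|w)/(p(u|w)p(v|w)), and the decoders draw from likelihoods. The tangent plane of 1/(xyz) at
(1,1,1) bounds the mean success below by an explicit ratio (`likelihood_success_ge`), hence the
error by five terms K^s E[g^s]. For n independent copies E[g^s] becomes an nth power, and the
derivative at s = 0 of exp(ρs) E[g^s] is ρ + E[log g]; each rate condition makes it negative, so all
five terms vanish for one small s > 0. Finally the random choices are removed by averaging.

Endpoint minimum. A near-maximiser at a point t close to t₀ nearly attains t₀-SR. As the value at t₀
cannot exceed t₀-SR, the slope I(W;Y) - I(W;Z) has, up to a small error, the sign that makes the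
term selected by t₀ the minimum in Marton's expression (`lamSR_le_martonSumRate`). -/

theorem sum_law_mul (P : Ω → ℝ) (f : Ω → A) (φ : A → ℝ) :
    ∑ a, law P f a * φ a = ∑ ω, P ω * φ (f ω) := by
  classical
  simp only [law, Finset.sum_mul, ite_mul, zero_mul]
  rw [Finset.sum_comm]
  refine Finset.sum_congr rfl fun ω _ => ?_
  rw [Finset.sum_ite_eq]
  simp

theorem sum_law (P : Ω → ℝ) (f : Ω → A) : ∑ a, law P f a = ∑ ω, P ω := by
  simpa using sum_law_mul P f (fun _ => 1)

theorem law_nonneg {P : Ω → ℝ} (hP : ∀ ω, 0 ≤ P ω) (f : Ω → A) (a : A) : 0 ≤ law P f a :=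
  Finset.sum_nonneg fun ω _ => by split_ifs <;> simp [hP]

theorem le_law {P : Ω → ℝ} (hP : ∀ ω, 0 ≤ P ω) (f : Ω → A) (ω : Ω) : P ω ≤ law P f (f ω) := by
  classical
  have := Finset.single_le_sum (f := fun ω' => if f ω' = f ω then P ω' else 0)
    (fun ω' _ => by split_ifs <;> simp [hP]) (Finset.mem_univ ω)
  simpa [law] using this

theorem law_mono_of_imp {P : Ω → ℝ} (hP : ∀ ω, 0 ≤ P ω) {f : Ω → A} {g : Ω → B} {ω : Ω}
    (h : ∀ ω', f ω' = f ω → g ω' = g ω) : law P f (f ω) ≤ law P g (g ω) := by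
  refine Finset.sum_le_sum fun ω' _ => ?_
  by_cases h1 : f ω' = f ω
  · rw [if_pos h1, if_pos (h ω' h1)]
  · rw [if_neg h1]; split_ifs <;> simp [hP]

theorem law_map (P : Ω → ℝ) (φ : Ω → Ω') (f : Ω' → A) (a : A) :
    law (law P φ) f a = law P (fun ω => f (φ ω)) a := by
  classical
  have := sum_law_mul P φ (fun ω' => if f ω' = a then 1 else 0)
  simpa [law] using this

theorem entropy_map (P : Ω → ℝ) (φ : Ω → Ω') (f : Ω' → A) :
    entropy (law P φ) f = entropy P (fun ω => f (φ ω)) := by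
  simp only [entropy, law_map]

theorem law_prod_sum (P : Ω → ℝ) (f : Ω → A) (g : Ω → B) (b : B) :
    ∑ a, law P (fun ω => (f ω, g ω)) (a, b) = law P g b := by
  classical
  simp only [law, Prod.mk.injEq]
  rw [Finset.sum_comm]
  refine Finset.sum_congr rfl fun ω _ => ?_
  by_cases h : g ω = b <;> simp [h]

theorem entropy_eq (P : Ω → ℝ) (f : Ω → A) :
    entropy P f = -(∑ ω, P ω * Real.log (law P f (f ω))) / Real.log 2 := by
  rw [entropy, ← sum_law_mul P f (fun a => Real.log (law P f a)), ← Finset.sum_neg_distrib]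
  simp [Real.negMulLog]

theorem log_two_pos : 0 < Real.log 2 := Real.log_pos one_lt_two

/-- The hypothesis says that f refines g, so every atom of f lies inside an atom of g and the
comparison is pointwise in ω. -/
theorem entropy_mono {P : Ω → ℝ} (hP : ∀ ω, 0 ≤ P ω) {f : Ω → A} {g : Ω → B}
    (h : ∀ ω ω', f ω = f ω' → g ω = g ω') : entropy P g ≤ entropy P f := by
  rw [entropy_eq, entropy_eq]
  refine div_le_div_of_nonneg_right (neg_le_neg (Finset.sum_le_sum fun ω _ => ?_)) log_two_pos.le
  rcases (hP ω).eq_or_lt with h0 | h0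
  · simp [← h0]
  · exact mul_le_mul_of_nonneg_left (Real.log_le_log (h0.trans_le (le_law hP f ω))
      (law_mono_of_imp hP fun ω' => h ω' ω)) h0.le

/-- Entropy sees only the partition into fibres. All regrouping and reordering of variables below
goes through this fact. -/
theorem entropy_congr {P : Ω → ℝ} {f : Ω → A} {g : Ω → B}
    (h : ∀ ω ω', f ω = f ω' ↔ g ω = g ω') : entropy P f = entropy P g := by
  rw [entropy_eq, entropy_eq]
  classical
  have hlaw : ∀ ω, law P f (f ω) = law P g (g ω) := fun ω =>
    Finset.sum_congr rfl fun ω' _ => if_congr (h ω' ω) rfl rfl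
  simp only [hlaw]

/-- Gibbs' inequality: the conditional entropy is at most any cross entropy. -/
theorem condEntropy_le_cross {P : Ω → ℝ} (hP : ∀ ω, 0 ≤ P ω) (f : Ω → A) (g : Ω → B)
    (r : B → A → ℝ) (hr : ∀ b a, 0 ≤ r b a) (hsum : ∀ b, ∑ a, r b a ≤ 1)
    (hpos : ∀ ω, P ω ≠ 0 → 0 < r (g ω) (f ω)) :
    condEntropy P f g ≤ -(∑ ω, P ω * Real.log (r (g ω) (f ω))) / Real.log 2 := by
  -- The mean likelihood ratio is at most the total mass; together with log t ≤ t - 1 at each ω this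
  -- gives the inequality.
  have hkey : ∑ ω, P ω * (r (g ω) (f ω) * law P g (g ω) / law P (fun ω => (f ω, g ω)) (f ω, g ω))
      ≤ ∑ ω, P ω := by
    rw [← sum_law_mul P (fun ω => (f ω, g ω))
      (fun s => r s.2 s.1 * law P g s.2 / law P (fun ω => (f ω, g ω)) s)]
    calc _ ≤ ∑ s : A × B, r s.2 s.1 * law P g s.2 := by
          refine Finset.sum_le_sum fun s _ => ?_
          by_cases h0 : law P (fun ω => (f ω, g ω)) s = 0
          · rw [h0, zero_mul]; exact mul_nonneg (hr _ _) (law_nonneg hP _ _)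
          · rw [mul_div_cancel₀ _ h0]
      _ = ∑ b, (∑ a, r b a) * law P g b := by
          rw [Fintype.sum_prod_type, Finset.sum_comm]
          simp only [Finset.sum_mul]
      _ ≤ ∑ b, law P g b := Finset.sum_le_sum fun b _ =>
          mul_le_of_le_one_left (law_nonneg hP _ _) (hsum b)
      _ = _ := sum_law P g
  have hpt : ∀ ω, P ω * Real.log (r (g ω) (f ω)) + P ω * Real.log (law P g (g ω))
      - P ω * Real.log (law P (fun ω => (f ω, g ω)) (f ω, g ω)) ≤
      P ω * (r (g ω) (f ω) * law P g (g ω) / law P (fun ω => (f ω, g ω)) (f ω, g ω)) - P ω := by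
    intro ω
    rcases (hP ω).eq_or_lt with h0 | h0
    · simp [← h0]
    have h1 := h0.trans_le (le_law hP g ω)
    have h2 := h0.trans_le (le_law hP (fun ω => (f ω, g ω)) ω)
    have h3 := hpos ω h0.ne'
    have := Real.log_le_sub_one_of_pos (div_pos (mul_pos h3 h1) h2)
    rw [Real.log_div (mul_pos h3 h1).ne' h2.ne', Real.log_mul h3.ne' h1.ne'] at this
    nlinarith
  have := Finset.sum_le_sum fun ω (_ : ω ∈ Finset.univ) => hpt ω
  simp only [Finset.sum_sub_distrib, Finset.sum_add_distrib] at this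
  rw [condEntropy, entropy_eq, entropy_eq, ← sub_div]
  refine div_le_div_of_nonneg_right ?_ log_two_pos.le
  linarith

/-- Gibbs' inequality with the kernel P(f|h), which ignores g: its cross entropy is exactly H(f|h).
-/
theorem condEntropy_le_condEntropy {P : Ω → ℝ} (hP : ∀ ω, 0 ≤ P ω) (f : Ω → A) (g : Ω → B)
    (h : Ω → C) : condEntropy P f (fun ω => (g ω, h ω)) ≤ condEntropy P f h := by
  refine (condEntropy_le_cross hP f (fun ω => (g ω, h ω))
    (fun s a => law P (fun ω => (f ω, h ω)) (a, s.2) / law P h s.2) (fun b a =>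
      div_nonneg (law_nonneg hP _ _) (law_nonneg hP _ _)) (fun b => ?_) (fun ω hω => ?_)).trans ?_
  · rw [← Finset.sum_div, law_prod_sum]
    exact div_self_le_one _
  · have h0 := (hP ω).lt_of_ne' hω
    exact div_pos (h0.trans_le (le_law hP (fun ω => (f ω, h ω)) ω)) (h0.trans_le (le_law hP h ω))
  · rw [condEntropy, entropy_eq, entropy_eq, ← sub_div]
    refine div_le_div_of_nonneg_right (le_of_eq ?_) log_two_pos.le
    rw [neg_sub_neg, ← Finset.sum_sub_distrib, ← Finset.sum_neg_distrib]
    refine Finset.sum_congr rfl fun ω _ => ?_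
    rcases (hP ω).eq_or_lt with h0 | h0
    · simp [← h0]
    have h1 := h0.trans_le (le_law hP h ω)
    have h2 := h0.trans_le (le_law hP (fun ω => (f ω, h ω)) ω)
    simp only
    rw [Real.log_div h2.ne' h1.ne']
    ring

/-- Submodularity of entropy on the lattice of partitions of the sample space. -/
theorem entropy_submod {P : Ω → ℝ} (hP : ∀ ω, 0 ≤ P ω) {u : Ω → A} {v : Ω → B} {t : Ω → C}
    {w : Ω → D} (hu : ∀ ω ω', u ω = u ω' → w ω = w ω') (hv : ∀ ω ω', v ω = v ω' → w ω = w ω')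
    (ht : ∀ ω ω', u ω = u ω' → v ω = v ω' → t ω = t ω') :
    entropy P t + entropy P w ≤ entropy P u + entropy P v := by
  have h1 := condEntropy_le_condEntropy hP u v w
  simp only [condEntropy] at h1
  have h2 : entropy P t ≤ entropy P (fun ω => (u ω, v ω, w ω)) :=
    entropy_mono hP fun ω ω' h => by
      simp only [Prod.mk.injEq] at h; exact ht _ _ h.1 h.2.1
  have h3 : entropy P (fun ω => (u ω, w ω)) = entropy P u := entropy_congr fun ω ω' => by
    simp only [Prod.mk.injEq]; exact ⟨fun h => h.1, fun h => ⟨h, hu _ _ h⟩⟩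
  have h4 : entropy P (fun ω => (v ω, w ω)) = entropy P v := entropy_congr fun ω ω' => by
    simp only [Prod.mk.injEq]; exact ⟨fun h => h.1, fun h => ⟨h, hv _ _ h⟩⟩
  linarith

theorem condEntropy_le_log_card {P : Ω → ℝ} (hP : P ∈ stdSimplex ℝ Ω) (f : Ω → A) (g : Ω → B) :
    condEntropy P f g ≤ Real.logb 2 (Fintype.card A) := by
  obtain ⟨ω₀⟩ : Nonempty Ω := by
    by_contra h; rw [not_nonempty_iff] at h; simpa using hP.2
  have hA : (0 : ℝ) < Fintype.card A := by
    have : Nonempty A := ⟨f ω₀⟩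
    exact_mod_cast Fintype.card_pos
  refine (condEntropy_le_cross hP.1 f g (fun _ _ => (Fintype.card A : ℝ)⁻¹)
    (fun _ _ => by positivity) (fun _ => ?_) (fun _ _ => by positivity)).trans ?_
  · simp [hA.ne']
  · rw [← Finset.sum_mul, hP.2, one_mul, Real.log_inv, neg_neg, Real.logb]

theorem entropy_const {P : Ω → ℝ} (hP : P ∈ stdSimplex ℝ Ω) (c : A) :
    entropy P (fun _ => c) = 0 := by
  rw [entropy_eq]
  simp [law, hP.2]

/-- Fano's inequality. -/
theorem fano {P : Ω → ℝ} (hP : P ∈ stdSimplex ℝ Ω) {m : ℕ} (f : Ω → Fin m) (g : Ω → B)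
    (d : B → Fin m) :
    condEntropy P f g ≤
      1 + (∑ ω, if d (g ω) = f ω then 0 else P ω) * Real.logb 2 m := by
  classical
  obtain ⟨ω₀⟩ : Nonempty Ω := by
    by_contra h; rw [not_nonempty_iff] at h; simpa using hP.2
  have hm : (0 : ℝ) < m := by exact_mod_cast (f ω₀).pos
  -- Half of the mass sits on the decoded value, the other half is spread uniformly. The code length
  -- is 1 bit when decoding is correct and 1 + log m bits otherwise.
  refine (condEntropy_le_cross hP.1 f g (fun b a => if d b = a then 1 / 2 else 1 / (2 * m))
    (fun _ _ => by split_ifs <;> positivity) (fun b => ?_)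
    (fun _ _ => by split_ifs <;> positivity)).trans ?_
  · calc ∑ a, (if d b = a then (1 : ℝ) / 2 else 1 / (2 * m))
        ≤ ∑ a, ((if d b = a then (1 : ℝ) / 2 else 0) + 1 / (2 * m)) := by
          refine Finset.sum_le_sum fun a _ => ?_
          split_ifs
          · have : (0 : ℝ) < 1 / (2 * m) := by positivity
            linarith
          · simp
      _ = 1 := by
          rw [Finset.sum_add_distrib, Finset.sum_ite_eq]
          simp
          field_simp
          norm_num
  · rw [div_le_iff₀ log_two_pos, add_mul, one_mul, mul_assoc, Real.logb,
      div_mul_cancel₀ _ log_two_pos.ne', Finset.sum_mul]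
    have h1 : Real.log 2 = ∑ ω, P ω * Real.log 2 := by rw [← Finset.sum_mul, hP.2, one_mul]
    rw [h1]
    rw [← Finset.sum_add_distrib, ← Finset.sum_neg_distrib]
    refine le_of_eq (Finset.sum_congr rfl fun ω _ => ?_)
    split_ifs with h
    · rw [one_div, Real.log_inv]; ring
    · rw [one_div, Real.log_inv, Real.log_mul two_ne_zero hm.ne']; ring

/-- The conditional entropy of the output of a kernel `K`. -/
theorem condEntropy_of_kernel {P : Ω → ℝ} (hP : ∀ ω, 0 ≤ P ω) (y : Ω → B) (s : Ω → A)
    (x : A → C) (K : C → B → ℝ)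
    (hK : ∀ a b, law P (fun ω => (y ω, s ω)) (b, a) = law P s a * K (x a) b) :
    condEntropy P y s = -(∑ ω, P ω * Real.log (K (x (s ω)) (y ω))) / Real.log 2 := by
  rw [condEntropy, entropy_eq, entropy_eq, ← sub_div, neg_sub_neg, ← Finset.sum_sub_distrib,
    ← Finset.sum_neg_distrib]
  congr 1
  refine Finset.sum_congr rfl fun ω _ => ?_
  rcases (hP ω).eq_or_lt with h0 | h0
  · simp [← h0]
  have h1 := h0.trans_le (le_law hP s ω)
  have h2 := h0.trans_le (le_law hP (fun ω => (y ω, s ω)) ω)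
  rw [hK] at h2 ⊢
  rw [Real.log_mul h1.ne' (pos_of_mul_pos_right h2 h1.le).ne']
  ring

theorem law_mem_stdSimplex {P : Ω → ℝ} (hP : P ∈ stdSimplex ℝ Ω) (f : Ω → A) :
    law P f ∈ stdSimplex ℝ A :=
  ⟨law_nonneg hP.1 f, by rw [sum_law, hP.2]⟩

end EntropyCalculus

end BC

namespace BC

/-! ### The Markov chain through the channel, and the exchange of receivers. -/

section Markov

variable {X Y Z A B C : Type*} [Fintype X] [Fintype Y] [Fintype Z] [Fintype A] [Fintype B]
  [Fintype C]

/-- The channel with the two receivers exchanged. -/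
def Channel.swap (q : Channel X Y Z) : Channel X Z Y where
  prob x z y := q.prob x y z
  prob_nonneg x z y := q.prob_nonneg x y z
  sum_prob x := by rw [Finset.sum_comm, q.sum_prob]

theorem sum_joint (q : Channel X Y Z) (p : A × X → ℝ) (φ : A × X → ℝ) :
    ∑ ω, joint q p ω * φ ω.1 = ∑ s, p s * φ s := by
  rw [Fintype.sum_prod_type]
  refine Finset.sum_congr rfl fun s _ => ?_
  simp only [joint]
  rw [Fintype.sum_prod_type]
  simp only [← Finset.sum_mul, ← Finset.mul_sum, q.sum_prob, mul_one]

theorem joint_nonneg (q : Channel X Y Z) {p : A × X → ℝ} (hp : ∀ s, 0 ≤ p s)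
    (ω : (A × X) × (Y × Z)) : 0 ≤ joint q p ω :=
  mul_nonneg (hp _) (q.prob_nonneg _ _ _)

theorem joint_mem_stdSimplex (q : Channel X Y Z) {p : A × X → ℝ} (hp : p ∈ stdSimplex ℝ (A × X)) :
    joint q p ∈ stdSimplex ℝ ((A × X) × (Y × Z)) :=
  ⟨joint_nonneg q hp.1, by simpa [hp.2] using sum_joint q p (fun _ => 1)⟩

theorem law_joint_input (q : Channel X Y Z) (p : A × X → ℝ) (f : A × X → B) (b : B) :
    law (joint q p) (fun ω => f ω.1) b = law p f b := by
  classical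
  simpa [law] using sum_joint q p (fun s => if f s = b then 1 else 0)

/-- The channel acts on the input alone, so rewriting the auxiliary variable while keeping the input
commutes with passing through the channel. -/
theorem joint_law (q : Channel X Y Z) (p : A × X → ℝ) (φ : A × X → B × X)
    (hφ : ∀ s, (φ s).2 = s.2) :
    joint q (law p φ) = law (joint q p) (fun ω => (φ ω.1, ω.2)) := by
  classical
  funext ⟨t, y, z⟩
  simp only [joint, law, Prod.mk.injEq]
  conv_rhs => rw [Fintype.sum_prod_type]
  rw [Finset.sum_mul]
  refine Finset.sum_congr rfl fun s _ => ?_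
  rw [Fintype.sum_eq_single (y, z) (fun yz h => by simp [h])]
  by_cases h : φ s = t
  · simp [h, ← hφ s]
  · simp [h]

theorem entropy_joint_law (q : Channel X Y Z) (p : A × X → ℝ) (φ : A × X → B × X)
    (hφ : ∀ s, (φ s).2 = s.2) (f : (B × X) × (Y × Z) → C) :
    entropy (joint q (law p φ)) f = entropy (joint q p) (fun ω => f (φ ω.1, ω.2)) := by
  rw [joint_law q p φ hφ, entropy_map]

theorem joint_swap (q : Channel X Y Z) (p : A × X → ℝ) :
    joint q.swap p = law (joint q p) (fun ω => (ω.1, ω.2.2, ω.2.1)) := by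
  classical
  funext ⟨t, z, y⟩
  simp only [joint, law, Channel.swap, Prod.mk.injEq]
  rw [Fintype.sum_prod_type, Fintype.sum_eq_single t (fun s hs => by simp [hs]),
    Fintype.sum_prod_type, Fintype.sum_eq_single y (fun s hs => by simp [hs]),
    Fintype.sum_eq_single z (fun s hs => by simp [hs])]
  simp

theorem entropy_joint_swap (q : Channel X Y Z) (p : A × X → ℝ) (f : (A × X) × (Z × Y) → C) :
    entropy (joint q.swap p) f = entropy (joint q p) (fun ω => f (ω.1, ω.2.2, ω.2.1)) := by
  rw [joint_swap, entropy_map]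

/-- The average of `-log q(y|x)`, the conditional entropy of `Y` given the input. -/
noncomputable def outputEntropy (q : Channel X Y Z) (p : A × X → ℝ) : ℝ :=
  -(∑ ω, joint q p ω * Real.log (∑ z, q.prob ω.1.2 ω.2.1 z)) / Real.log 2

/-- Given the input, the output `Y` is independent of everything before the channel. -/
theorem condEntropy_output (q : Channel X Y Z) {p : A × X → ℝ} (hp : ∀ s, 0 ≤ p s)
    (g : A × X → B) :
    condEntropy (joint q p) (fun ω => ω.2.1) (fun ω => (g ω.1, ω.1.2)) = outputEntropy q p := by
  classical
  refine condEntropy_of_kernel (joint_nonneg q hp) (fun ω => ω.2.1) (fun ω => (g ω.1, ω.1.2))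
    (x := Prod.snd) (K := fun x y => ∑ z, q.prob x y z) fun ⟨b, x⟩ y => ?_
  rw [law_joint_input q p (fun s => (g s, s.2))]
  simp only [law, joint, Prod.mk.injEq, Finset.sum_mul]
  rw [Fintype.sum_prod_type]
  refine Finset.sum_congr rfl fun s _ => ?_
  rw [Fintype.sum_prod_type, Fintype.sum_eq_single y (fun y' hy => by simp [hy])]
  by_cases h : g s = b ∧ s.2 = x
  · simp [h, Finset.mul_sum]
  · simp [h]

end Markov

/-! ### The endpoint rate expressions as signed sums of entropies. -/

section Values

variable {X Y Z U V W W' : Type*} [Fintype X] [Fintype Y] [Fintype Z] [Fintype U] [Fintype V]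
  [Fintype W] [Fintype W']

/-- With everything expanded into joint entropies, the information inequalities below become linear
consequences of submodularity. -/
theorem boundZY_eq (q : Channel X Y Z) (p : W × X → ℝ) :
    boundZY q p = entropy (joint q p) (fun ω => ω.2.2)
      - entropy (joint q p) (fun ω => (ω.1.1, ω.2.2))
      + entropy (joint q p) (fun ω => (ω.2.1, ω.1.1)) + entropy (joint q p) (fun ω => ω.1)
      - entropy (joint q p) (fun ω => (ω.2.1, ω.1)) := by
  rw [entropy_congr (P := joint q p) (f := fun ω => ω.1) (g := fun ω => (ω.1.2, ω.1.1))
    (by simp [Prod.ext_iff, and_comm]), entropy_congr (P := joint q p) (f := fun ω => (ω.2.1, ω.1))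
    (g := fun ω => (ω.1.2, ω.2.1, ω.1.1)) (by simp [Prod.ext_iff]; tauto)]
  simp only [boundZY, mutualInfo, condMutualInfo, condEntropy]
  ring

theorem boundYZ_eq_swap (q : Channel X Y Z) (p : W × X → ℝ) :
    boundYZ q p = boundZY q.swap p := by
  simp only [boundYZ, boundZY, mutualInfo, condMutualInfo, condEntropy, entropy_joint_swap]

theorem boundZY_relabel (q : Channel X Y Z) (p : W × X → ℝ) (e : W → W')
    (he : Function.Injective e) :
    boundZY q (law p (fun s => (e s.1, s.2))) = boundZY q p := by
  simp only [boundZY_eq]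
  simp only [entropy_joint_law q p (fun s => (e s.1, s.2)) (fun _ => rfl)]
  congr 1
  congr 1
  congr 1
  congr 1
  all_goals exact entropy_congr (by simp [Prod.ext_iff, he.eq_iff])

theorem lamValue_zero_eq (q : Channel X Y Z) (p : (U × V × W) × X → ℝ) :
    lamValue 0 q p = entropy (joint q p) (fun ω => ω.2.2)
      - entropy (joint q p) (fun ω => (ω.1.1.1, ω.2.1, ω.1.1.2.2))
      + entropy (joint q p) (fun ω => (ω.2.1, ω.1.1.2.2))
      - entropy (joint q p) (fun ω => (ω.1.1.2, ω.2.2))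
      + entropy (joint q p) (fun ω => ω.1.1) := by
  rw [entropy_congr (P := joint q p) (f := fun ω => ω.1.1)
    (g := fun ω => (ω.1.1.1, ω.1.1.2.1, ω.1.1.2.2))
    (by simp [Prod.ext_iff]), entropy_congr (P := joint q p) (f := fun ω => (ω.1.1.2, ω.2.2))
    (g := fun ω => (ω.1.1.2.1, ω.2.2, ω.1.1.2.2)) (by simp [Prod.ext_iff]; tauto)]
  have h1 : entropy (joint q p) (fun ω => (ω.2.2, ω.1.1.2.2)) =
      entropy (joint q p) (fun ω => (ω.1.1.2.2, ω.2.2)) :=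
    entropy_congr (by simp [and_comm])
  simp only [lamValue, infoWZ, privateTerm, mutualInfo, condMutualInfo, condEntropy] at h1 ⊢
  linarith

theorem lamValue_one_eq_swap (q : Channel X Y Z) (p : (U × V × W) × X → ℝ) :
    lamValue 1 q p = lamValue 0 q.swap (law p (fun s => ((s.1.2.1, s.1.1, s.1.2.2), s.2))) := by
  have h1 : entropy (joint q p) (fun ω => (ω.1.1.2.1, ω.1.1.1, ω.1.1.2.2)) =
      entropy (joint q p) (fun ω => (ω.1.1.1, ω.1.1.2.1, ω.1.1.2.2)) :=
    entropy_congr (by simp; tauto)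
  simp only [lamValue, infoWY, infoWZ, privateTerm, mutualInfo, condMutualInfo, condEntropy,
    entropy_joint_law q.swap p (fun s => ((s.1.2.1, s.1.1, s.1.2.2), s.2)) (fun _ => rfl),
    entropy_joint_swap, h1]
  ring

/-- The new auxiliary variable is (V,W). The two submodularity steps are I(U;V|Y,W) ≥ 0 and
H(Y|U,V,W,X) ≤ H(Y|U,V,W); the Markov property replaces H(Y|U,V,W,X) by H(Y|V,W,X). -/
theorem lamValue_zero_le_boundZY (q : Channel X Y Z) {p : (U × V × W) × X → ℝ}
    (hp : ∀ s, 0 ≤ p s) :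
    lamValue 0 q p ≤ boundZY q (law p (fun s => (s.1.2, s.2))) := by
  have hP := joint_nonneg q hp
  rw [lamValue_zero_eq, boundZY_eq]
  simp only [entropy_joint_law q p (fun s => (s.1.2, s.2)) (fun _ => rfl)]
  have h1 := condEntropy_output q hp (fun s => s.1.2)
  rw [← condEntropy_output q hp (fun s => s.1)] at h1
  simp only [condEntropy] at h1
  have h2 := entropy_submod hP (u := fun ω => (ω.1.1.1, ω.2.1, ω.1.1.2.2))
    (v := fun ω => (ω.2.1, ω.1.1.2)) (t := fun ω => (ω.1.1, ω.2.1))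
    (w := fun ω => (ω.2.1, ω.1.1.2.2)) (by simp) (by simp [Prod.ext_iff])
    (by simp [Prod.ext_iff]; tauto)
  have h3 := entropy_submod hP (u := fun ω => (ω.1.1, ω.2.1))
    (v := fun ω => (ω.1.1, ω.1.2)) (t := fun ω => (ω.2.1, ω.1.1, ω.1.2))
    (w := fun ω => ω.1.1) (fun _ _ h => (Prod.mk.inj h).1) (fun _ _ h => (Prod.mk.inj h).1)
    (by simp [Prod.ext_iff]; tauto)
  linarith

/-- Choosing U = X (up to an injective relabelling) and V constant leaves no loss: the terms
containing V vanish. -/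
theorem boundZY_eq_lamValue_zero (q : Channel X Y Z) (p : W × X → ℝ) (e : X → U)
    (he : Function.Injective e) (v : V) :
    lamValue 0 q (law p (fun s => ((e s.2, v, s.1), s.2))) = boundZY q p := by
  rw [lamValue_zero_eq, boundZY_eq]
  simp only [entropy_joint_law q p (fun s => ((e s.2, v, s.1), s.2)) (fun _ => rfl)]
  rw [entropy_congr (P := joint q p) (f := fun ω => (e ω.1.2, ω.2.1, ω.1.1))
    (g := fun ω => (ω.2.1, ω.1)) (by simp [Prod.ext_iff, he.eq_iff]; tauto),
    entropy_congr (P := joint q p) (f := fun ω => ((v, ω.1.1), ω.2.2))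
    (g := fun ω => (ω.1.1, ω.2.2)) (by simp),
    entropy_congr (P := joint q p) (f := fun ω => (e ω.1.2, v, ω.1.1))
    (g := fun ω => ω.1) (by simp [Prod.ext_iff, he.eq_iff]; tauto)]
  ring

end Values

end BC

namespace BC

/-! ### Compactness of convex hulls in finite dimension. -/

section ConvexHull

/-- By Carathéodory, dim + 1 points suffice, so the hull is a continuous image of a simplex times a
power of s. -/
theorem isCompact_convexHull {E : Type*} [NormedAddCommGroup E] [NormedSpace ℝ E]
    [FiniteDimensional ℝ E] {s : Set E} (hs : IsCompact s) : IsCompact (convexHull ℝ s) := by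
  set N := Module.finrank ℝ E + 1
  have himg : convexHull ℝ s = (fun wz : (Fin N → ℝ) × (Fin N → E) => ∑ i, wz.1 i • wz.2 i) ''
      (stdSimplex ℝ (Fin N) ×ˢ Set.pi Set.univ (fun _ => s)) := by
    refine Set.Subset.antisymm (fun x hx => ?_) ?_
    · obtain ⟨ι, _, z, w, hz, hind, hw, hw1, rfl⟩ := eq_pos_convex_span_of_mem_convexHull hx
      obtain ⟨e⟩ : Nonempty (ι ↪ Fin N) := Function.Embedding.nonempty_of_card_le (by
        simpa using hind.card_le_finrank_succ.trans
          (Nat.succ_le_succ (Submodule.finrank_le (vectorSpan ℝ (Set.range z)))))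
      obtain ⟨i₀⟩ : Nonempty ι := by
        by_contra h; rw [not_nonempty_iff] at h; simp at hw1
      -- A shorter combination is padded with zero weights on a repeated point of s.
      refine ⟨(Function.extend e w 0, Function.extend e z (fun _ => z i₀)), ⟨⟨fun j => ?_, ?_⟩,
        fun j _ => ?_⟩, ?_⟩
      · by_cases hj : ∃ i, e i = j
        · obtain ⟨i, rfl⟩ := hj
          simpa [e.injective.extend_apply] using (hw i).le
        · simp [Function.extend_apply' _ _ _ hj]
      · rw [← hw1]
        refine (Fintype.sum_of_injective e e.injective _ _ (fun j hj => ?_) fun i => ?_).symm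
        · exact Function.extend_apply' _ _ _ hj
        · exact (e.injective.extend_apply _ _ _).symm
      · by_cases hj : ∃ i, e i = j
        · obtain ⟨i, rfl⟩ := hj
          simpa [e.injective.extend_apply] using hz (Set.mem_range_self i)
        · simpa [Function.extend_apply' _ _ _ hj] using hz (Set.mem_range_self i₀)
      · refine (Fintype.sum_of_injective e e.injective _ _ (fun j hj => ?_) fun i => ?_).symm
        · change Function.extend e w (0 : Fin N → ℝ) j • _ = (0 : E)
          rw [Function.extend_apply' _ _ _ hj, Pi.zero_apply, zero_smul]
        · simp [e.injective.extend_apply]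
    · rintro _ ⟨⟨w, z⟩, ⟨hw, hz⟩, rfl⟩
      exact mem_convexHull_of_exists_fintype w z hw.1 hw.2 (fun i => hz i trivial) rfl
  rw [himg]
  refine ((isCompact_stdSimplex ℝ (Fin N)).prod (isCompact_univ_pi fun _ => hs)).image ?_
  fun_prop

end ConvexHull

/-! ### Existence of maximisers without a bound on the auxiliary alphabet. -/

section Attainment

variable {X Y Z W : Type*} [Fintype X] [Fintype Y] [Fintype Z] [Fintype W]

/-- The contribution to `I(W;Z) + I(X;Y|W)`, apart from the term `H(Z)`, of one value of `W`, as a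
homogeneous function of the mass `s` that this value has at each input. -/
noncomputable def sliceValue (q : Channel X Y Z) (s : X → ℝ) : ℝ :=
  (∑ y, Real.negMulLog (∑ x, s x * ∑ z, q.prob x y z)
    - ∑ z, Real.negMulLog (∑ x, s x * ∑ y, q.prob x y z)
    + ∑ x, Real.negMulLog (s x)
    - ∑ x, ∑ y, Real.negMulLog (s x * ∑ z, q.prob x y z)) / Real.log 2

/-- The entropy of `Z` for the input mass function `r`. -/
noncomputable def entropyZ (q : Channel X Y Z) (r : X → ℝ) : ℝ :=
  (∑ z, Real.negMulLog (∑ x, r x * ∑ y, q.prob x y z)) / Real.log 2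

theorem boundZY_eq_sum_sliceValue (q : Channel X Y Z) (p : W × X → ℝ) :
    boundZY q p = entropyZ q (fun x => ∑ w, p (w, x)) + ∑ w, sliceValue q (fun x => p (w, x)) := by
  classical
  have hZ : ∀ z, law (joint q p) (fun ω => ω.2.2) z =
      ∑ x, (∑ w, p (w, x)) * ∑ y, q.prob x y z := fun z => by
    simp only [law, joint, Fintype.sum_prod_type, Finset.sum_ite_eq', Finset.mem_univ, if_true]
    rw [Finset.sum_comm]
    simp only [← Finset.mul_sum, Finset.sum_mul]
  have hWZ : ∀ s : W × Z, law (joint q p) (fun ω => (ω.1.1, ω.2.2)) s =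
      ∑ x, p (s.1, x) * ∑ y, q.prob x y s.2 := fun s => by
    simp only [law, joint, Fintype.sum_prod_type, Prod.ext_iff]
    rw [Fintype.sum_eq_single s.1 (fun w hw => by simp [hw])]
    simp only [true_and, Finset.sum_ite_eq', Finset.mem_univ, if_true, ← Finset.mul_sum]
  have hYW : ∀ s : Y × W, law (joint q p) (fun ω => (ω.2.1, ω.1.1)) s =
      ∑ x, p (s.2, x) * ∑ z, q.prob x s.1 z := fun s => by
    simp only [law, joint, Fintype.sum_prod_type, Prod.ext_iff]
    rw [Fintype.sum_eq_single s.2 (fun w hw => by simp [hw])]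
    refine Finset.sum_congr rfl fun x _ => ?_
    rw [Fintype.sum_eq_single s.1 (fun w hw => by simp [hw])]
    simp [← Finset.mul_sum]
  have hYWX : ∀ s : Y × W × X, law (joint q p) (fun ω => (ω.2.1, ω.1)) s =
      p s.2 * ∑ z, q.prob s.2.2 s.1 z := fun s => by
    simp only [law, joint]
    rw [Fintype.sum_prod_type, Fintype.sum_eq_single s.2 (fun w hw => by simp [Prod.ext_iff, hw]),
      Fintype.sum_prod_type, Fintype.sum_eq_single s.1 (fun w hw => by simp [Prod.ext_iff, hw])]
    simp [← Finset.mul_sum]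
  have hWX : ∀ s : W × X, law (joint q p) (fun ω => ω.1) s = p s := fun s => by
    rw [law_joint_input q p (fun s => s), law, Fintype.sum_eq_single s (fun t ht => by simp [ht]),
      if_pos rfl]
  rw [boundZY_eq]
  simp only [entropy, hZ, hWZ, hYW, hYWX, hWX, sliceValue, entropyZ, ← Finset.sum_div,
    Finset.sum_sub_distrib, Finset.sum_add_distrib]
  simp only [Fintype.sum_prod_type]
  rw [Finset.sum_comm (s := (Finset.univ : Finset Y)) (t := (Finset.univ : Finset W))
    (f := fun y w => Real.negMulLog (∑ x, p (w, x) * ∑ z, q.prob x y z)),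
    Finset.sum_comm (s := (Finset.univ : Finset Y)) (t := (Finset.univ : Finset W))
    (f := fun y w => ∑ x, Real.negMulLog (p (w, x) * ∑ z, q.prob x y z))]
  have : ∀ w, ∑ y, ∑ x, Real.negMulLog (p (w, x) * ∑ z, q.prob x y z) =
      ∑ x, ∑ y, Real.negMulLog (p (w, x) * ∑ z, q.prob x y z) := fun w => Finset.sum_comm
  simp only [this]
  ring

theorem continuous_sliceValue (q : Channel X Y Z) : Continuous (sliceValue q) := by
  unfold sliceValue
  have h := Real.continuous_negMulLog
  fun_prop

theorem continuous_entropyZ (q : Channel X Y Z) : Continuous (entropyZ q) := by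
  unfold entropyZ
  have h := Real.continuous_negMulLog
  fun_prop

/-- Each of the four sums produces a correction, `Real.negMulLog c` times the total mass of s, with
signs +, -, +, -, so the corrections cancel. -/
theorem sliceValue_smul (q : Channel X Y Z) (c : ℝ) (s : X → ℝ) :
    sliceValue q (fun x => c * s x) = c * sliceValue q s := by
  have hy : ∑ y, ∑ x, s x * ∑ z, q.prob x y z = ∑ x, s x := by
    rw [Finset.sum_comm]
    simp only [← Finset.mul_sum, q.sum_prob, mul_one]
  have hz : ∑ z, ∑ x, s x * ∑ y, q.prob x y z = ∑ x, s x := by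
    rw [Finset.sum_comm]
    refine Finset.sum_congr rfl fun x _ => ?_
    rw [← Finset.mul_sum, Finset.sum_comm, q.sum_prob, mul_one]
  simp only [sliceValue, mul_assoc, ← Finset.mul_sum, Real.negMulLog_mul c,
    Finset.sum_add_distrib]
  simp only [← Finset.sum_mul, q.sum_prob, hy, hz]
  ring

/-- The convex hull of the graph of `sliceValue` over the simplex of input laws. -/
def sliceHull (q : Channel X Y Z) : Set ((X → ℝ) × ℝ) :=
  convexHull ℝ ((fun r => (r, sliceValue q r)) '' stdSimplex ℝ X)

theorem isCompact_sliceHull (q : Channel X Y Z) : IsCompact (sliceHull q) :=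
  isCompact_convexHull ((isCompact_stdSimplex ℝ X).image
    (continuous_id.prodMk (continuous_sliceValue q)))

theorem sliceHull_fst_mem (q : Channel X Y Z) {a : (X → ℝ) × ℝ} (ha : a ∈ sliceHull q) :
    a.1 ∈ stdSimplex ℝ X := by
  have : sliceHull q ⊆ Prod.fst ⁻¹' stdSimplex ℝ X := by
    refine convexHull_min ?_ ((convex_stdSimplex ℝ X).linear_preimage (LinearMap.fst ℝ (X → ℝ) ℝ))
    rintro _ ⟨r, hr, rfl⟩
    exact hr
  exact this ha

/-- Each slice p(w,·) is its mass times a probability vector; homogeneity turns the sum over w into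
a convex combination of points of the graph. -/
theorem exists_sliceHull_of_input (q : Channel X Y Z) [Nonempty X] {p : W × X → ℝ}
    (hp : p ∈ stdSimplex ℝ (W × X)) :
    ((fun x => ∑ w, p (w, x)), ∑ w, sliceValue q (fun x => p (w, x))) ∈ sliceHull q := by
  classical
  set l : W → ℝ := fun w => ∑ x, p (w, x)
  have hl : ∀ w, 0 ≤ l w := fun w => Finset.sum_nonneg fun x _ => hp.1 _
  -- A value of W of mass zero gets an arbitrary point of the simplex, taken with weight zero.
  let r : W → X → ℝ := fun w => if l w = 0 then Pi.single (Classical.arbitrary X) 1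
    else fun x => p (w, x) / l w
  have hr : ∀ w, r w ∈ stdSimplex ℝ X := fun w => by
    by_cases h : l w = 0
    · simp only [r, h, if_true]; exact single_mem_stdSimplex ℝ _
    · simp only [r, h, if_false]
      exact ⟨fun x => div_nonneg (hp.1 _) (hl w), by rw [← Finset.sum_div]; exact div_self h⟩
  have hlr : ∀ w x, p (w, x) = l w * r w x := fun w x => by
    by_cases h : l w = 0
    · rw [h, zero_mul]
      exact (Finset.sum_eq_zero_iff_of_nonneg fun x _ => hp.1 _).1 h x (Finset.mem_univ x)
    · simp only [r, h, if_false]; field_simp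
  refine mem_convexHull_of_exists_fintype l (fun w => (r w, sliceValue q (r w))) hl ?_
    (fun w => ⟨r w, hr w, rfl⟩) ?_
  · rw [← hp.2, Fintype.sum_prod_type]
  · simp only [hlr, sliceValue_smul]
    refine Prod.ext ?_ ?_
    · ext x; simp [Prod.fst_sum]
    · simp [Prod.snd_sum]

theorem inputJoint_mem_stdSimplex {p : X → ℝ} (hp : p ∈ stdSimplex ℝ X) {κ : X → W → ℝ}
    (hκ : ∀ x, κ x ∈ stdSimplex ℝ W) : inputJoint p κ ∈ stdSimplex ℝ (W × X) := by
  refine ⟨fun s => mul_nonneg (hp.1 _) ((hκ _).1 _), ?_⟩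
  simp only [inputJoint, Fintype.sum_prod_type]
  rw [Finset.sum_comm]
  simp only [← Finset.mul_sum, (hκ _).2, mul_one, hp.2]

theorem sum_inputJoint (p : X → ℝ) {κ : X → W → ℝ} (hκ : ∀ x, κ x ∈ stdSimplex ℝ W) :
    (fun x => ∑ w, inputJoint p κ (w, x)) = p := by
  funext x
  simp only [inputJoint, ← Finset.mul_sum, (hκ _).2, mul_one]

/-- Bayes' rule: the weights of a convex combination are the law of W, its points are the
conditional laws of X given W, and κ is the reversed kernel. -/
theorem exists_input_of_sliceHull (q : Channel X Y Z) {a : (X → ℝ) × ℝ} (ha : a ∈ sliceHull q) :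
    ∃ (c : ℕ) (κ : X → Fin c → ℝ), (∀ x, κ x ∈ stdSimplex ℝ (Fin c)) ∧
      boundZY q (inputJoint a.1 κ) = entropyZ q a.1 + a.2 := by
  classical
  have ha1 := sliceHull_fst_mem q ha
  obtain ⟨ι, _, l, z, hl, hl1, hz, rfl⟩ := mem_convexHull_iff_exists_fintype.1 ha
  choose r hr hrz using hz
  obtain rfl : z = fun i => (r i, sliceValue q (r i)) := funext fun i => (hrz i).symm
  have e := Fintype.equivFin ι
  set p : X → ℝ := fun x => ∑ i, l i * r i x
  have hp : (∑ i, l i • (r i, sliceValue q (r i))).1 = p := by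
    ext x; simp [p, Prod.fst_sum]
  rw [hp] at ha1 ⊢
  -- At inputs of probability zero the unconditional weights are used, which keeps κ x a probability
  -- vector.
  let κ : X → Fin (Fintype.card ι) → ℝ := fun x j =>
    if p x = 0 then l (e.symm j) else l (e.symm j) * r (e.symm j) x / p x
  have hκ : ∀ x, κ x ∈ stdSimplex ℝ (Fin (Fintype.card ι)) := fun x => by
    refine ⟨fun j => ?_, ?_⟩
    · simp only [κ]; split_ifs
      · exact hl _
      · exact div_nonneg (mul_nonneg (hl _) ((hr _).1 _)) (ha1.1 _)
    · simp only [κ]; split_ifs with h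
      · rw [← hl1]; exact e.symm.sum_comp l
      · rw [← Finset.sum_div, e.symm.sum_comp (fun i => l i * r i x)]; exact div_self h
  have hj : ∀ j x, inputJoint p κ (j, x) = l (e.symm j) * r (e.symm j) x := fun j x => by
    simp only [inputJoint, κ]
    split_ifs with h
    · rw [h, zero_mul]
      exact ((Finset.sum_eq_zero_iff_of_nonneg fun i _ => mul_nonneg (hl _) ((hr i).1 _)).1 h
        (e.symm j) (Finset.mem_univ _)).symm
    · field_simp
  refine ⟨_, κ, hκ, ?_⟩
  rw [boundZY_eq_sum_sliceValue, sum_inputJoint p hκ]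
  simp only [hj, sliceValue_smul]
  rw [e.symm.sum_comp (fun i => l i * sliceValue q (r i))]
  simp [Prod.snd_sum]

theorem exists_isGreatest_boundZY_at [Nonempty X] (q : Channel X Y Z) {p : X → ℝ}
    (hp : p ∈ stdSimplex ℝ X) :
    ∃ m, IsGreatest {r | ∃ (c : ℕ) (κ : X → Fin c → ℝ), (∀ x, κ x ∈ stdSimplex ℝ (Fin c)) ∧
      r = boundZY q (inputJoint p κ)} m := by
  -- With p(x) fixed H(Z) is constant, so it remains to maximise the second coordinate on a compact
  -- fibre of the hull.
  have hK : IsCompact (sliceHull q ∩ {a | a.1 = p}) :=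
    (isCompact_sliceHull q).inter_right (isClosed_singleton.preimage continuous_fst)
  obtain ⟨⟨p', t⟩, ⟨ha, rfl⟩, hmax⟩ := hK.exists_isMaxOn
    ⟨(p, sliceValue q p), subset_convexHull _ _ ⟨p, hp, rfl⟩, rfl⟩ continuous_snd.continuousOn
  obtain ⟨c, κ, hκ, h⟩ := exists_input_of_sliceHull q ha
  refine ⟨_, ⟨c, κ, hκ, h.symm⟩, ?_⟩
  rintro _ ⟨c, κ, hκ, rfl⟩
  have := exists_sliceHull_of_input q (inputJoint_mem_stdSimplex hp hκ)
  rw [boundZY_eq_sum_sliceValue]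
  rw [sum_inputJoint _ hκ] at this ⊢
  have := hmax ⟨this, rfl⟩
  simp only [Set.mem_ofPred_eq] at this
  simpa using this

theorem exists_isGreatest_boundZY [Nonempty X] (q : Channel X Y Z) :
    ∃ m, IsGreatest {r | ∃ (c : ℕ) (p : Fin c × X → ℝ), p ∈ stdSimplex ℝ (Fin c × X) ∧
      r = boundZY q p} m := by
  classical
  have hne : (sliceHull q).Nonempty :=
    convexHull_nonempty_iff.2 (Set.Nonempty.image _
      ⟨_, single_mem_stdSimplex ℝ (Classical.arbitrary X)⟩)
  have hcont : Continuous fun a : (X → ℝ) × ℝ => entropyZ q a.1 + a.2 :=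
    ((continuous_entropyZ q).comp continuous_fst).add continuous_snd
  obtain ⟨a, ha, hmax⟩ := (isCompact_sliceHull q).exists_isMaxOn hne hcont.continuousOn
  have hmax' : ∀ r t, (r, t) ∈ sliceHull q → entropyZ q r + t ≤ entropyZ q a.1 + a.2 :=
    fun r t h => isMaxOn_iff.1 hmax (r, t) h
  obtain ⟨c, κ, hκ, h⟩ := exists_input_of_sliceHull q ha
  have hp := inputJoint_mem_stdSimplex (sliceHull_fst_mem q ha) hκ
  refine ⟨entropyZ q a.1 + a.2, ⟨c, inputJoint a.1 κ, hp, h.symm⟩, ?_⟩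
  rintro r ⟨c', p, hp, hr⟩
  rw [hr, boundZY_eq_sum_sliceValue]
  exact hmax' _ _ (exists_sliceHull_of_input q hp)

end Attainment

end BC

namespace BC

/-! ### Attained endpoint rates, boundedness, and the endpoint argument. -/

section SumRateSets

variable {X Y Z A B : Type*} [Fintype X] [Fintype Y] [Fintype Z] [Fintype A] [Fintype B]

theorem law_inputJoint (p : X → ℝ) (κ : X → A → ℝ) (ψ : X → A → B) :
    law (inputJoint p κ) (fun s => (ψ s.2 s.1, s.2)) = inputJoint p (fun x => law (κ x) (ψ x)) := by
  classical
  funext ⟨b, x⟩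
  simp only [law, inputJoint, Prod.mk.injEq, Finset.mul_sum, mul_ite, mul_zero]
  rw [Fintype.sum_prod_type]
  refine Finset.sum_congr rfl fun a _ => ?_
  rw [Fintype.sum_eq_single x (fun x' hx => by simp [hx])]
  simp

theorem law_law (P : A → ℝ) {C : Type*} [Fintype C] (f : A → B) (g : B → C) :
    law (law P f) g = law P (fun a => g (f a)) :=
  funext fun _ => law_map _ _ _ _

/-- The two sets have the same greatest element: U = X with V on a one-point alphabet gives one
direction, merging V and W into a single finite alphabet the other. -/
theorem exists_isGreatest_lamSetAt_zero [Nonempty X] (q : Channel X Y Z) {p : X → ℝ}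
    (hp : p ∈ stdSimplex ℝ X) :
    IsGreatest (lamSetAt 0 q p) (lamSRAt 0 q p) ∧
      IsGreatest {r | ∃ (c : ℕ) (κ : X → Fin c → ℝ), (∀ x, κ x ∈ stdSimplex ℝ (Fin c)) ∧
        r = boundZY q (inputJoint p κ)} (lamSRAt 0 q p) := by
  obtain ⟨m, hm⟩ := exists_isGreatest_boundZY_at q hp
  have h : IsGreatest (lamSetAt 0 q p) m := by
    constructor
    · obtain ⟨c, κ, hκ, rfl⟩ := hm.1
      have e := Fintype.equivFin X
      refine ⟨Fintype.card X, 1, c, fun x => law (κ x) (fun w => (e x, 0, w)),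
        fun x => law_mem_stdSimplex (hκ x) _, ?_⟩
      rw [← law_inputJoint p κ (fun x w => (e x, (0 : Fin 1), w)),
        boundZY_eq_lamValue_zero q _ e e.injective]
    · rintro _ ⟨a, b, c, κ, hκ, rfl⟩
      refine (lamValue_zero_le_boundZY q (inputJoint_mem_stdSimplex hp hκ).1).trans (hm.2
        ⟨b * c, fun x => law (κ x) (fun u => finProdFinEquiv u.2),
          fun x => law_mem_stdSimplex (hκ x) _, ?_⟩)
      rw [← boundZY_relabel q _ finProdFinEquiv finProdFinEquiv.injective,
        ← law_inputJoint p κ (fun _ u => finProdFinEquiv u.2), law_law]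
  rw [lamSRAt, h.csSup_eq]
  exact ⟨h, hm⟩

theorem exists_isGreatest_lamSet_zero [Nonempty X] (q : Channel X Y Z) :
    IsGreatest (lamSet 0 q) (lamSR 0 q) ∧
      IsGreatest {r | ∃ (c : ℕ) (p : Fin c × X → ℝ), p ∈ stdSimplex ℝ (Fin c × X) ∧
        r = boundZY q p} (lamSR 0 q) := by
  obtain ⟨m, hm⟩ := exists_isGreatest_boundZY q
  have h : IsGreatest (lamSet 0 q) m := by
    constructor
    · obtain ⟨c, p, hp, rfl⟩ := hm.1
      have e := Fintype.equivFin X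
      exact ⟨Fintype.card X, 1, c, _, law_mem_stdSimplex hp _,
        (boundZY_eq_lamValue_zero q p e e.injective (0 : Fin 1)).symm⟩
    · rintro _ ⟨a, b, c, p, hp, rfl⟩
      refine (lamValue_zero_le_boundZY q hp.1).trans (hm.2
        ⟨b * c, _, law_mem_stdSimplex (law_mem_stdSimplex hp _) _,
          (boundZY_relabel q _ finProdFinEquiv finProdFinEquiv.injective).symm⟩)
  rw [lamSR, h.csSup_eq]
  exact ⟨h, hm⟩

theorem lamValue_zero_eq_swap {U V W : Type*} [Fintype U] [Fintype V] [Fintype W]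
    (q : Channel X Y Z) (p : (U × V × W) × X → ℝ) :
    lamValue 0 q p = lamValue 1 q.swap (law p (fun s => ((s.1.2.1, s.1.1, s.1.2.2), s.2))) := by
  have h1 : entropy (joint q p) (fun ω => (ω.1.1.2.1, ω.1.1.1, ω.1.1.2.2)) =
      entropy (joint q p) (fun ω => (ω.1.1.1, ω.1.1.2.1, ω.1.1.2.2)) :=
    entropy_congr (by simp; tauto)
  simp only [lamValue, infoWY, infoWZ, privateTerm, mutualInfo, condMutualInfo, condEntropy,
    entropy_joint_law q.swap p (fun s => ((s.1.2.1, s.1.1, s.1.2.2), s.2)) (fun _ => rfl),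
    entropy_joint_swap, h1]
  ring

theorem lamSetAt_one (q : Channel X Y Z) (p : X → ℝ) :
    lamSetAt 1 q p = lamSetAt 0 q.swap p := by
  refine Set.Subset.antisymm ?_ ?_
  · rintro r ⟨a, b, c, κ, hκ, hr⟩
    refine ⟨b, a, c, fun x => law (κ x) (fun u => (u.2.1, u.1, u.2.2)),
      fun x => law_mem_stdSimplex (hκ x) _, ?_⟩
    rw [hr, lamValue_one_eq_swap, ← law_inputJoint p κ (fun _ u => (u.2.1, u.1, u.2.2))]
  · rintro r ⟨a, b, c, κ, hκ, hr⟩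
    refine ⟨b, a, c, fun x => law (κ x) (fun u => (u.2.1, u.1, u.2.2)),
      fun x => law_mem_stdSimplex (hκ x) _, ?_⟩
    rw [hr, lamValue_zero_eq_swap, ← law_inputJoint p κ (fun _ u => (u.2.1, u.1, u.2.2))]
    rfl

theorem lamSet_one (q : Channel X Y Z) : lamSet 1 q = lamSet 0 q.swap := by
  refine Set.Subset.antisymm ?_ ?_
  · rintro r ⟨a, b, c, p, hp, hr⟩
    exact ⟨b, a, c, _, law_mem_stdSimplex hp _, hr.trans (lamValue_one_eq_swap q p)⟩
  · rintro r ⟨a, b, c, p, hp, hr⟩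
    exact ⟨b, a, c, _, law_mem_stdSimplex hp _, hr.trans (lamValue_zero_eq_swap q.swap p)⟩

theorem exists_isGreatest_lamSetAt_one [Nonempty X] (q : Channel X Y Z) {p : X → ℝ}
    (hp : p ∈ stdSimplex ℝ X) :
    IsGreatest (lamSetAt 1 q p) (lamSRAt 1 q p) ∧
      IsGreatest {r | ∃ (c : ℕ) (κ : X → Fin c → ℝ), (∀ x, κ x ∈ stdSimplex ℝ (Fin c)) ∧
        r = boundYZ q (inputJoint p κ)} (lamSRAt 1 q p) := by
  simp only [boundYZ_eq_swap, lamSRAt, lamSetAt_one]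
  exact exists_isGreatest_lamSetAt_zero q.swap hp

theorem lamSR_one (q : Channel X Y Z) : lamSR 1 q = lamSR 0 q.swap := by
  rw [lamSR, lamSet_one, lamSR]

theorem exists_isGreatest_lamSet_one [Nonempty X] (q : Channel X Y Z) :
    IsGreatest (lamSet 1 q) (lamSR 1 q) ∧
      IsGreatest {r | ∃ (c : ℕ) (p : Fin c × X → ℝ), p ∈ stdSimplex ℝ (Fin c × X) ∧
        r = boundYZ q p} (lamSR 1 q) := by
  simp only [boundYZ_eq_swap, lamSR_one, lamSet_one]
  exact exists_isGreatest_lamSet_zero q.swap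

section Bounds

variable {U V W : Type*} [Fintype U] [Fintype V] [Fintype W]

theorem infoWY_le (q : Channel X Y Z) {p : (U × V × W) × X → ℝ}
    (hp : p ∈ stdSimplex ℝ ((U × V × W) × X)) : infoWY q p ≤ Real.logb 2 (Fintype.card Y) := by
  have hP := joint_mem_stdSimplex q hp
  have h1 := condEntropy_le_log_card hP (fun ω => ω.2.1) (fun _ => ())
  have h2 : entropy (joint q p) (fun ω => (ω.2.1, ())) = entropy (joint q p) (fun ω => ω.2.1) :=
    entropy_congr (by simp)
  have h4 := entropy_mono hP.1 (f := fun ω => (ω.1.1.2.2, ω.2.1)) (g := fun ω => ω.1.1.2.2)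
    (by simp)
  simp only [condEntropy, entropy_const hP, infoWY, mutualInfo] at *
  linarith

theorem infoWY_nonneg (q : Channel X Y Z) {p : (U × V × W) × X → ℝ}
    (hp : p ∈ stdSimplex ℝ ((U × V × W) × X)) : 0 ≤ infoWY q p := by
  have hP := joint_mem_stdSimplex q hp
  have h5 := entropy_submod hP.1 (u := fun ω => ω.1.1.2.2) (v := fun ω => ω.2.1)
    (w := fun _ => ()) (t := fun ω => (ω.1.1.2.2, ω.2.1)) (by simp) (by simp) (by simp)
  simp only [condEntropy, entropy_const hP, infoWY, mutualInfo] at *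
  linarith

theorem infoWZ_eq_swap (q : Channel X Y Z) (p : (U × V × W) × X → ℝ) :
    infoWZ q p = infoWY q.swap p := by
  simp only [infoWZ, infoWY, mutualInfo, condEntropy, entropy_joint_swap]

theorem infoWZ_le (q : Channel X Y Z) {p : (U × V × W) × X → ℝ}
    (hp : p ∈ stdSimplex ℝ ((U × V × W) × X)) : infoWZ q p ≤ Real.logb 2 (Fintype.card Z) := by
  rw [infoWZ_eq_swap]
  exact infoWY_le q.swap hp

theorem infoWZ_nonneg (q : Channel X Y Z) {p : (U × V × W) × X → ℝ}
    (hp : p ∈ stdSimplex ℝ ((U × V × W) × X)) : 0 ≤ infoWZ q p := by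
  rw [infoWZ_eq_swap]
  exact infoWY_nonneg q.swap hp

theorem logb_natCast_nonneg (n : ℕ) : 0 ≤ Real.logb 2 n :=
  div_nonneg (Real.log_natCast_nonneg n) log_two_pos.le

/-- The two positive terms are at most H(Y|W) and H(Z|W), and the subtracted term is nonnegative. -/
theorem privateTerm_le (q : Channel X Y Z) {p : (U × V × W) × X → ℝ}
    (hp : p ∈ stdSimplex ℝ ((U × V × W) × X)) :
    privateTerm q p ≤ Real.logb 2 (Fintype.card Y) + Real.logb 2 (Fintype.card Z) := by
  have hP := joint_mem_stdSimplex q hp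
  have h1 := condEntropy_le_log_card hP (fun ω => ω.2.1) (fun ω => ω.1.1.2.2)
  have h2 := condEntropy_le_log_card hP (fun ω => ω.2.2) (fun ω => ω.1.1.2.2)
  have h3 := entropy_mono hP.1 (f := fun ω => (ω.1.1.1, ω.2.1, ω.1.1.2.2))
    (g := fun ω => (ω.1.1.1, ω.1.1.2.2)) (by simp; tauto)
  have h4 := entropy_mono hP.1 (f := fun ω => (ω.1.1.2.1, ω.2.2, ω.1.1.2.2))
    (g := fun ω => (ω.1.1.2.1, ω.1.1.2.2)) (by simp; tauto)
  have h5 := condEntropy_le_condEntropy hP.1 (fun ω => ω.1.1.1) (fun ω => ω.1.1.2.1)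
    (fun ω => ω.1.1.2.2)
  simp only [condEntropy, privateTerm, condMutualInfo] at *
  linarith

theorem martonValue_le_lamValue (q : Channel X Y Z) (p : (U × V × W) × X → ℝ) {t : ℝ}
    (ht : t ∈ Set.Icc (0 : ℝ) 1) : martonValue q p ≤ lamValue t q p := by
  have h1 := mul_le_mul_of_nonneg_left (min_le_left (infoWY q p) (infoWZ q p)) ht.1
  have h2 := mul_le_mul_of_nonneg_left (min_le_right (infoWY q p) (infoWZ q p))
    (sub_nonneg.2 ht.2)
  simp only [martonValue, lamValue]
  linarith

end Bounds

theorem lamSetAt_subset (t : ℝ) (q : Channel X Y Z) {p : X → ℝ} (hp : p ∈ stdSimplex ℝ X) :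
    lamSetAt t q p ⊆ lamSet t q := by
  rintro _ ⟨a, b, c, κ, hκ, rfl⟩
  exact ⟨a, b, c, _, inputJoint_mem_stdSimplex hp hκ, rfl⟩

theorem bddAbove_lamSet (q : Channel X Y Z) {t : ℝ} (ht : t ∈ Set.Icc (0 : ℝ) 1) :
    BddAbove (lamSet t q) := by
  refine ⟨t * Real.logb 2 (Fintype.card Y) + (1 - t) * Real.logb 2 (Fintype.card Z)
    + (Real.logb 2 (Fintype.card Y) + Real.logb 2 (Fintype.card Z)), ?_⟩
  rintro _ ⟨a, b, c, p, hp, rfl⟩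
  exact add_le_add (add_le_add (mul_le_mul_of_nonneg_left (infoWY_le q hp) ht.1)
    (mul_le_mul_of_nonneg_left (infoWZ_le q hp) (sub_nonneg.2 ht.2))) (privateTerm_le q hp)

theorem lamSetAt_nonempty (t : ℝ) (q : Channel X Y Z) (p : X → ℝ) : (lamSetAt t q p).Nonempty :=
  ⟨_, 1, 1, 1, fun _ => Pi.single (0, 0, 0) 1, fun _ => single_mem_stdSimplex ℝ _, rfl⟩

theorem stdSimplex_nonempty [Nonempty X] : (stdSimplex ℝ X).Nonempty := by
  classical
  exact ⟨_, single_mem_stdSimplex ℝ (Classical.arbitrary X)⟩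

theorem isLUB_lamSetAt (q : Channel X Y Z) {t : ℝ} (ht : t ∈ Set.Icc (0 : ℝ) 1) {p : X → ℝ}
    (hp : p ∈ stdSimplex ℝ X) : IsLUB (lamSetAt t q p) (lamSRAt t q p) :=
  isLUB_csSup (lamSetAt_nonempty t q p) ((bddAbove_lamSet q ht).mono (lamSetAt_subset t q hp))

theorem isLUB_lamSet [Nonempty X] (q : Channel X Y Z) {t : ℝ} (ht : t ∈ Set.Icc (0 : ℝ) 1) :
    IsLUB (lamSet t q) (lamSR t q) := by
  obtain ⟨p, hp⟩ := stdSimplex_nonempty (X := X)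
  exact isLUB_csSup ((lamSetAt_nonempty t q p).mono (lamSetAt_subset t q hp)) (bddAbove_lamSet q ht)

theorem isLUB_martonSet [Nonempty X] (q : Channel X Y Z) :
    IsLUB (martonSet q) (martonSumRate q) := by
  refine isLUB_csSup ?_ ?_
  · obtain ⟨p, hp⟩ := stdSimplex_nonempty (X := X)
    obtain ⟨_, a, b, c, p, hp, rfl⟩ := (lamSetAt_nonempty 0 q p).mono (lamSetAt_subset 0 q hp)
    exact ⟨_, a, b, c, p, hp, rfl⟩
  · have h0 : (0 : ℝ) ∈ Set.Icc (0 : ℝ) 1 := by simp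
    refine ⟨lamSR 0 q, ?_⟩
    rintro _ ⟨a, b, c, p, hp, rfl⟩
    exact (martonValue_le_lamValue q p h0).trans ((isLUB_lamSet q h0).1 ⟨a, b, c, p, hp, rfl⟩)

/-- If `t ↦ t-SR` has its minimum over `[0,1]` at an endpoint, then Marton's sum rate is at least
this minimum. -/
theorem lamSR_le_martonSumRate [Nonempty X] (q : Channel X Y Z) {t₀ : ℝ}
    (ht₀ : t₀ ∈ ({0, 1} : Set ℝ)) (hmin : IsMinOn (fun t => lamSR t q) (Set.Icc 0 1) t₀) :
    lamSR t₀ q ≤ martonSumRate q := by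
  refine le_of_forall_pos_le_add fun ε hε => ?_
  set B : ℝ := Real.logb 2 (Fintype.card Y) + Real.logb 2 (Fintype.card Z)
  have hY := logb_natCast_nonneg (Fintype.card Y)
  have hZ := logb_natCast_nonneg (Fintype.card Z)
  have hB : 0 ≤ B := add_nonneg hY hZ
  -- The total loss below is at most s² + sB + s ≤ s(B + 2): the slack at the near-maximiser, the
  -- move from t back to t₀, and the gap in the minimum.
  obtain ⟨s, hs0, hs1, hsε⟩ : ∃ s : ℝ, 0 < s ∧ s ≤ 1 ∧ s * (B + 2) ≤ ε := by
    have h : 0 < ε + (B + 2) := by linarith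
    refine ⟨ε / (ε + (B + 2)), div_pos hε h, (div_le_one h).2 (by linarith), ?_⟩
    rw [div_mul_eq_mul_div, div_le_iff₀ h]
    nlinarith
  have h01 : t₀ = 0 ∨ t₀ = 1 := ht₀
  have ht₀' : t₀ ∈ Set.Icc (0 : ℝ) 1 := by rcases h01 with rfl | rfl <;> simp
  -- This is the point of [0,1] at distance s from t₀, written uniformly for both endpoints.
  set t : ℝ := (1 - s) * t₀ + s * (1 - t₀) with ht
  have htI : t ∈ Set.Icc (0 : ℝ) 1 := by
    rcases h01 with h | h <;> rw [ht, h] <;> constructor <;> linarith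
  -- The slack must be of smaller order than s: dividing it by s later bounds the slope by s.
  have hlt : lamSR t₀ q - s ^ 2 < lamSR t q := by
    have := isMinOn_iff.1 hmin t htI
    nlinarith
  obtain ⟨_, ⟨a, b, c, p, hp, rfl⟩, hr, -⟩ := (isLUB_lamSet q htI).exists_between hlt
  have h1 := (isLUB_lamSet q ht₀').1 ⟨a, b, c, p, hp, rfl⟩
  have h2 := (isLUB_martonSet q).1 ⟨a, b, c, p, hp, rfl⟩
  refine le_trans ?_ (add_le_add h2 le_rfl)
  have hWY := infoWY_le q hp
  have hWZ := infoWZ_le q hp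
  have hWY0 := infoWY_nonneg q hp
  have hWZ0 := infoWZ_nonneg q hp
  have hss : s ^ 2 ≤ s := by nlinarith
  have hgap : ∀ d ≤ B, s * d ≤ s * B := fun d hd => mul_le_mul_of_nonneg_left hd hs0.le
  rw [ht] at hr
  simp only [lamValue, martonValue] at h1 h2 hr ⊢
  rcases h01 with h | h <;> rw [h] at hr <;> rw [h] at h1 ⊢
  -- The value at t exceeds the value at 0 by s times this difference. The former is at least 0-SR
  -- minus s², the latter at most 0-SR.
  · have h3 : -s ≤ infoWY q p - infoWZ q p := by
      have : s * -s ≤ s * (infoWY q p - infoWZ q p) := by linarith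
      exact le_of_mul_le_mul_left this hs0
    have h4 := hgap (infoWY q p - infoWZ q p) (by linarith)
    rcases min_cases (infoWY q p) (infoWZ q p) with ⟨h5, h6⟩ | ⟨h5, h6⟩ <;> rw [h5] <;> linarith
  · have h3 : -s ≤ infoWZ q p - infoWY q p := by
      have : s * -s ≤ s * (infoWZ q p - infoWY q p) := by linarith
      exact le_of_mul_le_mul_left this hs0
    have h4 := hgap (infoWZ q p - infoWY q p) (by linarith)
    rcases min_cases (infoWY q p) (infoWZ q p) with ⟨h5, h6⟩ | ⟨h5, h6⟩ <;> rw [h5] <;> linarith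

end SumRateSets

end BC

namespace BC

/-! ### Sums over product spaces. -/

section ProductSums

variable {ι B : Type*} [Fintype ι] [DecidableEq ι] [Fintype B]

theorem sum_pi_prod (c : ι → B → ℝ) : ∑ f : ι → B, ∏ i, c i (f i) = ∏ i, ∑ b, c i b := by
  rw [Finset.prod_univ_sum, Fintype.piFinset_univ]

/-- In a product of mass functions, the coordinate `i` is independent of every function that does
not depend on it. -/
theorem sum_pi_coord (c : ι → B → ℝ) (i : ι) (hc : ∑ b, c i b = 1) (Φ : (ι → B) → B → ℝ)
    (hΦ : ∀ f b b', Φ (Function.update f i b) b' = Φ f b') :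
    ∑ f : ι → B, (∏ j, c j (f j)) * Φ f (f i) =
      ∑ f : ι → B, (∏ j, c j (f j)) * ∑ b, c i b * Φ f b := by
  have hprod : ∀ (f : ι → B) (b : B), c i (f i) * ∏ j, c j (Function.update f i b j) =
      c i b * ∏ j, c j (f j) := fun f b => by
    rw [← Finset.mul_prod_erase _ _ (Finset.mem_univ i),
      ← Finset.mul_prod_erase (Finset.univ : Finset ι) (fun j => c j (f j)) (Finset.mem_univ i),
      Function.update_self, mul_left_comm]
    congr 2
    refine Finset.prod_congr rfl fun j hj => ?_
    rw [Function.update_of_ne (Finset.ne_of_mem_erase hj)]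
  -- An independent copy of coordinate i is adjoined and exchanged with the original; this preserves
  -- the product mass, and `Φ` does not see the change in its first argument.
  let σ : (ι → B) × B → (ι → B) × B := fun s => (Function.update s.1 i s.2, s.1 i)
  have hσ : Function.Involutive σ := fun s => by simp [σ]
  calc ∑ f : ι → B, (∏ j, c j (f j)) * Φ f (f i)
      = ∑ s : (ι → B) × B, c i s.2 * ((∏ j, c j (s.1 j)) * Φ s.1 (s.1 i)) := by
        simp only [Fintype.sum_prod_type, ← Finset.sum_mul, hc, one_mul]
    _ = ∑ s : (ι → B) × B, (∏ j, c j (s.1 j)) * (c i s.2 * Φ s.1 s.2) := by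
        refine Fintype.sum_equiv hσ.toPerm _ _ fun s => ?_
        simp only [Function.Involutive.coe_toPerm, σ, hΦ]
        have := hprod s.1 s.2
        linear_combination (-Φ s.1 (s.1 i)) * this
    _ = _ := by
        simp only [Fintype.sum_prod_type, Finset.mul_sum]

theorem sum_pi_mul_coord (c : ι → B → ℝ) (i : ι) (hc : ∑ b, c i b = 1) (φ : (ι → B) → ℝ)
    (hφ : ∀ f b, φ (Function.update f i b) = φ f) (ψ : B → ℝ) :
    ∑ f : ι → B, (∏ j, c j (f j)) * φ f * ψ (f i) =
      (∑ f : ι → B, (∏ j, c j (f j)) * φ f) * ∑ b, c i b * ψ b := by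
  have h := sum_pi_coord c i hc (fun f b => φ f * ψ b) (fun f b b' => by rw [hφ])
  simp only [← mul_assoc] at h
  rw [h, Finset.sum_mul]
  refine Finset.sum_congr rfl fun f _ => ?_
  rw [Finset.mul_sum, Finset.mul_sum]
  exact Finset.sum_congr rfl fun b _ => by ring

theorem sum_pi_one (c : ι → B → ℝ) (hc : ∀ i, ∑ b, c i b = 1) (i : ι) (ψ : B → ℝ) :
    ∑ f : ι → B, (∏ j, c j (f j)) * ψ (f i) = ∑ b, c i b * ψ b := by
  have h := sum_pi_mul_coord c i (hc i) (fun _ => 1) (fun _ _ => rfl) ψ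
  simp only [mul_one] at h
  rw [h, sum_pi_prod]
  simp [hc]

theorem sum_pi_two (c : ι → B → ℝ) (hc : ∀ i, ∑ b, c i b = 1) {i i' : ι} (hi : i' ≠ i)
    (ψ : B → B → ℝ) :
    ∑ f : ι → B, (∏ j, c j (f j)) * ψ (f i) (f i') =
      ∑ b', c i' b' * ∑ b, c i b * ψ b b' := by
  rw [sum_pi_coord c i (hc i) (fun f b => ψ b (f i')) (fun f b b' => by
    rw [Function.update_of_ne hi])]
  exact sum_pi_one c hc i' (fun b' => ∑ b, c i b * ψ b b')

end ProductSums

/-! ### The law induced by a code, and its single-letter terms. -/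

section Converse

variable {X Y Z : Type*} [Fintype X] [Fintype Y] [Fintype Z] {n M₁ M₂ : ℕ}

theorem Channel.sum_prob_prod (q : Channel X Y Z) (x : X) :
    ∑ yz : Y × Z, q.prob x yz.1 yz.2 = 1 := by
  rw [Fintype.sum_prod_type, q.sum_prob]

/-- The joint mass function of the messages and the outputs. -/
noncomputable def Code.mass (c : Code X Y Z n M₁ M₂) (q : Channel X Y Z)
    (ω : (Fin M₁ × Fin M₂) × (Fin n → Y × Z)) : ℝ :=
  ((M₁ : ℝ) * M₂)⁻¹ * ∏ i, q.prob (c.enc ω.1 i) (ω.2 i).1 (ω.2 i).2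

theorem Code.mass_nonneg (c : Code X Y Z n M₁ M₂) (q : Channel X Y Z) (ω) : 0 ≤ c.mass q ω :=
  mul_nonneg (by positivity) (Finset.prod_nonneg fun _ _ => q.prob_nonneg _ _ _)

theorem Code.sum_mass_mul (c : Code X Y Z n M₁ M₂) (q : Channel X Y Z)
    (φ : Fin M₁ × Fin M₂ → ℝ) :
    ∑ ω, c.mass q ω * φ ω.1 = ∑ m, ((M₁ : ℝ) * M₂)⁻¹ * φ m := by
  rw [Fintype.sum_prod_type]
  refine Finset.sum_congr rfl fun m _ => ?_
  simp only [Code.mass, ← Finset.sum_mul, ← Finset.mul_sum]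
  rw [sum_pi_prod (fun i (b : Y × Z) => q.prob (c.enc m i) b.1 b.2)]
  simp [q.sum_prob_prod]

theorem Code.mass_mem_stdSimplex (c : Code X Y Z n M₁ M₂) (q : Channel X Y Z) (h₁ : 0 < M₁)
    (h₂ : 0 < M₂) : c.mass q ∈ stdSimplex ℝ ((Fin M₁ × Fin M₂) × (Fin n → Y × Z)) := by
  refine ⟨c.mass_nonneg q, ?_⟩
  have h := c.sum_mass_mul q (fun _ => 1)
  simp only [mul_one] at h
  have h₁' : (M₁ : ℝ) ≠ 0 := by exact_mod_cast h₁.ne'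
  have h₂' : (M₂ : ℝ) ≠ 0 := by exact_mod_cast h₂.ne'
  rw [h]
  simp
  field_simp

theorem Code.sum_mass_outputs (c : Code X Y Z n M₁ M₂) (q : Channel X Y Z)
    (S : Fin M₁ × Fin M₂ → (Fin n → Y) → (Fin n → Z) → Prop) [∀ m y z, Decidable (S m y z)] :
    (∑ ω : (Fin M₁ × Fin M₂) × (Fin n → Y × Z),
      if S ω.1 (fun i => (ω.2 i).1) (fun i => (ω.2 i).2) then 0 else c.mass q ω) =
    (∑ m : Fin M₁ × Fin M₂, ∑ y : Fin n → Y, ∑ z : Fin n → Z,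
      if S m y z then 0 else ∏ i, q.prob (c.enc m i) (y i) (z i)) / ((M₁ : ℝ) * (M₂ : ℝ)) := by
  rw [Finset.sum_div, Fintype.sum_prod_type]
  refine Finset.sum_congr rfl fun m _ => ?_
  rw [← Fintype.sum_prod_type', Finset.sum_div]
  refine Fintype.sum_equiv (Equiv.arrowProdEquivProdArrow (Fin n) (fun _ => Y) (fun _ => Z)) _ _
    fun f => ?_
  by_cases h : S m (fun i => (f i).1) (fun i => (f i).2)
  · rw [if_pos h]
    exact ((congrArg (· / _) (if_pos h)).trans (zero_div _)).symm
  · rw [if_neg h]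
    refine Eq.trans ?_ (congrArg (· / _) (if_neg h)).symm
    rw [Code.mass, div_eq_inv_mul]
    rfl

theorem Code.err₁_eq (c : Code X Y Z n M₁ M₂) (q : Channel X Y Z) :
    c.err₁ q = ∑ ω, if c.dec₁ (fun i => (ω.2 i).1) = ω.1.1 then 0 else c.mass q ω :=
  (c.sum_mass_outputs q (fun m y _ => c.dec₁ y = m.1)).symm

theorem Code.err₂_eq (c : Code X Y Z n M₁ M₂) (q : Channel X Y Z) :
    c.err₂ q = ∑ ω, if c.dec₂ (fun i => (ω.2 i).2) = ω.1.2 then 0 else c.mass q ω :=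
  (c.sum_mass_outputs q (fun m _ z => c.dec₂ z = m.2)).symm

/-- There is no feedback: given the messages the output pairs at different times are independent.
Hence g may depend on past and future outputs, and (g, X_i) → outputs at time i is still the
channel. -/
theorem Code.law_coord (c : Code X Y Z n M₁ M₂) (q : Channel X Y Z) {B : Type*} [Fintype B]
    (i : Fin n) (g : (Fin M₁ × Fin M₂) × (Fin n → Y × Z) → B)
    (hg : ∀ m f b, g (m, Function.update f i b) = g (m, f)) :
    law (c.mass q) (fun ω => ((g ω, c.enc ω.1 i), ω.2 i)) =
      joint q (law (c.mass q) (fun ω => (g ω, c.enc ω.1 i))) := by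
  classical
  funext ⟨⟨b, x⟩, y, z⟩
  simp only [joint, law]
  conv_rhs => rw [Fintype.sum_prod_type]
  conv_lhs => rw [Fintype.sum_prod_type]
  rw [Finset.sum_mul]
  refine Finset.sum_congr rfl fun m _ => ?_
  have h := sum_pi_mul_coord (fun i (b : Y × Z) => q.prob (c.enc m i) b.1 b.2) i
    (q.sum_prob_prod _) (fun f => if (g (m, f), c.enc m i) = (b, x) then 1 else 0)
    (fun f b => by simp only [hg]) (fun s => if s = (y, z) then 1 else 0)
  simp only [mul_ite, mul_one, mul_zero, Finset.sum_ite_eq', Finset.mem_univ, if_true] at h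
  have hl : ∀ f, (if ((g (m, f), c.enc m i), f i) = ((b, x), (y, z)) then c.mass q (m, f) else 0) =
      ((M₁ : ℝ) * M₂)⁻¹ * (if f i = (y, z) then (if (g (m, f), c.enc m i) = (b, x) then
        ∏ j, q.prob (c.enc m j) (f j).1 (f j).2 else 0) else 0) := fun f => by
    by_cases h1 : (g (m, f), c.enc m i) = (b, x) <;> by_cases h2 : f i = (y, z) <;>
      simp [h1, h2, Code.mass]
  have hr : ∀ f, (if (g (m, f), c.enc m i) = (b, x) then c.mass q (m, f) else 0) =
      ((M₁ : ℝ) * M₂)⁻¹ * (if (g (m, f), c.enc m i) = (b, x) then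
        ∏ j, q.prob (c.enc m j) (f j).1 (f j).2 else 0) := fun f => by
    simp only [Code.mass]
    split_ifs <;> simp
  refine (Finset.sum_congr rfl fun f _ => by convert hl f).trans (Eq.trans ?_
    (congrArg (· * q.prob x y z) (Finset.sum_congr rfl fun f _ =>
      by convert hr f)).symm)
  simp only [← Finset.mul_sum, h]
  by_cases hx : c.enc m i = x
  · rw [hx]; ring
  · simp [hx]

/-- The single-letter information at time `i`, for an auxiliary variable `g` that does not depend
on the outputs at time `i`. -/
theorem Code.boundZY_coord (c : Code X Y Z n M₁ M₂) (q : Channel X Y Z) {B : Type*} [Fintype B]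
    (i : Fin n) (g : (Fin M₁ × Fin M₂) × (Fin n → Y × Z) → B)
    (hg : ∀ m f b, g (m, Function.update f i b) = g (m, f)) :
    boundZY q (law (c.mass q) (fun ω => (g ω, c.enc ω.1 i))) =
      entropy (c.mass q) (fun ω => (ω.2 i).2) - entropy (c.mass q) (fun ω => (g ω, (ω.2 i).2))
        + entropy (c.mass q) (fun ω => ((ω.2 i).1, g ω))
        - -(∑ ω, c.mass q ω * Real.log (∑ z, q.prob (c.enc ω.1 i) (ω.2 i).1 z)) / Real.log 2 := by
  have h := condEntropy_output q
    (law_nonneg (c.mass_nonneg q) (fun ω => (g ω, c.enc ω.1 i))) Prod.fst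
  rw [boundZY_eq]
  simp only [condEntropy, outputEntropy, ← c.law_coord q i g hg] at h ⊢
  rw [sum_law_mul (c.mass q) (fun ω => ((g ω, c.enc ω.1 i), ω.2 i))
    (fun ω => Real.log (∑ z, q.prob ω.1.2 ω.2.1 z))] at h
  rw [← h]
  simp only [entropy_map]
  ring

/-- Given the messages the law of Y^n is a product of marginal channels, so its logarithm splits
over time. -/
theorem Code.condEntropy_outputs (c : Code X Y Z n M₁ M₂) (q : Channel X Y Z) :
    condEntropy (c.mass q) (fun ω i => (ω.2 i).1) (fun ω => ω.1) =
      ∑ i, -(∑ ω, c.mass q ω * Real.log (∑ z, q.prob (c.enc ω.1 i) (ω.2 i).1 z)) / Real.log 2 := by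
  classical
  rw [condEntropy_of_kernel (c.mass_nonneg q) (fun ω i => (ω.2 i).1) (fun ω => ω.1) id
    (fun m y => ∏ i, ∑ z, q.prob (c.enc m i) (y i) z), ← Finset.sum_div, Finset.sum_neg_distrib,
    Finset.sum_comm]
  · congr 2
    refine Finset.sum_congr rfl fun ω _ => ?_
    rw [← Finset.mul_sum]
    by_cases h0 : c.mass q ω = 0
    · simp [h0]
    congr 1
    refine Real.log_prod fun i _ => ne_of_gt ?_
    have hi : q.prob (c.enc ω.1 i) (ω.2 i).1 (ω.2 i).2 ≠ 0 := fun h => h0 (by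
      rw [Code.mass, Finset.prod_eq_zero (Finset.mem_univ i) h, mul_zero])
    exact (lt_of_le_of_ne (q.prob_nonneg _ _ _) hi.symm).trans_le
      (Finset.single_le_sum (f := fun z => q.prob (c.enc ω.1 i) (ω.2 i).1 z)
        (fun z _ => q.prob_nonneg _ _ _) (Finset.mem_univ _))
  · intro m y
    have hm : law (c.mass q) (fun ω => ω.1) m = ((M₁ : ℝ) * M₂)⁻¹ := by
      have := c.sum_mass_mul q (fun m' => if m' = m then 1 else 0)
      refine Eq.trans (Finset.sum_congr rfl fun ω _ => ?_) (this.trans (by simp))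
      by_cases h : ω.1 = m <;> simp [h]
    change _ = _ * ∏ i, ∑ z, q.prob (c.enc m i) (y i) z
    rw [hm, ← sum_pi_prod (fun i z => q.prob (c.enc m i) (y i) z), law, Fintype.sum_prod_type,
      Fintype.sum_eq_single m (fun m' hm' => by simp [hm']), Finset.mul_sum]
    rw [← Equiv.sum_comp (Equiv.arrowProdEquivProdArrow (Fin n) (fun _ => Y) (fun _ => Z)).symm,
      Fintype.sum_prod_type, Fintype.sum_eq_single y]
    · simp [Equiv.arrowProdEquivProdArrow, Code.mass]
    · intro y' hy'
      simp [Equiv.arrowProdEquivProdArrow, hy']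

end Converse

end BC

namespace BC

/-! ### The converse: Csiszár's identity, Fano's inequality, and the passage to the closure. -/

section Converse

variable {X Y Z : Type*} [Fintype X] [Fintype Y] [Fintype Z] {n M₁ M₂ : ℕ}

theorem boundZY_le_lamSR_zero [Nonempty X] (q : Channel X Y Z) {W : Type*} [Fintype W]
    {p : W × X → ℝ} (hp : p ∈ stdSimplex ℝ (W × X)) : boundZY q p ≤ lamSR 0 q :=
  (exists_isGreatest_lamSet_zero q).2.2 ⟨Fintype.card W, _, law_mem_stdSimplex hp _,
    (boundZY_relabel q p (Fintype.equivFin W) (Fintype.equivFin W).injective).symm⟩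

theorem entropy_outputs_le (P : (Fin M₁ × Fin M₂) × (Fin n → Y × Z) → ℝ)
    (hP : P ∈ stdSimplex ℝ ((Fin M₁ × Fin M₂) × (Fin n → Y × Z))) :
    entropy P (fun ω i => (ω.2 i).2) ≤ ∑ i, entropy P (fun ω => (ω.2 i).2) := by
  -- Subadditivity by revealing one coordinate at a time; coordinates outside s are masked by
  -- `none`.
  have key : ∀ s : Finset (Fin n),
      entropy P (fun ω i => if i ∈ s then some (ω.2 i).2 else none) ≤
        ∑ i ∈ s, entropy P (fun ω => (ω.2 i).2) := by
    intro s
    induction s using Finset.induction_on with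
    | empty => simp [entropy_const hP]
    | insert a s ha ih =>
      rw [Finset.sum_insert ha]
      have h := entropy_submod hP.1 (u := fun ω i => if i ∈ s then some (ω.2 i).2 else none)
        (v := fun ω => (ω.2 a).2) (w := fun _ => ())
        (t := fun ω i => if i ∈ insert a s then some (ω.2 i).2 else none) (by simp) (by simp)
        (fun ω ω' h1 h2 => funext fun i => by
          have := congrFun h1 i
          by_cases hi : i = a
          · subst hi; simp [h2]
          · simpa [hi] using this)
      rw [entropy_const hP] at h
      linarith
  refine le_trans (le_of_eq (entropy_congr fun ω ω' => ?_)) (key Finset.univ)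
  simp [funext_iff]

/-- The single-letter bound: Csiszár's sum identity as a telescoping sum of entropies. -/
theorem Code.sum_info_le [Nonempty X] (c : Code X Y Z n M₁ M₂) (q : Channel X Y Z)
    (h₁ : 0 < M₁) (h₂ : 0 < M₂) :
    entropy (c.mass q) (fun ω i => (ω.2 i).2)
      - entropy (c.mass q) (fun ω => (ω.1.2, fun i => (ω.2 i).2))
      + entropy (c.mass q) (fun ω => (ω.1.2, fun i => (ω.2 i).1))
      - condEntropy (c.mass q) (fun ω i => (ω.2 i).1) (fun ω => ω.1) ≤ n * lamSR 0 q := by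
  have hP := c.mass_mem_stdSimplex q h₁ h₂
  -- The hybrid of M₂ with Z at times before k and Y from time k on; it interpolates between
  -- (M₂,Y^n) at k = 0 and (M₂,Z^n) at k = n.
  let T : ℕ → (Fin M₁ × Fin M₂) × (Fin n → Y × Z) → Fin M₂ × (Fin n → Z ⊕ Y) := fun k ω =>
    (ω.1.2, fun j => if (j : ℕ) < k then Sum.inl (ω.2 j).2 else Sum.inr (ω.2 j).1)
  -- The auxiliary variable at time i is the hybrid with time i erased: adjoining Y_i restores T i,
  -- adjoining Z_i gives T (i + 1).
  let W : Fin n → (Fin M₁ × Fin M₂) × (Fin n → Y × Z) → Fin M₂ × (Fin n → Option (Z ⊕ Y)) :=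
    fun i ω => (ω.1.2, fun j => if j < i then some (Sum.inl (ω.2 j).2) else
      if i < j then some (Sum.inr (ω.2 j).1) else none)
  have hWY : ∀ i, entropy (c.mass q) (fun ω => ((ω.2 i).1, W i ω)) =
      entropy (c.mass q) (T i) := fun i => entropy_congr fun ω ω' => by
    simp only [W, T, Prod.mk.injEq, funext_iff, Fin.lt_def]
    refine ⟨fun ⟨h1, h2, h3⟩ => ⟨h2, fun j => ?_⟩, fun ⟨h2, h3⟩ => ⟨?_, h2, fun j => ?_⟩⟩
    · have := h3 j
      rcases lt_trichotomy (j : ℕ) i with h | h | h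
      · simpa [h] using this
      · obtain rfl := Fin.ext h
        simpa using h1
      · simpa [h, h.not_gt] using this
    · simpa using h3 i
    · have := h3 j
      rcases lt_trichotomy (j : ℕ) i with h | h | h
      · simpa [h] using this
      · simp [h]
      · simpa [h, h.not_gt] using this
  have hWZ : ∀ i, entropy (c.mass q) (fun ω => (W i ω, (ω.2 i).2)) =
      entropy (c.mass q) (T (i + 1)) := fun i => entropy_congr fun ω ω' => by
    simp only [W, T, Prod.mk.injEq, funext_iff, Fin.lt_def, Nat.lt_succ_iff]
    refine ⟨fun ⟨⟨h2, h3⟩, h1⟩ => ⟨h2, fun j => ?_⟩, fun ⟨h2, h3⟩ => ⟨⟨h2, fun j => ?_⟩, ?_⟩⟩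
    · have := h3 j
      rcases lt_trichotomy (j : ℕ) i with h | h | h
      · simpa [h, h.le] using this
      · obtain rfl := Fin.ext h
        simpa using h1
      · simpa [h, h.not_gt, h.not_ge] using this
    · have := h3 j
      rcases lt_trichotomy (j : ℕ) i with h | h | h
      · simpa [h, h.le] using this
      · simp [h]
      · simpa [h, h.not_gt, h.not_ge] using this
    · simpa using h3 i
  have hi : ∀ i : Fin n, entropy (c.mass q) (fun ω => (ω.2 i).2)
      + (entropy (c.mass q) (T i) - entropy (c.mass q) (T (i + 1)))
      - -(∑ ω, c.mass q ω * Real.log (∑ z, q.prob (c.enc ω.1 i) (ω.2 i).1 z)) / Real.log 2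
      ≤ lamSR 0 q := fun i => by
    have h := c.boundZY_coord q i (W i) (fun m f b => by
      simp only [W, Prod.mk.injEq, true_and]
      funext j
      rcases lt_trichotomy j i with h | h | h
      · simp [h, h.ne]
      · simp [h]
      · simp [h, h.ne', h.not_gt])
    rw [hWY, hWZ] at h
    have := boundZY_le_lamSR_zero q (law_mem_stdSimplex hP (fun ω => (W i ω, c.enc ω.1 i)))
    linarith
  -- In the sum over i the entropies of T telescope, which is the content of Csiszár's identity.
  have hsum := Finset.sum_le_sum fun i (_ : i ∈ Finset.univ) => hi i
  rw [Finset.sum_sub_distrib, Finset.sum_add_distrib, ← c.condEntropy_outputs q,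
    Fin.sum_univ_eq_sum_range (fun k => entropy (c.mass q) (T k) - entropy (c.mass q) (T (k + 1))),
    Finset.sum_range_sub'] at hsum
  have hT0 : entropy (c.mass q) (T 0) =
      entropy (c.mass q) (fun ω => (ω.1.2, fun i => (ω.2 i).1)) :=
    entropy_congr fun ω ω' => by simp [T, funext_iff]
  have hTn : entropy (c.mass q) (T n) =
      entropy (c.mass q) (fun ω => (ω.1.2, fun i => (ω.2 i).2)) :=
    entropy_congr fun ω ω' => by simp [T, funext_iff]
  have hZ := entropy_outputs_le (c.mass q) hP
  simp only [Finset.sum_const, Finset.card_univ, Fintype.card_fin, nsmul_eq_mul] at hsum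
  rw [hT0, hTn] at hsum
  linarith

theorem Code.entropy_messages (c : Code X Y Z n M₁ M₂) (q : Channel X Y Z) (h₁ : 0 < M₁)
    (h₂ : 0 < M₂) :
    entropy (c.mass q) (fun ω => ω.1) = Real.logb 2 M₁ + Real.logb 2 M₂ := by
  classical
  have h₁' : (M₁ : ℝ) ≠ 0 := by exact_mod_cast h₁.ne'
  have h₂' : (M₂ : ℝ) ≠ 0 := by exact_mod_cast h₂.ne'
  have hm : ∀ m, law (c.mass q) (fun ω => ω.1) m = ((M₁ : ℝ) * M₂)⁻¹ := fun m => by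
    have := c.sum_mass_mul q (fun m' => if m' = m then 1 else 0)
    refine Eq.trans (Finset.sum_congr rfl fun ω _ => ?_) (this.trans (by simp))
    by_cases h : ω.1 = m <;> simp [h]
  rw [entropy_eq]
  simp only [hm]
  rw [← Finset.sum_mul, (c.mass_mem_stdSimplex q h₁ h₂).2, one_mul, Real.log_inv, neg_neg,
    Real.log_mul h₁' h₂', add_div]
  rfl

/-- The entropy of the messages is at most I(M₂;Z^n) + I(M₁;Y^n|M₂) + H(M₂|Z^n) + H(M₁|Y^n), since
H(M₁|M₂,Y^n) ≤ H(M₁|Y^n) by submodularity. Fano's inequality controls the last two terms. -/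
theorem Code.logb_card_le [Nonempty X] (c : Code X Y Z n M₁ M₂) (q : Channel X Y Z)
    (h₁ : 0 < M₁) (h₂ : 0 < M₂) :
    Real.logb 2 M₁ + Real.logb 2 M₂ ≤
      2 + c.err₁ q * Real.logb 2 M₁ + c.err₂ q * Real.logb 2 M₂ + n * lamSR 0 q := by
  have hP := c.mass_mem_stdSimplex q h₁ h₂
  have hF1 := fano hP (fun ω => ω.1.1) (fun ω i => (ω.2 i).1) c.dec₁
  have hF2 := fano hP (fun ω => ω.1.2) (fun ω i => (ω.2 i).2) c.dec₂
  rw [← c.err₁_eq q] at hF1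
  rw [← c.err₂_eq q] at hF2
  have hS := c.sum_info_le q h₁ h₂
  have hM := c.entropy_messages q h₁ h₂
  have hsub := entropy_submod hP.1 (u := fun ω => (ω.1.1, fun i => (ω.2 i).1))
    (v := fun ω => (ω.1.2, fun i => (ω.2 i).1)) (w := fun ω i => (ω.2 i).1)
    (t := fun ω => (fun i => (ω.2 i).1, ω.1)) (fun _ _ h => (Prod.mk.inj h).2)
    (fun _ _ h => (Prod.mk.inj h).2) (fun ω ω' h h' => by
      have h1 := Prod.mk.inj h
      have h2 := Prod.mk.inj h'
      exact Prod.ext h1.2 (Prod.ext h1.1 h2.1))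
  simp only [condEntropy] at *
  linarith

/-- Every achievable sum rate is at most `0-SR`. -/
theorem IsAchievable.add_le_lamSR_zero [Nonempty X] {q : Channel X Y Z} {R : ℝ × ℝ}
    (hR : IsAchievable q R) : R.1 + R.2 ≤ lamSR 0 q := by
  obtain ⟨h1, h2, c, he1, he2⟩ := hR
  have hfl : ∀ (n : ℕ) (r : ℝ), 0 ≤ r → 0 < ⌊(2 : ℝ) ^ ((n : ℝ) * r)⌋₊ ∧
      n * r - 1 ≤ Real.logb 2 ⌊(2 : ℝ) ^ ((n : ℝ) * r)⌋₊ ∧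
      Real.logb 2 ⌊(2 : ℝ) ^ ((n : ℝ) * r)⌋₊ ≤ n * r := by
    intro n r hr
    have hone : (1 : ℝ) ≤ 2 ^ ((n : ℝ) * r) :=
      Real.one_le_rpow one_le_two (mul_nonneg n.cast_nonneg hr)
    have hpos : 0 < ⌊(2 : ℝ) ^ ((n : ℝ) * r)⌋₊ := Nat.floor_pos.2 hone
    have hpos' : (1 : ℝ) ≤ ⌊(2 : ℝ) ^ ((n : ℝ) * r)⌋₊ := by exact_mod_cast hpos
    refine ⟨hpos, ?_, ?_⟩
    · rw [Real.le_logb_iff_rpow_le one_lt_two (by linarith), Real.rpow_sub_one two_ne_zero]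
      have := Nat.lt_floor_add_one ((2 : ℝ) ^ ((n : ℝ) * r))
      linarith
    · rw [Real.logb_le_iff_le_rpow one_lt_two (by linarith)]
      exact Nat.floor_le (by positivity)
  have hE1 : ∀ n, 0 ≤ (c n).err₁ q := fun n => by
    rw [Code.err₁_eq]
    exact Finset.sum_nonneg fun ω _ => by split_ifs <;> simp [Code.mass_nonneg]
  have hE2 : ∀ n, 0 ≤ (c n).err₂ q := fun n => by
    rw [Code.err₂_eq]
    exact Finset.sum_nonneg fun ω _ => by split_ifs <;> simp [Code.mass_nonneg]
  -- The constant 4 collects one bit from each use of Fano's inequality and one from each rounding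
  -- of a message set size.
  have hlim : Filter.Tendsto (fun n : ℕ => 4 / (n : ℝ) + (c n).err₁ q * R.1 + (c n).err₂ q * R.2
      + lamSR 0 q) Filter.atTop (nhds (0 + 0 * R.1 + 0 * R.2 + lamSR 0 q)) :=
    (((tendsto_const_div_atTop_nhds_zero_nat 4).add (he1.mul_const _)).add
      (he2.mul_const _)).add_const _
  have hle : ∀ᶠ n : ℕ in Filter.atTop, R.1 + R.2 ≤ 4 / (n : ℝ) + (c n).err₁ q * R.1
      + (c n).err₂ q * R.2 + lamSR 0 q := by
    filter_upwards [Filter.eventually_gt_atTop 0] with n hn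
    obtain ⟨p1, l1, u1⟩ := hfl n R.1 h1
    obtain ⟨p2, l2, u2⟩ := hfl n R.2 h2
    have hc := (c n).logb_card_le q p1 p2
    have hn' : (0 : ℝ) < n := by exact_mod_cast hn
    have k1 := mul_le_mul_of_nonneg_left u1 (hE1 n)
    have k2 := mul_le_mul_of_nonneg_left u2 (hE2 n)
    have : (n : ℝ) * (R.1 + R.2) ≤ n * (4 / (n : ℝ) + (c n).err₁ q * R.1
      + (c n).err₂ q * R.2 + lamSR 0 q) := by
      have h4 : (n : ℝ) * (4 / n) = 4 := by field_simp
      linarith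
    exact le_of_mul_le_mul_left this hn'
  simpa using ge_of_tendsto hlim hle

/-- The code with the two receivers exchanged. -/
def Code.swap (c : Code X Y Z n M₁ M₂) : Code X Z Y n M₂ M₁ where
  enc m := c.enc m.swap
  dec₁ := c.dec₂
  dec₂ := c.dec₁

theorem Code.err₁_swap (c : Code X Y Z n M₁ M₂) (q : Channel X Y Z) :
    c.swap.err₁ q.swap = c.err₂ q := by
  simp only [Code.err₁, Code.err₂]
  rw [← Equiv.sum_comp (Equiv.prodComm (Fin M₁) (Fin M₂)), mul_comm]
  congr 1
  refine Finset.sum_congr rfl fun m _ => ?_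
  rw [Finset.sum_comm]
  rfl

theorem Code.err₂_swap (c : Code X Y Z n M₁ M₂) (q : Channel X Y Z) :
    c.swap.err₂ q.swap = c.err₁ q := by
  simp only [Code.err₁, Code.err₂]
  rw [← Equiv.sum_comp (Equiv.prodComm (Fin M₁) (Fin M₂)), mul_comm]
  congr 1
  refine Finset.sum_congr rfl fun m _ => ?_
  rw [Finset.sum_comm]
  rfl

theorem IsAchievable.swap {q : Channel X Y Z} {R : ℝ × ℝ} (hR : IsAchievable q R) :
    IsAchievable q.swap R.swap := by
  obtain ⟨h1, h2, c, he1, he2⟩ := hR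
  exact ⟨h2, h1, fun n => (c n).swap, he2.congr fun n => ((c n).err₁_swap q).symm,
    he1.congr fun n => ((c n).err₂_swap q).symm⟩

theorem IsAchievable.add_le_lamSR_one [Nonempty X] {q : Channel X Y Z} {R : ℝ × ℝ}
    (hR : IsAchievable q R) : R.1 + R.2 ≤ lamSR 1 q := by
  rw [lamSR_one, add_comm]
  exact hR.swap.add_le_lamSR_zero

/-- With one message per receiver no error can occur. This makes the capacity region nonempty, as
the existence of a maximal sum rate needs. -/
theorem isAchievable_zero [Nonempty X] (q : Channel X Y Z) : IsAchievable q (0, 0) := by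
  have h1 : ∀ n : ℕ, ⌊(2 : ℝ) ^ ((n : ℝ) * 0)⌋₊ = 1 := fun n => by simp
  have hs : ∀ n : ℕ, Subsingleton (Fin ⌊(2 : ℝ) ^ ((n : ℝ) * 0)⌋₊) := fun n => by
    rw [h1]; infer_instance
  have x : X := Classical.arbitrary X
  refine ⟨le_rfl, le_rfl, fun n => ⟨fun _ _ => x, fun _ => ⟨0, by simp⟩, fun _ => ⟨0, by simp⟩⟩,
    ?_, ?_⟩
  · refine tendsto_const_nhds.congr fun n => ?_
    have := hs n
    rw [Code.err₁, Finset.sum_eq_zero, zero_div]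
    exact fun m _ => Finset.sum_eq_zero fun y _ => Finset.sum_eq_zero fun z _ =>
      if_pos (Subsingleton.elim _ _)
  · refine tendsto_const_nhds.congr fun n => ?_
    have := hs n
    rw [Code.err₂, Finset.sum_eq_zero, zero_div]
    exact fun m _ => Finset.sum_eq_zero fun y _ => Finset.sum_eq_zero fun z _ =>
      if_pos (Subsingleton.elim _ _)

theorem capacityRegion_subset (q : Channel X Y Z) {B : ℝ}
    (hB : ∀ R, IsAchievable q R → R.1 + R.2 ≤ B) :
    capacityRegion q ⊆ {R | 0 ≤ R.1 ∧ 0 ≤ R.2 ∧ R.1 + R.2 ≤ B} := by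
  refine closure_minimal (fun R hR => ⟨hR.1, hR.2.1, hB R hR⟩) ?_
  exact (isClosed_le continuous_const continuous_fst).inter
    ((isClosed_le continuous_const continuous_snd).inter
      (isClosed_le (continuous_fst.add continuous_snd) continuous_const))

theorem isGreatest_optimalSumRate [Nonempty X] (q : Channel X Y Z) :
    IsGreatest (sumRates q) (optimalSumRate q) := by
  have hsub := capacityRegion_subset q fun R hR => hR.add_le_lamSR_zero
  have hcpt : IsCompact (capacityRegion q) := by
    refine (isCompact_Icc (a := ((0 : ℝ), (0 : ℝ)))
      (b := (lamSR 0 q, lamSR 0 q))).of_isClosed_subset isClosed_closure fun R hR => ?_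
    obtain ⟨h1, h2, h3⟩ := hsub hR
    exact ⟨⟨h1, h2⟩, ⟨by simp only; linarith, by simp only; linarith⟩⟩
  exact (hcpt.image (continuous_fst.add continuous_snd)).isGreatest_sSup
    ⟨_, _, subset_closure (isAchievable_zero q), rfl⟩

theorem optimalSumRate_le [Nonempty X] (q : Channel X Y Z) :
    optimalSumRate q ≤ min (lamSR 0 q) (lamSR 1 q) := by
  obtain ⟨⟨R, hR, h⟩, -⟩ := isGreatest_optimalSumRate q
  rw [← h]
  exact le_min (capacityRegion_subset q (fun R hR => hR.add_le_lamSR_zero) hR).2.2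
    (capacityRegion_subset q (fun R hR => hR.add_le_lamSR_one) hR).2.2

theorem IsAchievable.add_le_optimalSumRate [Nonempty X] {q : Channel X Y Z} {R : ℝ × ℝ}
    (hR : IsAchievable q R) : R.1 + R.2 ≤ optimalSumRate q :=
  (isGreatest_optimalSumRate q).2 ⟨R, subset_closure hR, rfl⟩

end Converse

end BC

namespace BC

/-! ### Removal of randomness from encoders and decoders. -/

section Derandomization

/-- Nonnegativity of F absorbs a deficit in the weights, which occurs for likelihood rules whose
normaliser vanishes (division by zero gives 0). -/
theorem exists_sum_mul_le {A : Type*} [Fintype A] [Nonempty A] (r F : A → ℝ) (hr : ∀ a, 0 ≤ r a)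
    (hr1 : ∑ a, r a ≤ 1) (hF : ∀ a, 0 ≤ F a) : ∃ a, ∑ b, r b * F b ≤ F a := by
  obtain ⟨a, ha⟩ := Finite.exists_max F
  refine ⟨a, ?_⟩
  calc ∑ b, r b * F b ≤ ∑ b, r b * F a :=
        Finset.sum_le_sum fun b _ => mul_le_mul_of_nonneg_left (ha b) (hr b)
    _ = (∑ b, r b) * F a := by rw [Finset.sum_mul]
    _ ≤ F a := mul_le_of_le_one_left (hF a) hr1

/-- A stochastic encoder and two stochastic decoders can be replaced by deterministic ones. -/
theorem exists_deterministic {N₁ N₂ X Y Z : Type*} [Fintype N₁] [Fintype N₂] [Fintype X] [Fintype Y]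
    [Fintype Z] [Nonempty N₁] [Nonempty N₂] [Nonempty X] [DecidableEq N₁] [DecidableEq N₂]
    (Q : X → Y → Z → ℝ) (hQ : ∀ x y z, 0 ≤ Q x y z)
    (e : N₁ × N₂ → X → ℝ) (he : ∀ m x, 0 ≤ e m x) (he1 : ∀ m, ∑ x, e m x ≤ 1)
    (r₁ : Y → N₁ → ℝ) (hr₁ : ∀ y m, 0 ≤ r₁ y m) (hr₁1 : ∀ y, ∑ m, r₁ y m ≤ 1)
    (r₂ : Z → N₂ → ℝ) (hr₂ : ∀ z m, 0 ≤ r₂ z m) (hr₂1 : ∀ z, ∑ m, r₂ z m ≤ 1) :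
    ∃ (enc : N₁ × N₂ → X) (d₁ : Y → N₁) (d₂ : Z → N₂),
      ∑ m, ∑ x, e m x * ∑ y, ∑ z, Q x y z * (r₁ y m.1 * r₂ z m.2) ≤
        ∑ m : N₁ × N₂, ∑ y, ∑ z, if d₁ y = m.1 ∧ d₂ z = m.2 then Q (enc m) y z else 0 := by
  -- The success probability is linear in each rule separately: it is first optimised for each
  -- message pair, then for each y with the encoder fixed, then for each z with both fixed.
  have h1 : ∀ m : N₁ × N₂, ∃ x, ∑ x, e m x * ∑ y, ∑ z, Q x y z * (r₁ y m.1 * r₂ z m.2) ≤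
      ∑ y, ∑ z, Q x y z * (r₁ y m.1 * r₂ z m.2) := fun m =>
    exists_sum_mul_le (e m) _ (he m) (he1 m) fun x => Finset.sum_nonneg fun y _ =>
      Finset.sum_nonneg fun z _ => mul_nonneg (hQ x y z) (mul_nonneg (hr₁ _ _) (hr₂ _ _))
  choose enc henc using h1
  have h2 : ∀ y, ∃ m₁, ∑ m₁, r₁ y m₁ * ∑ m₂, ∑ z, Q (enc (m₁, m₂)) y z * r₂ z m₂ ≤
      ∑ m₂, ∑ z, Q (enc (m₁, m₂)) y z * r₂ z m₂ := fun y =>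
    exists_sum_mul_le (r₁ y) _ (hr₁ y) (hr₁1 y) fun m₁ => Finset.sum_nonneg fun m₂ _ =>
      Finset.sum_nonneg fun z _ => mul_nonneg (hQ _ y z) (hr₂ _ _)
  choose d₁ hd₁ using h2
  have h3 : ∀ z, ∃ m₂, ∑ m₂, r₂ z m₂ * ∑ y, Q (enc (d₁ y, m₂)) y z ≤
      ∑ y, Q (enc (d₁ y, m₂)) y z := fun z =>
    exists_sum_mul_le (r₂ z) _ (hr₂ z) (hr₂1 z) fun m₂ => Finset.sum_nonneg fun y _ => hQ _ y z
  choose d₂ hd₂ using h3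
  refine ⟨enc, d₁, d₂, ?_⟩
  calc _ ≤ ∑ m : N₁ × N₂, ∑ y, ∑ z, Q (enc m) y z * (r₁ y m.1 * r₂ z m.2) :=
        Finset.sum_le_sum fun m _ => henc m
    _ = ∑ y, ∑ m₁, r₁ y m₁ * ∑ m₂, ∑ z, Q (enc (m₁, m₂)) y z * r₂ z m₂ := by
        rw [Finset.sum_comm]
        refine Finset.sum_congr rfl fun y _ => ?_
        rw [Fintype.sum_prod_type]
        refine Finset.sum_congr rfl fun m₁ _ => ?_
        simp only [Finset.mul_sum]
        exact Finset.sum_congr rfl fun m₂ _ => Finset.sum_congr rfl fun z _ => by ring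
    _ ≤ ∑ y, ∑ m₂, ∑ z, Q (enc (d₁ y, m₂)) y z * r₂ z m₂ := Finset.sum_le_sum fun y _ => hd₁ y
    _ = ∑ z, ∑ m₂, r₂ z m₂ * ∑ y, Q (enc (d₁ y, m₂)) y z := by
        simp only [Finset.mul_sum]
        rw [Finset.sum_congr rfl fun y _ => Finset.sum_comm, Finset.sum_comm]
        refine Finset.sum_congr rfl fun z _ => ?_
        rw [Finset.sum_comm]
        exact Finset.sum_congr rfl fun m₂ _ => Finset.sum_congr rfl fun y _ => by ring
    _ ≤ ∑ z, ∑ y, Q (enc (d₁ y, d₂ z)) y z := Finset.sum_le_sum fun z _ => hd₂ z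
    _ = _ := by
        rw [Finset.sum_comm]
        symm
        rw [Finset.sum_comm]
        refine Finset.sum_congr rfl fun y _ => ?_
        rw [Finset.sum_comm]
        refine Finset.sum_congr rfl fun z _ => ?_
        rw [Fintype.sum_eq_single (d₁ y, d₂ z)]
        · simp
        · rintro ⟨m₁, m₂⟩ hm
          refine if_neg fun h => hm ?_
          rw [h.1, h.2]

end Derandomization

/-! ### Random superposition codebooks and their moments. -/

section Codebook

variable {W U V K L I : Type*} [Fintype W] [Fintype U] [Fintype V] [Fintype K] [Fintype L]
  [Fintype I] [DecidableEq K] [DecidableEq L] [DecidableEq I]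

/-- The mass function of a cluster: a cloud centre `w` with satellites `u(k)` and `v(l)`, which are
conditionally independent given `w`. -/
def clusterMass (pw : W → ℝ) (pu : W → U → ℝ) (pv : W → V → ℝ) (s : W × (K → U) × (L → V)) : ℝ :=
  pw s.1 * ((∏ k, pu s.1 (s.2.1 k)) * ∏ l, pv s.1 (s.2.2 l))

/-- The average of `φ(w,u,v)` when `u` and `v` are conditionally independent given `w`. -/
def tripleMean (pw : W → ℝ) (pu : W → U → ℝ) (pv : W → V → ℝ) (φ : W → U → V → ℝ) : ℝ :=
  ∑ w, pw w * ∑ u, pu w u * ∑ v, pv w v * φ w u v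

variable {pw : W → ℝ} {pu : W → U → ℝ} {pv : W → V → ℝ}

theorem sum_clusterMass_mul (pw : W → ℝ) (pu : W → U → ℝ) (pv : W → V → ℝ)
    (F : W → (K → U) → (L → V) → ℝ) :
    ∑ s : W × (K → U) × (L → V), clusterMass pw pu pv s * F s.1 s.2.1 s.2.2 =
      ∑ w, pw w * ∑ f : K → U, (∏ k, pu w (f k)) * ∑ g : L → V, (∏ l, pv w (g l)) * F w f g := by
  simp only [Fintype.sum_prod_type, clusterMass, Finset.mul_sum]
  exact Finset.sum_congr rfl fun w _ => Finset.sum_congr rfl fun f _ =>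
    Finset.sum_congr rfl fun g _ => by ring

theorem sum_clusterMass_triple (hu : ∀ w, ∑ u, pu w u = 1) (hv : ∀ w, ∑ v, pv w v = 1) (k : K)
    (l : L) (φ : W → U → V → ℝ) :
    ∑ s : W × (K → U) × (L → V), clusterMass pw pu pv s * φ s.1 (s.2.1 k) (s.2.2 l) =
      tripleMean pw pu pv φ := by
  rw [sum_clusterMass_mul pw pu pv (fun w f g => φ w (f k) (g l)), tripleMean]
  refine Finset.sum_congr rfl fun w _ => ?_
  congr 1
  rw [← sum_pi_one (fun _ => pu w) (fun _ => hu w) k (fun u => ∑ v, pv w v * φ w u v)]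
  refine Finset.sum_congr rfl fun f _ => ?_
  congr 1
  exact sum_pi_one (fun _ => pv w) (fun _ => hv w) l (φ w (f k))

theorem sum_clusterMass_two_left (hu : ∀ w, ∑ u, pu w u = 1) (hv : ∀ w, ∑ v, pv w v = 1) {k k' : K}
    (hk : k' ≠ k) (l : L) (φ : W → U → V → U → ℝ) :
    ∑ s : W × (K → U) × (L → V), clusterMass pw pu pv s * φ s.1 (s.2.1 k) (s.2.2 l) (s.2.1 k') =
      tripleMean pw pu pv (fun w u v => ∑ u', pu w u' * φ w u v u') := by
  rw [sum_clusterMass_mul pw pu pv (fun w f g => φ w (f k) (g l) (f k')), tripleMean]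
  refine Finset.sum_congr rfl fun w _ => ?_
  congr 1
  refine Eq.trans (Finset.sum_congr rfl fun f _ => congrArg _
    (sum_pi_one (fun _ => pv w) (fun _ => hv w) l (fun v => φ w (f k) v (f k')))) ?_
  refine (sum_pi_two (fun _ => pu w) (fun _ => hu w) hk.symm
    (fun u' u => ∑ v, pv w v * φ w u v u')).trans ?_
  refine Finset.sum_congr rfl fun u _ => ?_
  congr 1
  simp only [Finset.mul_sum]
  rw [Finset.sum_comm]
  exact Finset.sum_congr rfl fun v _ => Finset.sum_congr rfl fun u' _ => by ring

theorem sum_clusterMass_two_right (hu : ∀ w, ∑ u, pu w u = 1) (hv : ∀ w, ∑ v, pv w v = 1) (k : K)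
    {l l' : L} (hl : l' ≠ l) (φ : W → U → V → V → ℝ) :
    ∑ s : W × (K → U) × (L → V), clusterMass pw pu pv s * φ s.1 (s.2.1 k) (s.2.2 l) (s.2.2 l') =
      tripleMean pw pu pv (fun w u v => ∑ v', pv w v' * φ w u v v') := by
  rw [sum_clusterMass_mul pw pu pv (fun w f g => φ w (f k) (g l) (g l')), tripleMean]
  refine Finset.sum_congr rfl fun w _ => ?_
  congr 1
  refine Eq.trans (Finset.sum_congr rfl fun f _ => congrArg _
    (sum_pi_two (fun _ => pv w) (fun _ => hv w) hl.symm (fun v' v => φ w (f k) v v'))) ?_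
  exact sum_pi_one (fun _ => pu w) (fun _ => hu w) k
    (fun u => ∑ v, pv w v * ∑ v', pv w v' * φ w u v v')

/-- The mass function of a codebook: independent clusters. -/
def codebookMass (pw : W → ℝ) (pu : W → U → ℝ) (pv : W → V → ℝ)
    (c : I → W × (K → U) × (L → V)) : ℝ :=
  ∏ i, clusterMass pw pu pv (c i)

theorem sum_clusterMass (hw : ∑ w, pw w = 1) (hu : ∀ w, ∑ u, pu w u = 1)
    (hv : ∀ w, ∑ v, pv w v = 1) :
    ∑ s : W × (K → U) × (L → V), clusterMass pw pu pv s = 1 := by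
  have h := sum_clusterMass_mul (K := K) (L := L) pw pu pv (fun _ _ _ => 1)
  simp only [mul_one] at h
  rw [h]
  simp only [sum_pi_prod (fun (_ : L) => pv _), sum_pi_prod (fun (_ : K) => pu _), hu, hv,
    Finset.prod_const_one, mul_one, hw]

theorem sum_codebookMass (hw : ∑ w, pw w = 1) (hu : ∀ w, ∑ u, pu w u = 1)
    (hv : ∀ w, ∑ v, pv w v = 1) :
    ∑ c : I → W × (K → U) × (L → V), codebookMass pw pu pv c = 1 := by
  simp only [codebookMass]
  rw [sum_pi_prod (fun _ => clusterMass pw pu pv)]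
  simp [sum_clusterMass hw hu hv]

theorem sum_codebookMass_one (hw : ∑ w, pw w = 1) (hu : ∀ w, ∑ u, pu w u = 1)
    (hv : ∀ w, ∑ v, pv w v = 1) (i : I) (ψ : W × (K → U) × (L → V) → ℝ) :
    ∑ c : I → W × (K → U) × (L → V), codebookMass pw pu pv c * ψ (c i) =
      ∑ s, clusterMass pw pu pv s * ψ s :=
  sum_pi_one (fun _ => clusterMass pw pu pv) (fun _ => sum_clusterMass hw hu hv) i ψ

theorem sum_codebookMass_two (hw : ∑ w, pw w = 1) (hu : ∀ w, ∑ u, pu w u = 1)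
    (hv : ∀ w, ∑ v, pv w v = 1) {i i' : I} (hi : i' ≠ i) (ψ ψ' : W × (K → U) × (L → V) → ℝ) :
    ∑ c : I → W × (K → U) × (L → V), codebookMass pw pu pv c * (ψ (c i) * ψ' (c i')) =
      (∑ s, clusterMass pw pu pv s * ψ s) * ∑ s, clusterMass pw pu pv s * ψ' s := by
  refine (sum_pi_two (fun _ => clusterMass pw pu pv) (fun _ => sum_clusterMass hw hu hv) hi
    (fun s s' => ψ s * ψ' s')).trans ?_
  rw [Finset.sum_mul_sum, Finset.sum_comm]
  refine Finset.sum_congr rfl fun s _ => ?_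
  rw [Finset.mul_sum]
  exact Finset.sum_congr rfl fun s' _ => by ring

theorem sum_ite_eq_card {ι : Type*} [Fintype ι] [DecidableEq ι] (i₀ : ι) (f : ι → ℝ) (a b : ℝ)
    (h₀ : f i₀ = a) (h : ∀ i, i ≠ i₀ → f i = b) :
    ∑ i, f i = a + ((Fintype.card ι : ℝ) - 1) * b := by
  rw [← Finset.add_sum_erase _ _ (Finset.mem_univ i₀), h₀,
    Finset.sum_congr rfl fun i hi => h i (Finset.ne_of_mem_erase hi), Finset.sum_const,
    Finset.card_erase_of_mem (Finset.mem_univ i₀), nsmul_eq_mul, Finset.card_univ,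
    Nat.cast_sub (Fintype.card_pos_iff.2 ⟨i₀⟩), Nat.cast_one]

theorem tripleMean_add_mul (φ ψ : W → U → V → ℝ) (r : ℝ) :
    tripleMean pw pu pv φ + r * tripleMean pw pu pv ψ =
      tripleMean pw pu pv (fun w u v => φ w u v + r * ψ w u v) := by
  simp only [tripleMean, Finset.mul_sum, ← Finset.sum_add_distrib]
  refine Finset.sum_congr rfl fun w _ => ?_
  refine Finset.sum_congr rfl fun u _ => ?_
  exact Finset.sum_congr rfl fun v _ => by ring

theorem tripleMean_mono (hw0 : ∀ w, 0 ≤ pw w) (hu0 : ∀ w u, 0 ≤ pu w u) (hv0 : ∀ w v, 0 ≤ pv w v)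
    {φ ψ : W → U → V → ℝ} (h : ∀ w u v, φ w u v ≤ ψ w u v) :
    tripleMean pw pu pv φ ≤ tripleMean pw pu pv ψ :=
  Finset.sum_le_sum fun w _ => mul_le_mul_of_nonneg_left (Finset.sum_le_sum fun u _ =>
    mul_le_mul_of_nonneg_left (Finset.sum_le_sum fun v _ =>
      mul_le_mul_of_nonneg_left (h w u v) (hv0 w v)) (hu0 w u)) (hw0 w)

end Codebook

end BC

namespace BC

/-! ### Means of the likelihood normalisers for a given codeword triple. -/

section CodebookMeans

variable {W U V K L I : Type*} [Fintype W] [Fintype U] [Fintype V] [Fintype K] [Fintype L]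
  [Fintype I] [DecidableEq K] [DecidableEq L] [DecidableEq I]
  {pw : W → ℝ} {pu : W → U → ℝ} {pv : W → V → ℝ}

theorem sum_codebookMass_triple (hw : ∑ w, pw w = 1) (hu : ∀ w, ∑ u, pu w u = 1)
    (hv : ∀ w, ∑ v, pv w v = 1) (i : I) (k : K) (l : L) (φ : W → U → V → ℝ) :
    ∑ c : I → W × (K → U) × (L → V),
      codebookMass pw pu pv c * φ (c i).1 ((c i).2.1 k) ((c i).2.2 l) = tripleMean pw pu pv φ :=
  (sum_codebookMass_one hw hu hv i (fun s => φ s.1 (s.2.1 k) (s.2.2 l))).trans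
    (sum_clusterMass_triple hu hv k l φ)

/-- The bracket on the right is the mean of the first decoder's normaliser given the codeword
triple: the true codeword, the other satellites of its cluster, and all satellites of the other
clusters. -/
theorem sum_codebookMass_left (hw : ∑ w, pw w = 1) (hu : ∀ w, ∑ u, pu w u = 1)
    (hv : ∀ w, ∑ v, pv w v = 1) (i₀ : I) (k₀ : K) (l : L) (φ : W → U → V → ℝ) (D : W → U → ℝ) :
    ∑ c : I → W × (K → U) × (L → V), codebookMass pw pu pv c *
      (φ (c i₀).1 ((c i₀).2.1 k₀) ((c i₀).2.2 l) * ∑ i, ∑ k, D (c i).1 ((c i).2.1 k)) =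
    tripleMean pw pu pv (fun w u v => φ w u v * (D w u
      + ((Fintype.card K : ℝ) - 1) * ∑ u', pu w u' * D w u'
      + ((Fintype.card I : ℝ) - 1) * Fintype.card K * ∑ w', pw w' * ∑ u', pu w' u' * D w' u')) := by
  set c₁ := ∑ w', pw w' * ∑ u', pu w' u' * D w' u' with hc₁
  have hsame : ∀ k, k ≠ k₀ → ∑ c : I → W × (K → U) × (L → V), codebookMass pw pu pv c *
      (φ (c i₀).1 ((c i₀).2.1 k₀) ((c i₀).2.2 l) * D (c i₀).1 ((c i₀).2.1 k)) =
      tripleMean pw pu pv (fun w u v => φ w u v * ∑ u', pu w u' * D w u') := fun k hk => by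
    refine (sum_codebookMass_one hw hu hv i₀
      (fun s => φ s.1 (s.2.1 k₀) (s.2.2 l) * D s.1 (s.2.1 k))).trans ?_
    refine (sum_clusterMass_two_left hu hv hk l (fun w u v u' => φ w u v * D w u')).trans ?_
    congr 1
    funext w u v
    rw [Finset.mul_sum]
    exact Finset.sum_congr rfl fun u' _ => by ring
  have hother : ∀ i, i ≠ i₀ → ∀ k, ∑ c : I → W × (K → U) × (L → V), codebookMass pw pu pv c *
      (φ (c i₀).1 ((c i₀).2.1 k₀) ((c i₀).2.2 l) * D (c i).1 ((c i).2.1 k)) =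
      tripleMean pw pu pv φ * c₁ := fun i hi k => by
    refine (sum_codebookMass_two hw hu hv hi (fun s => φ s.1 (s.2.1 k₀) (s.2.2 l))
      (fun s => D s.1 (s.2.1 k))).trans ?_
    rw [sum_clusterMass_triple hu hv k₀ l φ, sum_clusterMass_triple hu hv k l (fun w u _ => D w u)]
    simp only [tripleMean, ← Finset.sum_mul, hv, one_mul, hc₁]
  calc _ = ∑ i, ∑ k, ∑ c : I → W × (K → U) × (L → V), codebookMass pw pu pv c *
      (φ (c i₀).1 ((c i₀).2.1 k₀) ((c i₀).2.2 l) * D (c i).1 ((c i).2.1 k)) := by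
        simp only [Finset.mul_sum]
        rw [Finset.sum_comm]
        exact Finset.sum_congr rfl fun i _ => Finset.sum_comm
    _ = (tripleMean pw pu pv (fun w u v => φ w u v * D w u) + ((Fintype.card K : ℝ) - 1) *
          tripleMean pw pu pv (fun w u v => φ w u v * ∑ u', pu w u' * D w u'))
        + ((Fintype.card I : ℝ) - 1) * (Fintype.card K * (tripleMean pw pu pv φ * c₁)) := by
        refine sum_ite_eq_card i₀ _ _ _ (sum_ite_eq_card k₀ _ _ _ ?_ hsame) fun i hi => ?_
        · exact sum_codebookMass_triple hw hu hv i₀ k₀ l (fun w u v => φ w u v * D w u)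
        · simp [hother i hi]
    _ = _ := by
        rw [tripleMean_add_mul, show ((Fintype.card I : ℝ) - 1) * (Fintype.card K *
          (tripleMean pw pu pv φ * c₁)) = (((Fintype.card I : ℝ) - 1) * Fintype.card K * c₁) *
          tripleMean pw pu pv φ by ring, tripleMean_add_mul]
        congr 1
        funext w u v
        ring

theorem sum_codebookMass_right (hw : ∑ w, pw w = 1) (hu : ∀ w, ∑ u, pu w u = 1)
    (hv : ∀ w, ∑ v, pv w v = 1) (i₀ : I) (k : K) (l₀ : L) (φ : W → U → V → ℝ) (D : W → V → ℝ) :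
    ∑ c : I → W × (K → U) × (L → V), codebookMass pw pu pv c *
      (φ (c i₀).1 ((c i₀).2.1 k) ((c i₀).2.2 l₀) * ∑ i, ∑ l, D (c i).1 ((c i).2.2 l)) =
    tripleMean pw pu pv (fun w u v => φ w u v * (D w v
      + ((Fintype.card L : ℝ) - 1) * ∑ v', pv w v' * D w v'
      + ((Fintype.card I : ℝ) - 1) * Fintype.card L * ∑ w', pw w' * ∑ v', pv w' v' * D w' v')) := by
  set c₁ := ∑ w', pw w' * ∑ v', pv w' v' * D w' v' with hc₁
  have hsame : ∀ l, l ≠ l₀ → ∑ c : I → W × (K → U) × (L → V), codebookMass pw pu pv c *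
      (φ (c i₀).1 ((c i₀).2.1 k) ((c i₀).2.2 l₀) * D (c i₀).1 ((c i₀).2.2 l)) =
      tripleMean pw pu pv (fun w u v => φ w u v * ∑ v', pv w v' * D w v') := fun l hl => by
    refine (sum_codebookMass_one hw hu hv i₀
      (fun s => φ s.1 (s.2.1 k) (s.2.2 l₀) * D s.1 (s.2.2 l))).trans ?_
    refine (sum_clusterMass_two_right hu hv k hl (fun w u v v' => φ w u v * D w v')).trans ?_
    congr 1
    funext w u v
    rw [Finset.mul_sum]
    exact Finset.sum_congr rfl fun v' _ => by ring
  have hother : ∀ i, i ≠ i₀ → ∀ l, ∑ c : I → W × (K → U) × (L → V), codebookMass pw pu pv c *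
      (φ (c i₀).1 ((c i₀).2.1 k) ((c i₀).2.2 l₀) * D (c i).1 ((c i).2.2 l)) =
      tripleMean pw pu pv φ * c₁ := fun i hi l => by
    refine (sum_codebookMass_two hw hu hv hi (fun s => φ s.1 (s.2.1 k) (s.2.2 l₀))
      (fun s => D s.1 (s.2.2 l))).trans ?_
    rw [sum_clusterMass_triple hu hv k l₀ φ, sum_clusterMass_triple hu hv k l (fun w _ v => D w v)]
    simp only [tripleMean, ← Finset.sum_mul, hu, one_mul, hc₁]
  calc _ = ∑ i, ∑ l, ∑ c : I → W × (K → U) × (L → V), codebookMass pw pu pv c *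
      (φ (c i₀).1 ((c i₀).2.1 k) ((c i₀).2.2 l₀) * D (c i).1 ((c i).2.2 l)) := by
        simp only [Finset.mul_sum]
        rw [Finset.sum_comm]
        exact Finset.sum_congr rfl fun i _ => Finset.sum_comm
    _ = (tripleMean pw pu pv (fun w u v => φ w u v * D w v) + ((Fintype.card L : ℝ) - 1) *
          tripleMean pw pu pv (fun w u v => φ w u v * ∑ v', pv w v' * D w v'))
        + ((Fintype.card I : ℝ) - 1) * (Fintype.card L * (tripleMean pw pu pv φ * c₁)) := by
        refine sum_ite_eq_card i₀ _ _ _ (sum_ite_eq_card l₀ _ _ _ ?_ hsame) fun i hi => ?_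
        · exact sum_codebookMass_triple hw hu hv i₀ k l₀ (fun w u v => φ w u v * D w v)
        · simp [hother i hi]
    _ = _ := by
        rw [tripleMean_add_mul, show ((Fintype.card I : ℝ) - 1) * (Fintype.card L *
          (tripleMean pw pu pv φ * c₁)) = (((Fintype.card I : ℝ) - 1) * Fintype.card L * c₁) *
          tripleMean pw pu pv φ by ring, tripleMean_add_mul]
        congr 1
        funext w u v
        ring

/-- The same computation for the encoder's normaliser over one bin; each competing bin member has
mean density at most 1, whence an inequality. -/
theorem sum_codebookMass_bin {I₁ J : Type*} [Fintype I₁] [Fintype J] [DecidableEq I₁]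
    [DecidableEq J] (hw0 : ∀ w, 0 ≤ pw w) (hu0 : ∀ w u, 0 ≤ pu w u) (hv0 : ∀ w v, 0 ≤ pv w v)
    (hw : ∑ w, pw w = 1) (hu : ∀ w, ∑ u, pu w u = 1)
    (hv : ∀ w, ∑ v, pv w v = 1) (i₀ : I) (i₁ : I₁) (j₀ : J) (l : L) (φ a : W → U → V → ℝ)
    (hφ : ∀ w u v, 0 ≤ φ w u v) (ha : ∀ w v, ∑ u, pu w u * a w u v ≤ 1) :
    ∑ c : I → W × (I₁ × J → U) × (L → V), codebookMass pw pu pv c *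
      (φ (c i₀).1 ((c i₀).2.1 (i₁, j₀)) ((c i₀).2.2 l) *
        ∑ j, a (c i₀).1 ((c i₀).2.1 (i₁, j)) ((c i₀).2.2 l)) ≤
    tripleMean pw pu pv (fun w u v => φ w u v * (a w u v + ((Fintype.card J : ℝ) - 1))) := by
  have hsame : ∀ j, j ≠ j₀ → ∑ c : I → W × (I₁ × J → U) × (L → V), codebookMass pw pu pv c *
      (φ (c i₀).1 ((c i₀).2.1 (i₁, j₀)) ((c i₀).2.2 l) *
        a (c i₀).1 ((c i₀).2.1 (i₁, j)) ((c i₀).2.2 l)) =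
      tripleMean pw pu pv (fun w u v => φ w u v * ∑ u', pu w u' * a w u' v) := fun j hj => by
    refine (sum_codebookMass_one hw hu hv i₀ (fun s => φ s.1 (s.2.1 (i₁, j₀)) (s.2.2 l) *
      a s.1 (s.2.1 (i₁, j)) (s.2.2 l))).trans ?_
    refine (sum_clusterMass_two_left hu hv (k := (i₁, j₀)) (k' := (i₁, j)) (by simp [hj]) l
      (fun w u v u' => φ w u v * a w u' v)).trans ?_
    congr 1
    funext w u v
    rw [Finset.mul_sum]
    exact Finset.sum_congr rfl fun u' _ => by ring
  have hJ : (0 : ℝ) ≤ (Fintype.card J : ℝ) - 1 := by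
    have : (1 : ℝ) ≤ Fintype.card J := by exact_mod_cast Fintype.card_pos_iff.2 ⟨j₀⟩
    linarith
  calc _ = ∑ j, ∑ c : I → W × (I₁ × J → U) × (L → V), codebookMass pw pu pv c *
      (φ (c i₀).1 ((c i₀).2.1 (i₁, j₀)) ((c i₀).2.2 l) *
        a (c i₀).1 ((c i₀).2.1 (i₁, j)) ((c i₀).2.2 l)) := by
        simp only [Finset.mul_sum]
        exact Finset.sum_comm
    _ = tripleMean pw pu pv (fun w u v => φ w u v * a w u v) + ((Fintype.card J : ℝ) - 1) *
          tripleMean pw pu pv (fun w u v => φ w u v * ∑ u', pu w u' * a w u' v) :=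
        sum_ite_eq_card j₀ _ _ _
          (sum_codebookMass_triple hw hu hv i₀ (i₁, j₀) l (fun w u v => φ w u v * a w u v)) hsame
    _ = tripleMean pw pu pv (fun w u v => φ w u v * a w u v + ((Fintype.card J : ℝ) - 1) *
          (φ w u v * ∑ u', pu w u' * a w u' v)) := tripleMean_add_mul _ _ _
    _ ≤ _ := by
        refine tripleMean_mono hw0 hu0 hv0 fun w u v => ?_
        have := mul_le_mul_of_nonneg_left (ha w v) (mul_nonneg hJ (hφ w u v))
        linarith

end CodebookMeans

/-! ### The one-shot coding bound. -/

section OneShot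

/-- The tangent plane at (1,1,1) of the convex function 1/(xyz). It comes from log t ≤ t - 1 at x,
y, z and 1/(xyz), where the logarithms cancel. -/
theorem four_sub_le_inv {x y z : ℝ} (hx : 0 < x) (hy : 0 < y) (hz : 0 < z) :
    4 - x - y - z ≤ (x * y * z)⁻¹ := by
  have h1 := Real.log_le_sub_one_of_pos hx
  have h2 := Real.log_le_sub_one_of_pos hy
  have h3 := Real.log_le_sub_one_of_pos hz
  have h4 := Real.log_le_sub_one_of_pos (inv_pos.2 (mul_pos (mul_pos hx hy) hz))
  rw [Real.log_inv, Real.log_mul (mul_pos hx hy).ne' hz.ne', Real.log_mul hx.ne' hy.ne'] at h4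
  linarith

/-- Serves as Jensen's inequality for three dependent denominators: the bound is linear in S, S₁,
S₂, so only their separate conditional means matter, and A, B, C will bound those means. -/
theorem ratio_prod_ge {α δ₁ δ₂ S S₁ S₂ A B C : ℝ} (hα : 0 < α) (hδ₁ : 0 < δ₁) (hδ₂ : 0 < δ₂)
    (hS : 0 < S) (hS₁ : 0 < S₁) (hS₂ : 0 < S₂) (hA : 0 < A) (hB : 0 < B) (hC : 0 < C) :
    α * δ₁ * δ₂ / (A * B * C) * (4 - S / A - S₁ / B - S₂ / C) ≤ α / S * (δ₁ / S₁ * (δ₂ / S₂)) := by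
  have h := four_sub_le_inv (div_pos hS hA) (div_pos hS₁ hB) (div_pos hS₂ hC)
  refine (mul_le_mul_of_nonneg_left h (by positivity)).trans (le_of_eq ?_)
  field_simp

theorem div_mul_self_le {φ : ℝ} (hφ : 0 ≤ φ) (A : ℝ) : φ / A * A ≤ φ := by
  by_cases h : A = 0
  · simp [h, hφ]
  · rw [div_mul_cancel₀ _ h]

end OneShot

end BC

namespace BC

section OneShot

variable {W U V X Y Z I₀ I₁ I₂ J : Type*} [Fintype W] [Fintype U] [Fintype V] [Fintype X]
  [Fintype Y] [Fintype Z] [Fintype I₀] [Fintype I₁] [Fintype I₂] [Fintype J]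
  [DecidableEq I₀] [DecidableEq I₁] [DecidableEq I₂] [DecidableEq J]

/-- The success probability of the likelihood encoder and the likelihood decoders at one codeword
triple, averaged over the codebooks. -/
theorem likelihood_success_ge {pw : W → ℝ} {pu : W → U → ℝ} {pv : W → V → ℝ}
    (hw0 : ∀ w, 0 ≤ pw w) (hu0 : ∀ w u, 0 ≤ pu w u) (hv0 : ∀ w v, 0 ≤ pv w v)
    (hw : ∑ w, pw w = 1) (hu : ∀ w, ∑ u, pu w u = 1) (hv : ∀ w, ∑ v, pv w v = 1)
    (a g : W → U → V → ℝ) (ha0 : ∀ w u v, 0 ≤ a w u v) (ha : ∀ w v, ∑ u, pu w u * a w u v ≤ 1)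
    (hg : ∀ w u v, 0 ≤ g w u v) (D₁ : W → U → ℝ) (hD₁ : ∀ w u, 0 ≤ D₁ w u) (D₂ : W → V → ℝ)
    (hD₂ : ∀ w v, 0 ≤ D₂ w v)
    (hpos : ∀ w u v, g w u v ≠ 0 → a w u v ≠ 0 → 0 < D₁ w u ∧ 0 < D₂ w v)
    (i₀ : I₀) (i₁ : I₁) (j₀ : J) (i₂ : I₂) :
    tripleMean pw pu pv (fun w u v => g w u v * (a w u v * D₁ w u * D₂ w v /
      ((a w u v + ((Fintype.card J : ℝ) - 1)) *
      (D₁ w u + ((Fintype.card (I₁ × J) : ℝ) - 1) * ∑ u', pu w u' * D₁ w u'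
        + ((Fintype.card I₀ : ℝ) - 1) * Fintype.card (I₁ × J) *
          ∑ w', pw w' * ∑ u', pu w' u' * D₁ w' u') *
      (D₂ w v + ((Fintype.card I₂ : ℝ) - 1) * ∑ v', pv w v' * D₂ w v'
        + ((Fintype.card I₀ : ℝ) - 1) * Fintype.card I₂ *
          ∑ w', pw w' * ∑ v', pv w' v' * D₂ w' v')))) ≤
    ∑ c : I₀ → W × (I₁ × J → U) × (I₂ → V), codebookMass pw pu pv c *
      (g (c i₀).1 ((c i₀).2.1 (i₁, j₀)) ((c i₀).2.2 i₂) *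
        (a (c i₀).1 ((c i₀).2.1 (i₁, j₀)) ((c i₀).2.2 i₂) /
            (∑ j, a (c i₀).1 ((c i₀).2.1 (i₁, j)) ((c i₀).2.2 i₂)) *
          (D₁ (c i₀).1 ((c i₀).2.1 (i₁, j₀)) / (∑ i, ∑ k, D₁ (c i).1 ((c i).2.1 k)) *
          (D₂ (c i₀).1 ((c i₀).2.2 i₂) / (∑ i, ∑ l, D₂ (c i).1 ((c i).2.2 l)))))) := by
  have hJ : (0 : ℝ) ≤ (Fintype.card J : ℝ) - 1 := sub_nonneg.2 (by
    exact_mod_cast Fintype.card_pos_iff.2 ⟨j₀⟩)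
  have hK : (0 : ℝ) ≤ (Fintype.card (I₁ × J) : ℝ) - 1 := sub_nonneg.2 (by
    exact_mod_cast Fintype.card_pos_iff.2 ⟨(i₁, j₀)⟩)
  have hI : (0 : ℝ) ≤ (Fintype.card I₀ : ℝ) - 1 := sub_nonneg.2 (by
    exact_mod_cast Fintype.card_pos_iff.2 ⟨i₀⟩)
  have hL : (0 : ℝ) ≤ (Fintype.card I₂ : ℝ) - 1 := sub_nonneg.2 (by
    exact_mod_cast Fintype.card_pos_iff.2 ⟨i₂⟩)
  -- A bounds, and B and C equal, the conditional means given the codeword triple of the three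
  -- random normalisers.
  set A : W → U → V → ℝ := fun w u v => a w u v + ((Fintype.card J : ℝ) - 1) with hA
  set B : W → U → ℝ := fun w u => D₁ w u + ((Fintype.card (I₁ × J) : ℝ) - 1) *
      (∑ u', pu w u' * D₁ w u') + ((Fintype.card I₀ : ℝ) - 1) * Fintype.card (I₁ × J) *
          ∑ w', pw w' * ∑ u', pu w' u' * D₁ w' u' with hB
  set C : W → V → ℝ := fun w v => D₂ w v + ((Fintype.card I₂ : ℝ) - 1) *
      (∑ v', pv w v' * D₂ w v') + ((Fintype.card I₀ : ℝ) - 1) * Fintype.card I₂ *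
          ∑ w', pw w' * ∑ v', pv w' v' * D₂ w' v' with hC
  have hb₁ : ∀ w, 0 ≤ ∑ u', pu w u' * D₁ w u' := fun w =>
    Finset.sum_nonneg fun u _ => mul_nonneg (hu0 _ _) (hD₁ _ _)
  have hb₂ : ∀ w, 0 ≤ ∑ v', pv w v' * D₂ w v' := fun w =>
    Finset.sum_nonneg fun v _ => mul_nonneg (hv0 _ _) (hD₂ _ _)
  have hAa : ∀ w u v, a w u v ≤ A w u v := fun w u v => le_add_of_nonneg_right hJ
  have hBD : ∀ w u, D₁ w u ≤ B w u := fun w u => by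
    have h1 := mul_nonneg hK (hb₁ w)
    have h2 := mul_nonneg (mul_nonneg hI (Nat.cast_nonneg (α := ℝ) (Fintype.card (I₁ × J))))
      (Finset.sum_nonneg fun w (_ : w ∈ Finset.univ) => mul_nonneg (hw0 w) (hb₁ w))
    simp only [hB]; linarith
  have hCD : ∀ w v, D₂ w v ≤ C w v := fun w v => by
    have h1 := mul_nonneg hL (hb₂ w)
    have h2 := mul_nonneg (mul_nonneg hI (Nat.cast_nonneg (α := ℝ) (Fintype.card I₂)))
      (Finset.sum_nonneg fun w (_ : w ∈ Finset.univ) => mul_nonneg (hw0 w) (hb₂ w))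
    simp only [hC]; linarith
  set φ : W → U → V → ℝ := fun w u v => g w u v * (a w u v * D₁ w u * D₂ w v /
    (A w u v * B w u * C w v)) with hφ
  have hA0 : ∀ w u v, 0 ≤ A w u v := fun w u v => (ha0 w u v).trans (hAa w u v)
  have hB0 : ∀ w u, 0 ≤ B w u := fun w u => (hD₁ w u).trans (hBD w u)
  have hC0 : ∀ w v, 0 ≤ C w v := fun w v => (hD₂ w v).trans (hCD w v)
  have hφ0 : ∀ w u v, 0 ≤ φ w u v := fun w u v => mul_nonneg (hg _ _ _) (div_nonneg
    (mul_nonneg (mul_nonneg (ha0 _ _ _) (hD₁ _ _)) (hD₂ _ _))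
    (mul_nonneg (mul_nonneg (hA0 _ _ _) (hB0 _ _)) (hC0 _ _)))
  have hμ : ∀ c : I₀ → W × (I₁ × J → U) × (I₂ → V), 0 ≤ codebookMass pw pu pv c := fun c =>
    Finset.prod_nonneg fun i _ => mul_nonneg (hw0 _) (mul_nonneg
      (Finset.prod_nonneg fun _ _ => hu0 _ _) (Finset.prod_nonneg fun _ _ => hv0 _ _))
  -- The tangent bound for each codebook. Averaging makes each subtracted term at most the mean of
  -- φ, so 4 - 1 - 1 - 1 = 1 copy of that mean survives.
  have hpt : ∀ c : I₀ → W × (I₁ × J → U) × (I₂ → V),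
      4 * φ (c i₀).1 ((c i₀).2.1 (i₁, j₀)) ((c i₀).2.2 i₂)
      - φ (c i₀).1 ((c i₀).2.1 (i₁, j₀)) ((c i₀).2.2 i₂) /
          A (c i₀).1 ((c i₀).2.1 (i₁, j₀)) ((c i₀).2.2 i₂) *
          (∑ j, a (c i₀).1 ((c i₀).2.1 (i₁, j)) ((c i₀).2.2 i₂))
      - φ (c i₀).1 ((c i₀).2.1 (i₁, j₀)) ((c i₀).2.2 i₂) / B (c i₀).1 ((c i₀).2.1 (i₁, j₀)) *
          (∑ i, ∑ k, D₁ (c i).1 ((c i).2.1 k))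
      - φ (c i₀).1 ((c i₀).2.1 (i₁, j₀)) ((c i₀).2.2 i₂) / C (c i₀).1 ((c i₀).2.2 i₂) *
          (∑ i, ∑ l, D₂ (c i).1 ((c i).2.2 l)) ≤
      g (c i₀).1 ((c i₀).2.1 (i₁, j₀)) ((c i₀).2.2 i₂) *
        (a (c i₀).1 ((c i₀).2.1 (i₁, j₀)) ((c i₀).2.2 i₂) /
            (∑ j, a (c i₀).1 ((c i₀).2.1 (i₁, j)) ((c i₀).2.2 i₂)) *
          (D₁ (c i₀).1 ((c i₀).2.1 (i₁, j₀)) / (∑ i, ∑ k, D₁ (c i).1 ((c i).2.1 k)) *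
          (D₂ (c i₀).1 ((c i₀).2.2 i₂) / (∑ i, ∑ l, D₂ (c i).1 ((c i).2.2 l))))) := by
    intro c
    have hS := Finset.single_le_sum (f := fun j => a (c i₀).1 ((c i₀).2.1 (i₁, j)) ((c i₀).2.2 i₂))
      (fun j _ => ha0 _ _ _) (Finset.mem_univ j₀)
    have hS₁ := (Finset.single_le_sum (f := fun k => D₁ (c i₀).1 ((c i₀).2.1 k))
      (fun k _ => hD₁ _ _) (Finset.mem_univ (i₁, j₀))).trans
      (Finset.single_le_sum (f := fun i => ∑ k, D₁ (c i).1 ((c i).2.1 k))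
        (fun i _ => Finset.sum_nonneg fun k _ => hD₁ _ _) (Finset.mem_univ i₀))
    have hS₂ := (Finset.single_le_sum (f := fun l => D₂ (c i₀).1 ((c i₀).2.2 l))
      (fun k _ => hD₂ _ _) (Finset.mem_univ i₂)).trans
      (Finset.single_le_sum (f := fun i => ∑ l, D₂ (c i).1 ((c i).2.2 l))
        (fun i _ => Finset.sum_nonneg fun k _ => hD₂ _ _) (Finset.mem_univ i₀))
    generalize (∑ j, a (c i₀).1 ((c i₀).2.1 (i₁, j)) ((c i₀).2.2 i₂)) = S at *
    generalize (∑ i, ∑ k, D₁ (c i).1 ((c i).2.1 k)) = S₁ at *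
    generalize (∑ i, ∑ l, D₂ (c i).1 ((c i).2.2 l)) = S₂ at *
    generalize (c i₀).1 = w at *
    generalize (c i₀).2.1 (i₁, j₀) = u at *
    generalize (c i₀).2.2 i₂ = v at *
    by_cases h0 : g w u v = 0
    · simp [hφ, h0]
    by_cases h1 : a w u v = 0
    · simp [hφ, h1]
    obtain ⟨hp₁, hp₂⟩ := hpos w u v h0 h1
    have ha' := (ha0 w u v).lt_of_ne' h1
    have h := mul_le_mul_of_nonneg_left (ratio_prod_ge ha' hp₁ hp₂ (ha'.trans_le hS)
      (hp₁.trans_le hS₁) (hp₂.trans_le hS₂) (ha'.trans_le (hAa w u v)) (hp₁.trans_le (hBD w u))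
      (hp₂.trans_le (hCD w v))) (hg w u v)
    refine le_trans (le_of_eq ?_) h
    simp only [hφ]
    ring
  refine le_trans ?_ (Finset.sum_le_sum fun c _ => mul_le_mul_of_nonneg_left (hpt c) (hμ c))
  simp only [mul_sub, Finset.sum_sub_distrib]
  have e1 := sum_codebookMass_triple hw hu hv i₀ (i₁, j₀) i₂ (fun w u v => 4 * φ w u v)
  have e2 := sum_codebookMass_bin hw0 hu0 hv0 hw hu hv i₀ i₁ j₀ i₂
    (fun w u v => φ w u v / A w u v) a (fun w u v => div_nonneg (hφ0 _ _ _) (hA0 _ _ _)) ha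
  have e3 := sum_codebookMass_left hw hu hv i₀ (i₁, j₀) i₂ (fun w u v => φ w u v / B w u) D₁
  have e4 := sum_codebookMass_right hw hu hv i₀ (i₁, j₀) i₂ (fun w u v => φ w u v / C w v) D₂
  have m2 : tripleMean pw pu pv (fun w u v => φ w u v / A w u v * A w u v) ≤
      tripleMean pw pu pv φ :=
    tripleMean_mono hw0 hu0 hv0 fun w u v => div_mul_self_le (hφ0 w u v) _
  have m3 : tripleMean pw pu pv (fun w u v => φ w u v / B w u * B w u) ≤ tripleMean pw pu pv φ :=
    tripleMean_mono hw0 hu0 hv0 fun w u v => div_mul_self_le (hφ0 w u v) _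
  have m4 : tripleMean pw pu pv (fun w u v => φ w u v / C w v * C w v) ≤ tripleMean pw pu pv φ :=
    tripleMean_mono hw0 hu0 hv0 fun w u v => div_mul_self_le (hφ0 w u v) _
  have m1 : tripleMean pw pu pv (fun w u v => 4 * φ w u v) = 4 * tripleMean pw pu pv φ := by
    have := tripleMean_add_mul (pw := pw) (pu := pu) (pv := pv) (fun _ _ _ => 0) φ 4
    simp only [zero_add] at this
    rw [← this]
    simp [tripleMean]
  have e1' := e1.trans m1
  have e2' := e2.trans m2
  have e3' := e3.trans_le m3
  have e4' := e4.trans_le m4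
  linarith

end OneShot

end BC

namespace BC

section OneShot

variable {W U V X Y Z I₀ I₁ I₂ J N₁ N₂ : Type*} [Fintype W] [Fintype U] [Fintype V] [Fintype X]
  [Fintype Y] [Fintype Z] [Fintype I₀] [Fintype I₁] [Fintype I₂] [Fintype J] [Fintype N₁]
  [Fintype N₂] [DecidableEq I₀] [DecidableEq I₁] [DecidableEq I₂] [DecidableEq J] [DecidableEq N₁]
  [DecidableEq N₂]

theorem sum_embedding_le {A B : Type*} [Fintype A] [Fintype B] (e : A ↪ B) (f : B → ℝ)
    (hf : ∀ b, 0 ≤ f b) : ∑ a, f (e a) ≤ ∑ b, f b := by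
  rw [← Finset.sum_map Finset.univ e f]
  exact Finset.sum_le_univ_sum_of_nonneg hf

/-- A one-shot form of Marton's coding theorem, with a common message part. -/
theorem exists_code_of_likelihood [Nonempty N₁] [Nonempty N₂] [Nonempty X] [Nonempty J]
    [Nonempty W] [Nonempty U] [Nonempty V]
    {pw : W → ℝ} {pu : W → U → ℝ} {pv : W → V → ℝ}
    (hw0 : ∀ w, 0 ≤ pw w) (hu0 : ∀ w u, 0 ≤ pu w u) (hv0 : ∀ w v, 0 ≤ pv w v)
    (hw : ∑ w, pw w = 1) (hu : ∀ w, ∑ u, pu w u = 1) (hv : ∀ w, ∑ v, pv w v = 1)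
    (a : W → U → V → ℝ) (ha0 : ∀ w u v, 0 ≤ a w u v) (ha : ∀ w v, ∑ u, pu w u * a w u v ≤ 1)
    (px : W → U → V → X → ℝ) (hx0 : ∀ w u v x, 0 ≤ px w u v x) (hx : ∀ w u v, ∑ x, px w u v x = 1)
    (Q : X → Y → Z → ℝ) (hQ : ∀ x y z, 0 ≤ Q x y z)
    (D₁ : W → U → Y → ℝ) (hD₁ : ∀ w u y, 0 ≤ D₁ w u y)
    (D₂ : W → V → Z → ℝ) (hD₂ : ∀ w v z, 0 ≤ D₂ w v z)
    (hpos : ∀ w u v x y z, px w u v x * Q x y z ≠ 0 → a w u v ≠ 0 → 0 < D₁ w u y ∧ 0 < D₂ w v z)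
    (ι₁ : N₁ ↪ I₀ × I₁) (ι₂ : N₂ ↪ I₂) :
    ∃ (enc : N₁ × N₂ → X) (d₁ : Y → N₁) (d₂ : Z → N₂),
      (Fintype.card N₁ : ℝ) * Fintype.card N₂ * (Fintype.card J * ∑ x, ∑ y, ∑ z,
        tripleMean pw pu pv (fun w u v => px w u v x * Q x y z * (a w u v * D₁ w u y * D₂ w v z /
          ((a w u v + ((Fintype.card J : ℝ) - 1)) *
          (D₁ w u y + ((Fintype.card (I₁ × J) : ℝ) - 1) * ∑ u', pu w u' * D₁ w u' y
            + ((Fintype.card I₀ : ℝ) - 1) * Fintype.card (I₁ × J) *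
              ∑ w', pw w' * ∑ u', pu w' u' * D₁ w' u' y) *
          (D₂ w v z + ((Fintype.card I₂ : ℝ) - 1) * ∑ v', pv w v' * D₂ w v' z
            + ((Fintype.card I₀ : ℝ) - 1) * Fintype.card I₂ *
              ∑ w', pw w' * ∑ v', pv w' v' * D₂ w' v' z))))) ≤
        ∑ m : N₁ × N₂, ∑ y, ∑ z, if d₁ y = m.1 ∧ d₂ z = m.2 then Q (enc m) y z else 0 := by
  let SA : (I₀ → W × (I₁ × J → U) × (I₂ → V)) → I₀ → I₁ → I₂ → ℝ := fun c i₀ i₁ i₂ =>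
    ∑ j, a (c i₀).1 ((c i₀).2.1 (i₁, j)) ((c i₀).2.2 i₂)
  let S₁ : (I₀ → W × (I₁ × J → U) × (I₂ → V)) → Y → ℝ := fun c y =>
    ∑ i, ∑ k, D₁ (c i).1 ((c i).2.1 k) y
  let S₂ : (I₀ → W × (I₁ × J → U) × (I₂ → V)) → Z → ℝ := fun c z =>
    ∑ i, ∑ l, D₂ (c i).1 ((c i).2.2 l) z
  let τ : (I₀ → W × (I₁ × J → U) × (I₂ → V)) → I₀ → I₁ → I₂ → J → X → Y → Z → ℝ :=
    fun c i₀ i₁ i₂ j x y z =>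
      px (c i₀).1 ((c i₀).2.1 (i₁, j)) ((c i₀).2.2 i₂) x * Q x y z *
        (a (c i₀).1 ((c i₀).2.1 (i₁, j)) ((c i₀).2.2 i₂) / SA c i₀ i₁ i₂ *
          (D₁ (c i₀).1 ((c i₀).2.1 (i₁, j)) y / S₁ c y *
          (D₂ (c i₀).1 ((c i₀).2.2 i₂) z / S₂ c z)))
  have hSA : ∀ c i₀ i₁ i₂, 0 ≤ SA c i₀ i₁ i₂ := fun c i₀ i₁ i₂ =>
    Finset.sum_nonneg fun j _ => ha0 _ _ _
  have hS₁ : ∀ c y, 0 ≤ S₁ c y := fun c y =>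
    Finset.sum_nonneg fun i _ => Finset.sum_nonneg fun k _ => hD₁ _ _ _
  have hS₂ : ∀ c z, 0 ≤ S₂ c z := fun c z =>
    Finset.sum_nonneg fun i _ => Finset.sum_nonneg fun k _ => hD₂ _ _ _
  have hτ : ∀ c i₀ i₁ i₂ j x y z, 0 ≤ τ c i₀ i₁ i₂ j x y z := fun c i₀ i₁ i₂ j x y z =>
    mul_nonneg (mul_nonneg (hx0 _ _ _ _) (hQ _ _ _)) (mul_nonneg
      (div_nonneg (ha0 _ _ _) (hSA _ _ _ _)) (mul_nonneg (div_nonneg (hD₁ _ _ _) (hS₁ _ _))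
        (div_nonneg (hD₂ _ _ _) (hS₂ _ _))))
  have hμ : ∀ c : I₀ → W × (I₁ × J → U) × (I₂ → V), 0 ≤ codebookMass pw pu pv c := fun c =>
    Finset.prod_nonneg fun i _ => mul_nonneg (hw0 _) (mul_nonneg
      (Finset.prod_nonneg fun _ _ => hu0 _ _) (Finset.prod_nonneg fun _ _ => hv0 _ _))
  -- A codebook at least as good as the average is fixed before the encoder and the decoders are
  -- derandomised.
  obtain ⟨c, hc⟩ := exists_sum_mul_le (codebookMass (I := I₀) (K := I₁ × J) (L := I₂) pw pu pv)
    (fun c => ∑ m : N₁ × N₂, ∑ j, ∑ x, ∑ y, ∑ z, τ c (ι₁ m.1).1 (ι₁ m.1).2 (ι₂ m.2) j x y z) hμ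
    (sum_codebookMass hw hu hv).le (fun c => Finset.sum_nonneg fun m _ => Finset.sum_nonneg
      fun j _ => Finset.sum_nonneg fun x _ => Finset.sum_nonneg fun y _ => Finset.sum_nonneg
      fun z _ => hτ _ _ _ _ _ _ _ _)
  -- The first message picks a cloud and a bin in it, the second a satellite index. The encoder
  -- draws j in the bin with weight a, then the input. The first decoder sums its likelihoods over
  -- j, the second over the cloud index, neither of which it must report.
  obtain ⟨enc, d₁, d₂, hdet⟩ := exists_deterministic Q hQ
    (fun (m : N₁ × N₂) x => ∑ j, a (c (ι₁ m.1).1).1 ((c (ι₁ m.1).1).2.1 ((ι₁ m.1).2, j))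
      ((c (ι₁ m.1).1).2.2 (ι₂ m.2)) / SA c (ι₁ m.1).1 (ι₁ m.1).2 (ι₂ m.2) *
      px (c (ι₁ m.1).1).1 ((c (ι₁ m.1).1).2.1 ((ι₁ m.1).2, j)) ((c (ι₁ m.1).1).2.2 (ι₂ m.2)) x)
    (fun m x => Finset.sum_nonneg fun j _ => mul_nonneg (div_nonneg (ha0 _ _ _) (hSA _ _ _ _))
      (hx0 _ _ _ _))
    (fun m => by
      rw [Finset.sum_comm]
      simp only [← Finset.mul_sum, hx, mul_one]
      rw [← Finset.sum_div]
      exact div_self_le_one _)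
    (fun y m₁ => ∑ j, D₁ (c (ι₁ m₁).1).1 ((c (ι₁ m₁).1).2.1 ((ι₁ m₁).2, j)) y / S₁ c y)
    (fun y m₁ => Finset.sum_nonneg fun j _ => div_nonneg (hD₁ _ _ _) (hS₁ _ _))
    (fun y => by
      simp only [← Finset.sum_div]
      refine (div_le_div_of_nonneg_right (sum_embedding_le ι₁
        (fun p => ∑ j, D₁ (c p.1).1 ((c p.1).2.1 (p.2, j)) y)
        (fun p => Finset.sum_nonneg fun j _ => hD₁ _ _ _)) (hS₁ c y)).trans ?_
      simp only [Fintype.sum_prod_type, S₁]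
      exact div_self_le_one _)
    (fun z m₂ => ∑ i, D₂ (c i).1 ((c i).2.2 (ι₂ m₂)) z / S₂ c z)
    (fun z m₂ => Finset.sum_nonneg fun j _ => div_nonneg (hD₂ _ _ _) (hS₂ _ _))
    (fun z => by
      simp only [← Finset.sum_div]
      refine (div_le_div_of_nonneg_right (sum_embedding_le ι₂
        (fun l => ∑ i, D₂ (c i).1 ((c i).2.2 l) z)
        (fun p => Finset.sum_nonneg fun j _ => hD₂ _ _ _)) (hS₂ c z)).trans ?_
      rw [Finset.sum_comm]
      exact div_self_le_one _)
  refine ⟨enc, d₁, d₂, le_trans ?_ (hc.trans (le_trans ?_ hdet))⟩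
  · have hconst : ∀ s : ℝ, (Fintype.card N₁ : ℝ) * Fintype.card N₂ * (Fintype.card J * s) =
        ∑ _m : N₁ × N₂, ∑ _j : J, s := fun s => by
      simp [Fintype.card_prod]
    rw [hconst]
    have hswap : ∑ c, codebookMass pw pu pv c * ∑ m : N₁ × N₂, ∑ j, ∑ x, ∑ y, ∑ z,
        τ c (ι₁ m.1).1 (ι₁ m.1).2 (ι₂ m.2) j x y z = ∑ m : N₁ × N₂, ∑ j, ∑ x, ∑ y, ∑ z,
        ∑ c, codebookMass pw pu pv c * τ c (ι₁ m.1).1 (ι₁ m.1).2 (ι₂ m.2) j x y z := by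
      simp only [Finset.mul_sum]
      rw [Finset.sum_comm]
      refine Finset.sum_congr rfl fun m _ => ?_
      rw [Finset.sum_comm]
      refine Finset.sum_congr rfl fun j _ => ?_
      rw [Finset.sum_comm]
      refine Finset.sum_congr rfl fun x _ => ?_
      rw [Finset.sum_comm]
      exact Finset.sum_congr rfl fun y _ => Finset.sum_comm
    rw [hswap]
    refine Finset.sum_le_sum fun m _ => Finset.sum_le_sum fun j _ => Finset.sum_le_sum fun x _ =>
      Finset.sum_le_sum fun y _ => Finset.sum_le_sum fun z _ => ?_
    exact likelihood_success_ge hw0 hu0 hv0 hw hu hv a (fun w u v => px w u v x * Q x y z) ha0 ha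
      (fun w u v => mul_nonneg (hx0 _ _ _ _) (hQ _ _ _)) (fun w u => D₁ w u y)
      (fun w u => hD₁ w u y) (fun w v => D₂ w v z) (fun w v => hD₂ w v z)
      (fun w u v => hpos w u v x y z) (ι₁ m.1).1 (ι₁ m.1).2 j (ι₂ m.2)
  -- The decoders' sums are bounded below by the term in which the transmitted j and cloud are
  -- recovered.
  · refine Finset.sum_le_sum fun m _ => ?_
    rw [Finset.sum_comm]
    refine Finset.sum_le_sum fun x _ => ?_
    rw [Finset.sum_mul]
    refine Finset.sum_le_sum fun j _ => ?_
    simp only [Finset.mul_sum (s := (Finset.univ : Finset Y)),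
      Finset.mul_sum (s := (Finset.univ : Finset Z))]
    refine Finset.sum_le_sum fun y _ => Finset.sum_le_sum fun z _ => ?_
    have h1 := Finset.single_le_sum (f := fun j => D₁ (c (ι₁ m.1).1).1
      ((c (ι₁ m.1).1).2.1 ((ι₁ m.1).2, j)) y / S₁ c y)
      (fun j _ => div_nonneg (hD₁ _ _ _) (hS₁ _ _)) (Finset.mem_univ j)
    have h2 := Finset.single_le_sum (f := fun i => D₂ (c i).1 ((c i).2.2 (ι₂ m.2)) z / S₂ c z)
      (fun j _ => div_nonneg (hD₂ _ _ _) (hS₂ _ _)) (Finset.mem_univ (ι₁ m.1).1)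
    have h3 := mul_le_mul h1 h2 (div_nonneg (hD₂ _ _ _) (hS₂ _ _))
      (Finset.sum_nonneg fun j _ => div_nonneg (hD₁ _ _ _) (hS₁ _ _))
    refine le_trans (le_of_eq ?_) (mul_le_mul_of_nonneg_left h3
      (mul_nonneg (mul_nonneg (div_nonneg
        (ha0 (c (ι₁ m.1).1).1 ((c (ι₁ m.1).1).2.1 ((ι₁ m.1).2, j)) ((c (ι₁ m.1).1).2.2 (ι₂ m.2)))
        (hSA c (ι₁ m.1).1 (ι₁ m.1).2 (ι₂ m.2)))
        (hx0 (c (ι₁ m.1).1).1 ((c (ι₁ m.1).1).2.1 ((ι₁ m.1).2, j))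
          ((c (ι₁ m.1).1).2.2 (ι₂ m.2)) x)) (hQ x y z)) |>.trans (le_of_eq ?_))
    · simp only [τ]; ring
    · ring

end OneShot

end BC

/-! ### Error bounds with fractional moments, for abstract ensembles. -/

namespace BC

theorem self_le_rpow_or_one_le {t s : ℝ} (ht : 0 ≤ t) (hs0 : 0 < s) (hs1 : s ≤ 1) :
    t ≤ t ^ s ∨ 1 ≤ t ^ s := by
  rcases le_total t 1 with h | h
  · rcases ht.eq_or_lt with h0 | h0
    · left; rw [← h0, Real.zero_rpow hs0.ne']
    · left
      simpa using Real.rpow_le_rpow_of_exponent_ge h0 h hs1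
  · right; exact Real.one_le_rpow h hs0.le

/-- Without exponents it follows from 1 + x ≤ exp x. Passing to powers costs nothing: either t ≤
t^s, or t^s ≥ 1 and the left side is not positive. -/
theorem one_sub_sum_rpow_le {t₁ t₂ t₃ t₄ t₅ s : ℝ} (h₁ : 0 ≤ t₁) (h₂ : 0 ≤ t₂) (h₃ : 0 ≤ t₃)
    (h₄ : 0 ≤ t₄) (h₅ : 0 ≤ t₅) (hs0 : 0 < s) (hs1 : s ≤ 1) :
    1 - (t₁ ^ s + t₂ ^ s + t₃ ^ s + t₄ ^ s + t₅ ^ s) ≤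
      1 / ((1 + t₁) * (1 + t₂ + t₃) * (1 + t₄ + t₅)) := by
  have hp : 0 < (1 + t₁) * (1 + t₂ + t₃) * (1 + t₄ + t₅) := by positivity
  have hexp : 1 - (t₁ + t₂ + t₃ + t₄ + t₅) ≤ 1 / ((1 + t₁) * (1 + t₂ + t₃) * (1 + t₄ + t₅)) := by
    rw [le_div_iff₀ hp]
    have e1 := Real.add_one_le_exp t₁
    have e2 := Real.add_one_le_exp (t₂ + t₃)
    have e3 := Real.add_one_le_exp (t₄ + t₅)
    have e4 := Real.add_one_le_exp (-(t₁ + t₂ + t₃ + t₄ + t₅))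
    calc _ ≤ Real.exp (-(t₁ + t₂ + t₃ + t₄ + t₅)) *
          ((1 + t₁) * (1 + t₂ + t₃) * (1 + t₄ + t₅)) :=
          mul_le_mul_of_nonneg_right (by linarith) hp.le
      _ ≤ Real.exp (-(t₁ + t₂ + t₃ + t₄ + t₅)) *
          (Real.exp t₁ * Real.exp (t₂ + t₃) * Real.exp (t₄ + t₅)) := by
          gcongr <;> linarith
      _ = 1 := by
          rw [← Real.exp_add, ← Real.exp_add, ← Real.exp_add, ← Real.exp_zero]
          congr 1; ring
  have n1 := Real.rpow_nonneg h₁ s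
  have n2 := Real.rpow_nonneg h₂ s
  have n3 := Real.rpow_nonneg h₃ s
  have n4 := Real.rpow_nonneg h₄ s
  have n5 := Real.rpow_nonneg h₅ s
  have hpos := (one_div_pos.2 hp).le
  rcases self_le_rpow_or_one_le h₁ hs0 hs1 with a1 | a1
  swap; · linarith
  rcases self_le_rpow_or_one_le h₂ hs0 hs1 with a2 | a2
  swap; · linarith
  rcases self_le_rpow_or_one_le h₃ hs0 hs1 with a3 | a3
  swap; · linarith
  rcases self_le_rpow_or_one_le h₄ hs0 hs1 with a4 | a4
  swap; · linarith
  rcases self_le_rpow_or_one_le h₅ hs0 hs1 with a5 | a5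
  swap; · linarith
  linarith

/-- The five terms are the failures: the bin lacks a jointly fitting member, and each decoder
confuses codewords within the cluster or across clusters. The parameter κ is 1/J in general, and can
be 0 when J = 1 and a ≤ 1. -/
theorem one_sub_le_likelihood_ratio {a J κ D₁ D₂ k₁ k₂ k₃ k₄ b₁ c₁ b₂ c₂ s : ℝ} (ha : 0 < a)
    (hJ : 1 ≤ J) (hκ : 0 ≤ κ) (haJ : a + (J - 1) ≤ J * (1 + κ * a)) (hD₁ : 0 < D₁) (hD₂ : 0 < D₂)
    (hk₁ : 0 ≤ k₁) (hk₂ : 0 ≤ k₂) (hk₃ : 0 ≤ k₃) (hk₄ : 0 ≤ k₄) (hb₁ : 0 ≤ b₁) (hc₁ : 0 ≤ c₁)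
    (hb₂ : 0 ≤ b₂) (hc₂ : 0 ≤ c₂) (hs0 : 0 < s) (hs1 : s ≤ 1) :
    1 - (κ ^ s * a ^ s + k₁ ^ s * (b₁ / D₁) ^ s + k₂ ^ s * (c₁ / D₁) ^ s +
      k₃ ^ s * (b₂ / D₂) ^ s + k₄ ^ s * (c₂ / D₂) ^ s) ≤
    J * (D₁ * D₂ / ((a + (J - 1)) * (D₁ + k₁ * b₁ + k₂ * c₁) * (D₂ + k₃ * b₂ + k₄ * c₂))) := by
  have hb₁' := div_nonneg hb₁ hD₁.le
  have hc₁' := div_nonneg hc₁ hD₁.le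
  have hb₂' := div_nonneg hb₂ hD₂.le
  have hc₂' := div_nonneg hc₂ hD₂.le
  simp only [← Real.mul_rpow hκ ha.le, ← Real.mul_rpow hk₁ hb₁', ← Real.mul_rpow hk₂ hc₁',
    ← Real.mul_rpow hk₃ hb₂', ← Real.mul_rpow hk₄ hc₂']
  refine (one_sub_sum_rpow_le (mul_nonneg hκ ha.le) (mul_nonneg hk₁ hb₁') (mul_nonneg hk₂ hc₁')
    (mul_nonneg hk₃ hb₂') (mul_nonneg hk₄ hc₂') hs0 hs1).trans ?_
  have hA : 0 < a + (J - 1) := by linarith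
  have hB : 0 < D₁ + k₁ * b₁ + k₂ * c₁ := by positivity
  have hC : 0 < D₂ + k₃ * b₂ + k₄ * c₂ := by positivity
  have hB' : 1 + k₁ * (b₁ / D₁) + k₂ * (c₁ / D₁) = (D₁ + k₁ * b₁ + k₂ * c₁) / D₁ := by
    field_simp
  have hC' : 1 + k₃ * (b₂ / D₂) + k₄ * (c₂ / D₂) = (D₂ + k₃ * b₂ + k₄ * c₂) / D₂ := by
    field_simp
  rw [hB', hC']
  have hJ0 : 0 < J := by linarith
  calc 1 / ((1 + κ * a) * ((D₁ + k₁ * b₁ + k₂ * c₁) / D₁) * ((D₂ + k₃ * b₂ + k₄ * c₂) / D₂))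
      ≤ 1 / (((a + (J - 1)) / J) * ((D₁ + k₁ * b₁ + k₂ * c₁) / D₁) *
        ((D₂ + k₃ * b₂ + k₄ * c₂) / D₂)) := by
        refine one_div_le_one_div_of_le (by positivity) ?_
        have : (a + (J - 1)) / J ≤ 1 + κ * a := by rw [div_le_iff₀ hJ0]; linarith
        gcongr
    _ = _ := by field_simp

/-- A random code ensemble: cluster centers `W`, satellites `U` and `V` that are independent given
`W`, the target density `a` of the pair of satellites, the input kernel `px`, and the decoding
metrics `D₁`, `D₂` of the receivers. -/
structure Ensemble (W U V X Y Z : Type*) [Fintype W] [Fintype U] [Fintype V] [Fintype X] where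
  pw : W → ℝ
  pu : W → U → ℝ
  pv : W → V → ℝ
  px : W → U → V → X → ℝ
  a : W → U → V → ℝ
  D₁ : W → U → Y → ℝ
  D₂ : W → V → Z → ℝ
  Q : X → Y → Z → ℝ
  pw_nonneg : ∀ w, 0 ≤ pw w
  pu_nonneg : ∀ w u, 0 ≤ pu w u
  pv_nonneg : ∀ w v, 0 ≤ pv w v
  px_nonneg : ∀ w u v x, 0 ≤ px w u v x
  a_nonneg : ∀ w u v, 0 ≤ a w u v
  D₁_nonneg : ∀ w u y, 0 ≤ D₁ w u y
  D₂_nonneg : ∀ w v z, 0 ≤ D₂ w v z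
  Q_nonneg : ∀ x y z, 0 ≤ Q x y z
  sum_pw : ∑ w, pw w = 1
  sum_pu : ∀ w, ∑ u, pu w u = 1
  sum_pv : ∀ w, ∑ v, pv w v = 1
  sum_px : ∀ w u v, ∑ x, px w u v x = 1
  sum_a : ∀ w v, ∑ u, pu w u * a w u v ≤ 1
  pos : ∀ w u v x y z, px w u v x * Q x y z ≠ 0 → a w u v ≠ 0 → 0 < D₁ w u y ∧ 0 < D₂ w v z

namespace Ensemble

variable {W U V X Y Z : Type*} [Fintype W] [Fintype U] [Fintype V] [Fintype X] [Fintype Y]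
  [Fintype Z] (E : Ensemble W U V X Y Z)

/-- The average of the metric `D₁` over the satellites of a cluster. -/
def b₁ (w : W) (y : Y) : ℝ := ∑ u, E.pu w u * E.D₁ w u y

/-- The average of the metric `D₁` over all clusters. -/
def c₁ (y : Y) : ℝ := ∑ w, E.pw w * E.b₁ w y

/-- The average of the metric `D₂` over the satellites of a cluster. -/
def b₂ (w : W) (z : Z) : ℝ := ∑ v, E.pv w v * E.D₂ w v z

/-- The average of the metric `D₂` over all clusters. -/
def c₂ (z : Z) : ℝ := ∑ w, E.pw w * E.b₂ w z

theorem b₁_nonneg (w y) : 0 ≤ E.b₁ w y :=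
  Finset.sum_nonneg fun _ _ => mul_nonneg (E.pu_nonneg _ _) (E.D₁_nonneg _ _ _)

theorem c₁_nonneg (y) : 0 ≤ E.c₁ y :=
  Finset.sum_nonneg fun _ _ => mul_nonneg (E.pw_nonneg _) (E.b₁_nonneg _ _)

theorem b₂_nonneg (w z) : 0 ≤ E.b₂ w z :=
  Finset.sum_nonneg fun _ _ => mul_nonneg (E.pv_nonneg _ _) (E.D₂_nonneg _ _ _)

theorem c₂_nonneg (z) : 0 ≤ E.c₂ z :=
  Finset.sum_nonneg fun _ _ => mul_nonneg (E.pw_nonneg _) (E.b₂_nonneg _ _)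

/-- The joint mass function of the ensemble. -/
def mass (x : X) (y : Y) (z : Z) (w : W) (u : U) (v : V) : ℝ :=
  E.pw w * (E.pu w u * (E.pv w v * (E.px w u v x * E.Q x y z * E.a w u v)))

theorem mass_nonneg (x y z w u v) : 0 ≤ E.mass x y z w u v :=
  mul_nonneg (E.pw_nonneg _) (mul_nonneg (E.pu_nonneg _ _) (mul_nonneg (E.pv_nonneg _ _)
    (mul_nonneg (mul_nonneg (E.px_nonneg _ _ _ _) (E.Q_nonneg _ _ _)) (E.a_nonneg _ _ _))))

/-- Integration against the joint mass function. -/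
def expect (g : W → U → V → Y → Z → ℝ) : ℝ :=
  ∑ x, ∑ y, ∑ z, ∑ w, ∑ u, ∑ v, E.mass x y z w u v * g w u v y z

theorem expect_add (f g : W → U → V → Y → Z → ℝ) :
    E.expect (fun w u v y z => f w u v y z + g w u v y z) = E.expect f + E.expect g := by
  simp only [expect, mul_add, Finset.sum_add_distrib]

theorem expect_const_mul (r : ℝ) (g : W → U → V → Y → Z → ℝ) :
    E.expect (fun w u v y z => r * g w u v y z) = r * E.expect g := by
  simp only [expect, mul_left_comm _ r, ← Finset.mul_sum]

theorem expect_sub (f g : W → U → V → Y → Z → ℝ) :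
    E.expect (fun w u v y z => f w u v y z - g w u v y z) = E.expect f - E.expect g := by
  simp only [expect, mul_sub, Finset.sum_sub_distrib]

/-- The pointwise ratio bound is integrated against the joint mass; points of zero mass are split
off because the ratio bound needs positive metrics. -/
theorem exists_code [Nonempty W] [Nonempty U] [Nonempty V] [Nonempty X]
    (hE : E.expect (fun _ _ _ _ _ => 1) = 1) {n₁ n₂ m₀ m₁ j m₂ : ℕ} (hn₁ : 0 < n₁) (hn₂ : 0 < n₂)
    (hm₀ : 0 < m₀) (hm₁ : 0 < m₁) (hj : 0 < j) (h₁ : n₁ ≤ m₀ * m₁) (h₂ : n₂ ≤ m₂) {κ s : ℝ}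
    (hκ : 0 ≤ κ) (haJ : ∀ w u v, E.a w u v + ((j : ℝ) - 1) ≤ j * (1 + κ * E.a w u v))
    (hs0 : 0 < s) (hs1 : s ≤ 1) :
    ∃ (enc : Fin n₁ × Fin n₂ → X) (d₁ : Y → Fin n₁) (d₂ : Z → Fin n₂),
      (n₁ : ℝ) * n₂ * (1 - (κ ^ s * E.expect (fun w u v _ _ => E.a w u v ^ s) +
        ((m₁ : ℝ) * j - 1) ^ s * E.expect (fun w u _ y _ => (E.b₁ w y / E.D₁ w u y) ^ s) +
        (((m₀ : ℝ) - 1) * (m₁ * j)) ^ s * E.expect (fun w u _ y _ => (E.c₁ y / E.D₁ w u y) ^ s) +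
        ((m₂ : ℝ) - 1) ^ s * E.expect (fun w _ v _ z => (E.b₂ w z / E.D₂ w v z) ^ s) +
        (((m₀ : ℝ) - 1) * m₂) ^ s * E.expect (fun w _ v _ z => (E.c₂ z / E.D₂ w v z) ^ s))) ≤
        ∑ m : Fin n₁ × Fin n₂, ∑ y, ∑ z,
          if d₁ y = m.1 ∧ d₂ z = m.2 then E.Q (enc m) y z else 0 := by
  classical
  have : Nonempty (Fin n₁) := ⟨⟨0, hn₁⟩⟩
  have : Nonempty (Fin n₂) := ⟨⟨0, hn₂⟩⟩
  have : Nonempty (Fin j) := ⟨⟨0, hj⟩⟩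
  have hm₂ : 0 < m₂ := hn₂.trans_le h₂
  obtain ⟨enc, d₁, d₂, h⟩ := exists_code_of_likelihood E.pw_nonneg E.pu_nonneg E.pv_nonneg E.sum_pw
    E.sum_pu E.sum_pv E.a E.a_nonneg E.sum_a E.px E.px_nonneg E.sum_px E.Q E.Q_nonneg E.D₁
    E.D₁_nonneg E.D₂ E.D₂_nonneg E.pos (J := Fin j)
    ((Fin.castLEEmb h₁).trans finProdFinEquiv.symm.toEmbedding) (Fin.castLEEmb h₂)
  refine ⟨enc, d₁, d₂, le_trans ?_ h⟩
  simp only [Fintype.card_fin, Fintype.card_prod, Nat.cast_mul]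
  refine mul_le_mul_of_nonneg_left ?_ (by positivity)
  nth_rewrite 1 [← hE]
  simp only [← expect_const_mul, ← expect_add, ← expect_sub]
  simp only [expect, tripleMean, Finset.mul_sum]
  refine Finset.sum_le_sum fun x _ => Finset.sum_le_sum fun y _ => Finset.sum_le_sum fun z _ =>
    Finset.sum_le_sum fun w _ => Finset.sum_le_sum fun u _ => Finset.sum_le_sum fun v _ => ?_
  by_cases hP : E.mass x y z w u v = 0
  · refine le_of_eq ?_
    rw [hP, zero_mul]
    simp only [mass, mul_eq_zero] at hP
    rcases hP with h | h | h | (h | h) | h <;> simp [h]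
  · have hP' := hP
    simp only [mass, mul_eq_zero, not_or] at hP'
    have hapos : 0 < E.a w u v := lt_of_le_of_ne (E.a_nonneg _ _ _) (Ne.symm hP'.2.2.2.2)
    obtain ⟨hD₁, hD₂⟩ := E.pos w u v x y z (mul_ne_zero hP'.2.2.2.1.1 hP'.2.2.2.1.2) hP'.2.2.2.2
    have c1 : (1 : ℝ) ≤ j := by exact_mod_cast hj
    have c0 : (1 : ℝ) ≤ m₀ := by exact_mod_cast hm₀
    have c2 : (1 : ℝ) ≤ m₂ := by exact_mod_cast hm₂
    have c3 : (1 : ℝ) ≤ m₁ := by exact_mod_cast hm₁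
    have key := mul_le_mul_of_nonneg_left (one_sub_le_likelihood_ratio hapos c1 hκ (haJ w u v) hD₁
      hD₂ (k₁ := (m₁ : ℝ) * j - 1) (k₂ := ((m₀ : ℝ) - 1) * (m₁ * j)) (k₃ := (m₂ : ℝ) - 1)
      (k₄ := ((m₀ : ℝ) - 1) * m₂) (by nlinarith) (mul_nonneg (by linarith) (by positivity))
      (by linarith) (mul_nonneg (by linarith) (by positivity)) (E.b₁_nonneg w y) (E.c₁_nonneg y)
      (E.b₂_nonneg w z) (E.c₂_nonneg z) hs0 hs1) (E.mass_nonneg x y z w u v)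
    refine key.trans (le_of_eq ?_)
    simp only [b₁, b₂, c₁, c₂, mass, Finset.mul_sum]
    ring

end Ensemble

end BC

namespace BC

/-! ### Independent copies and exponential decay. -/

open Filter Topology

namespace Ensemble

variable {W U V X Y Z : Type*} [Fintype W] [Fintype U] [Fintype V] [Fintype X] [Fintype Y]
  [Fintype Z] (E : Ensemble W U V X Y Z)

/-- The ensemble of `n` independent copies. -/
def pi (n : ℕ) : Ensemble (Fin n → W) (Fin n → U) (Fin n → V) (Fin n → X) (Fin n → Y)
    (Fin n → Z) where
  pw w := ∏ i, E.pw (w i)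
  pu w u := ∏ i, E.pu (w i) (u i)
  pv w v := ∏ i, E.pv (w i) (v i)
  px w u v x := ∏ i, E.px (w i) (u i) (v i) (x i)
  a w u v := ∏ i, E.a (w i) (u i) (v i)
  D₁ w u y := ∏ i, E.D₁ (w i) (u i) (y i)
  D₂ w v z := ∏ i, E.D₂ (w i) (v i) (z i)
  Q x y z := ∏ i, E.Q (x i) (y i) (z i)
  pw_nonneg _ := Finset.prod_nonneg fun _ _ => E.pw_nonneg _
  pu_nonneg _ _ := Finset.prod_nonneg fun _ _ => E.pu_nonneg _ _
  pv_nonneg _ _ := Finset.prod_nonneg fun _ _ => E.pv_nonneg _ _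
  px_nonneg _ _ _ _ := Finset.prod_nonneg fun _ _ => E.px_nonneg _ _ _ _
  a_nonneg _ _ _ := Finset.prod_nonneg fun _ _ => E.a_nonneg _ _ _
  D₁_nonneg _ _ _ := Finset.prod_nonneg fun _ _ => E.D₁_nonneg _ _ _
  D₂_nonneg _ _ _ := Finset.prod_nonneg fun _ _ => E.D₂_nonneg _ _ _
  Q_nonneg _ _ _ := Finset.prod_nonneg fun _ _ => E.Q_nonneg _ _ _
  sum_pw := by rw [sum_pi_prod (fun _ w => E.pw w)]; simp [E.sum_pw]
  sum_pu w := by rw [sum_pi_prod (fun i u => E.pu (w i) u)]; simp [E.sum_pu]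
  sum_pv w := by rw [sum_pi_prod (fun i v => E.pv (w i) v)]; simp [E.sum_pv]
  sum_px w u v := by
    rw [sum_pi_prod (fun i x => E.px (w i) (u i) (v i) x)]; simp [E.sum_px]
  sum_a w v := by
    simp only [← Finset.prod_mul_distrib]
    rw [sum_pi_prod (fun i u => E.pu (w i) u * E.a (w i) u (v i))]
    exact Finset.prod_le_one (fun i _ => Finset.sum_nonneg fun u _ =>
      mul_nonneg (E.pu_nonneg _ _) (E.a_nonneg _ _ _)) fun i _ => E.sum_a _ _
  pos w u v x y z h ha := by
    rw [← Finset.prod_mul_distrib, Finset.prod_ne_zero_iff] at h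
    rw [Finset.prod_ne_zero_iff] at ha
    exact ⟨Finset.prod_pos fun i hi => (E.pos _ _ _ _ _ _ (h i hi) (ha i hi)).1,
      Finset.prod_pos fun i hi => (E.pos _ _ _ _ _ _ (h i hi) (ha i hi)).2⟩

variable (n : ℕ)

theorem pi_b₁ (w : Fin n → W) (y : Fin n → Y) : (E.pi n).b₁ w y = ∏ i, E.b₁ (w i) (y i) := by
  simp only [b₁, pi, ← Finset.prod_mul_distrib]
  exact sum_pi_prod (fun i u => E.pu (w i) u * E.D₁ (w i) u (y i))

theorem pi_b₂ (w : Fin n → W) (z : Fin n → Z) : (E.pi n).b₂ w z = ∏ i, E.b₂ (w i) (z i) := by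
  simp only [b₂, pi, ← Finset.prod_mul_distrib]
  exact sum_pi_prod (fun i v => E.pv (w i) v * E.D₂ (w i) v (z i))

theorem pi_c₁ (y : Fin n → Y) : (E.pi n).c₁ y = ∏ i, E.c₁ (y i) := by
  simp only [c₁, pi_b₁]
  simp only [pi, ← Finset.prod_mul_distrib]
  exact sum_pi_prod (fun i w => E.pw w * E.b₁ w (y i))

theorem pi_c₂ (z : Fin n → Z) : (E.pi n).c₂ z = ∏ i, E.c₂ (z i) := by
  simp only [c₂, pi_b₂]
  simp only [pi, ← Finset.prod_mul_distrib]
  exact sum_pi_prod (fun i w => E.pw w * E.b₂ w (z i))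

theorem pi_mass (x y z w u v) :
    (E.pi n).mass x y z w u v = ∏ i, E.mass (x i) (y i) (z i) (w i) (u i) (v i) := by
  simp only [mass, pi, Finset.prod_mul_distrib]

/-- Sum and product are exchanged for one of the six variables at a time, from the innermost
outwards. -/
theorem expect_pi (g : W → U → V → Y → Z → ℝ) :
    (E.pi n).expect (fun w u v y z => ∏ i, g (w i) (u i) (v i) (y i) (z i)) = E.expect g ^ n := by
  have h1 : ∀ (x : Fin n → X) (y : Fin n → Y) (z : Fin n → Z) (w : Fin n → W) (u : Fin n → U),
      ∑ v : Fin n → V, ∏ i, E.mass (x i) (y i) (z i) (w i) (u i) (v i) *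
        g (w i) (u i) (v i) (y i) (z i) = _ := fun x y z w u => sum_pi_prod
    (fun i v => E.mass (x i) (y i) (z i) (w i) (u i) v * g (w i) (u i) v (y i) (z i))
  have h2 : ∀ (x : Fin n → X) (y : Fin n → Y) (z : Fin n → Z) (w : Fin n → W), _ = _ :=
    fun x y z w => sum_pi_prod (fun i u => ∑ v, E.mass (x i) (y i) (z i) (w i) u v *
      g (w i) u v (y i) (z i))
  have h3 : ∀ (x : Fin n → X) (y : Fin n → Y) (z : Fin n → Z), _ = _ := fun x y z =>
    sum_pi_prod (fun i w => ∑ u, ∑ v, E.mass (x i) (y i) (z i) w u v * g w u v (y i) (z i))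
  have h4 : ∀ (x : Fin n → X) (y : Fin n → Y), _ = _ := fun x y => sum_pi_prod (fun i z =>
    ∑ w, ∑ u, ∑ v, E.mass (x i) (y i) z w u v * g w u v (y i) z)
  have h5 : ∀ x : Fin n → X, _ = _ := fun x => sum_pi_prod (fun i y =>
    ∑ z, ∑ w, ∑ u, ∑ v, E.mass (x i) y z w u v * g w u v y z)
  have h6 := sum_pi_prod (fun (_ : Fin n) x =>
    ∑ y, ∑ z, ∑ w, ∑ u, ∑ v, E.mass x y z w u v * g w u v y z)
  simp only [expect, pi_mass, ← Finset.prod_mul_distrib]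
  simp only [h1, h2, h3, h4, h5, h6, Finset.prod_const, Finset.card_univ, Fintype.card_fin]

theorem expect_pi_rpow (g : W → U → V → Y → Z → ℝ) (hg : ∀ w u v y z, 0 ≤ g w u v y z) (s : ℝ) :
    (E.pi n).expect (fun w u v y z => (∏ i, g (w i) (u i) (v i) (y i) (z i)) ^ s) =
      E.expect (fun w u v y z => g w u v y z ^ s) ^ n := by
  rw [← expect_pi]
  congr 1
  funext w u v y z
  exact (Real.finsetProd_rpow _ _ (fun i _ => hg _ _ _ _ _) s).symm

end Ensemble

/-- The sequence `K` is identically zero, or grows with an exponential rate below `-L`. -/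
def IsBelowRate (K : ℕ → ℝ) (L : ℝ) : Prop :=
  (∀ n, K n = 0) ∨ ∃ C ρ : ℝ, 0 ≤ C ∧ ρ + L < 0 ∧ ∀ n : ℕ, 0 ≤ K n ∧ K n ≤ C * Real.exp (ρ * n)

/-- This replaces the law of large numbers: a negative derivative at 0 gives an exponential decay
rate for every small s > 0. -/
theorem eventually_lt_one_of_hasDerivAt {f : ℝ → ℝ} {d : ℝ} (hf : HasDerivAt f d 0) (h0 : f 0 = 1)
    (hd : d < 0) : ∀ᶠ s in 𝓝[>] (0 : ℝ), f s < 1 := by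
  have h := (hasDerivAt_iff_tendsto_slope.1 hf).mono_left
    (nhdsWithin_mono (0 : ℝ) (fun x (hx : 0 < x) => hx.ne'))
  filter_upwards [h.eventually (gt_mem_nhds hd), self_mem_nhdsWithin] with s hs hs0
  rw [slope_def_field, h0, sub_zero] at hs
  have := (div_lt_iff₀ (show (0 : ℝ) < s from hs0)).1 hs
  linarith

namespace Ensemble

variable {W U V X Y Z : Type*} [Fintype W] [Fintype U] [Fintype V] [Fintype X] [Fintype Y]
  [Fintype Z] (E : Ensemble W U V X Y Z)

theorem hasDerivAt_expect_rpow (g : W → U → V → Y → Z → ℝ)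
    (hpos : ∀ x y z w u v, E.mass x y z w u v ≠ 0 → 0 < g w u v y z) :
    HasDerivAt (fun s : ℝ => E.expect (fun w u v y z => g w u v y z ^ s))
      (E.expect (fun w u v y z => Real.log (g w u v y z))) 0 := by
  unfold expect
  refine HasDerivAt.fun_sum fun x _ => HasDerivAt.fun_sum fun y _ => HasDerivAt.fun_sum fun z _ =>
    HasDerivAt.fun_sum fun w _ => HasDerivAt.fun_sum fun u _ => HasDerivAt.fun_sum fun v _ => ?_
  by_cases h : E.mass x y z w u v = 0
  · simp only [h, zero_mul]; exact hasDerivAt_const _ _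
  · have h1 := (Real.hasStrictDerivAt_const_rpow (hpos x y z w u v h) 0).hasDerivAt
    simpa using h1.const_mul (E.mass x y z w u v)

theorem expect_nonneg {f : W → U → V → Y → Z → ℝ} (h : ∀ w u v y z, 0 ≤ f w u v y z) :
    0 ≤ E.expect f :=
  Finset.sum_nonneg fun _ _ => Finset.sum_nonneg fun _ _ => Finset.sum_nonneg fun _ _ =>
    Finset.sum_nonneg fun _ _ => Finset.sum_nonneg fun _ _ => Finset.sum_nonneg fun _ _ =>
      mul_nonneg (E.mass_nonneg _ _ _ _ _ _) (h _ _ _ _ _)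

/-- The sequence is at most C^s times the nth power of exp(ρs) E[g^s], which equals 1 at s = 0 and
has derivative ρ + E[log g] < 0 there. A sequence K that is identically zero needs no rate
condition. -/
theorem eventually_tendsto (hE : E.expect (fun _ _ _ _ _ => 1) = 1) (g : W → U → V → Y → Z → ℝ)
    (hg : ∀ w u v y z, 0 ≤ g w u v y z)
    (hpos : ∀ x y z w u v, E.mass x y z w u v ≠ 0 → 0 < g w u v y z) {K : ℕ → ℝ}
    (hK : IsBelowRate K (E.expect (fun w u v y z => Real.log (g w u v y z)))) :
    ∀ᶠ s in 𝓝[>] (0 : ℝ), Tendsto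
      (fun n => K n ^ s * E.expect (fun w u v y z => g w u v y z ^ s) ^ n) atTop (𝓝 0) := by
  rcases hK with hK | ⟨C, ρ, hC, hρ, hK⟩
  · filter_upwards [self_mem_nhdsWithin] with s hs
    simp [hK, Real.zero_rpow (ne_of_gt (show (0 : ℝ) < s from hs))]
  have hd : HasDerivAt (fun s : ℝ => Real.exp (ρ * s) * E.expect (fun w u v y z => g w u v y z ^ s))
      (ρ + E.expect (fun w u v y z => Real.log (g w u v y z))) 0 := by
    have h1 : HasDerivAt (fun s : ℝ => Real.exp (ρ * s)) ρ 0 := by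
      simpa using ((hasDerivAt_id (0 : ℝ)).const_mul ρ).exp
    simpa [hE] using h1.fun_mul (E.hasDerivAt_expect_rpow g hpos)
  filter_upwards [eventually_lt_one_of_hasDerivAt hd (by simp [hE]) hρ, self_mem_nhdsWithin]
    with s hs hs0
  have hs0 : 0 < s := hs0
  have hnn : 0 ≤ E.expect (fun w u v y z => g w u v y z ^ s) :=
    E.expect_nonneg fun w u v y z => Real.rpow_nonneg (hg _ _ _ _ _) s
  have hlim : Tendsto (fun n : ℕ => C ^ s *
      (Real.exp (ρ * s) * E.expect (fun w u v y z => g w u v y z ^ s)) ^ n) atTop (𝓝 0) := by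
    simpa using (tendsto_pow_atTop_nhds_zero_of_lt_one (by positivity) hs).const_mul (C ^ s)
  refine squeeze_zero (fun n => mul_nonneg (Real.rpow_nonneg (hK n).1 s) (pow_nonneg hnn n))
    (fun n => ?_) hlim
  rw [mul_pow, ← mul_assoc]
  refine mul_le_mul_of_nonneg_right ?_ (pow_nonneg hnn n)
  refine (Real.rpow_le_rpow (hK n).1 (hK n).2 hs0.le).trans (le_of_eq ?_)
  rw [Real.mul_rpow hC (Real.exp_pos _).le, ← Real.exp_mul, ← Real.exp_nat_mul]
  congr 2; ring

end Ensemble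

end BC

namespace BC

/-! ### From success probabilities to codes with vanishing error. -/

open Filter Topology

theorem IsBelowRate.nonneg {K : ℕ → ℝ} {L : ℝ} (h : IsBelowRate K L) (n : ℕ) : 0 ≤ K n := by
  rcases h with h | ⟨_, _, _, _, h⟩
  · exact (h n).ge
  · exact (h n).1

/-- Either receiver's error event is disjoint from joint success, and the total mass over all
messages is n₁ n₂. -/
theorem Code.err_le_of_success {X Y Z : Type*} [Fintype Y] [Fintype Z] (q : Channel X Y Z)
    {n n₁ n₂ : ℕ} (hn₁ : 0 < n₁) (hn₂ : 0 < n₂) (c : Code X Y Z n n₁ n₂) {r : ℝ}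
    (h : (n₁ : ℝ) * n₂ * (1 - r) ≤ ∑ m : Fin n₁ × Fin n₂, ∑ y, ∑ z,
      if c.dec₁ y = m.1 ∧ c.dec₂ z = m.2 then ∏ i, q.prob (c.enc m i) (y i) (z i) else 0) :
    c.err₁ q ≤ r ∧ c.err₂ q ≤ r := by
  have hpos : (0 : ℝ) < (n₁ : ℝ) * n₂ := by positivity
  have htot : ∑ m : Fin n₁ × Fin n₂, ∑ y : Fin n → Y, ∑ z : Fin n → Z,
      ∏ i, q.prob (c.enc m i) (y i) (z i) = (n₁ : ℝ) * n₂ := by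
    have h1 : ∀ (m : Fin n₁ × Fin n₂) (y : Fin n → Y), ∑ z : Fin n → Z,
        ∏ i, q.prob (c.enc m i) (y i) (z i) = ∏ i, ∑ z, q.prob (c.enc m i) (y i) z := fun m y =>
      sum_pi_prod (fun i z => q.prob (c.enc m i) (y i) z)
    have h2 : ∀ m : Fin n₁ × Fin n₂, ∑ y : Fin n → Y, ∏ i, ∑ z, q.prob (c.enc m i) (y i) z =
        ∏ i, ∑ y, ∑ z, q.prob (c.enc m i) y z := fun m =>
      sum_pi_prod (fun i y => ∑ z, q.prob (c.enc m i) y z)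
    simp [h1, h2, q.sum_prob]
  have key : ∀ S : Fin n₁ × Fin n₂ → (Fin n → Y) → (Fin n → Z) → Prop,
      [∀ m y z, Decidable (S m y z)] →
      (∀ m y z, c.dec₁ y = m.1 ∧ c.dec₂ z = m.2 → S m y z) →
      (∑ m : Fin n₁ × Fin n₂, ∑ y : Fin n → Y, ∑ z : Fin n → Z,
        if S m y z then 0 else ∏ i, q.prob (c.enc m i) (y i) (z i)) / ((n₁ : ℝ) * n₂) ≤ r := by
    intro S _ hS
    rw [div_le_iff₀ hpos]
    have : (∑ m : Fin n₁ × Fin n₂, ∑ y : Fin n → Y, ∑ z : Fin n → Z,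
        if S m y z then 0 else ∏ i, q.prob (c.enc m i) (y i) (z i)) +
        (∑ m : Fin n₁ × Fin n₂, ∑ y, ∑ z, if c.dec₁ y = m.1 ∧ c.dec₂ z = m.2 then
          ∏ i, q.prob (c.enc m i) (y i) (z i) else 0) ≤ (n₁ : ℝ) * n₂ := by
      rw [← htot]
      simp only [← Finset.sum_add_distrib]
      refine Finset.sum_le_sum fun m _ => Finset.sum_le_sum fun y _ => Finset.sum_le_sum fun z _ => ?_
      have h0 : 0 ≤ ∏ i, q.prob (c.enc m i) (y i) (z i) :=
        Finset.prod_nonneg fun _ _ => q.prob_nonneg _ _ _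
      by_cases h1 : c.dec₁ y = m.1 ∧ c.dec₂ z = m.2
      · rw [if_pos h1, if_pos (hS _ _ _ h1), zero_add]
      · rw [if_neg h1, add_zero]
        split_ifs
        · exact h0
        · exact le_rfl
    linarith
  exact ⟨key (fun m y _ => c.dec₁ y = m.1) fun m y z h => h.1,
    key (fun m _ z => c.dec₂ z = m.2) fun m y z h => h.2⟩

namespace Ensemble

variable {W U V X Y Z : Type*} [Fintype W] [Fintype U] [Fintype V] [Fintype X] [Fintype Y]
  [Fintype Z] (E : Ensemble W U V X Y Z)

theorem pos_of_mass {x y z w u v} (h : E.mass x y z w u v ≠ 0) :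
    0 < E.a w u v ∧ 0 < E.b₁ w y / E.D₁ w u y ∧ 0 < E.c₁ y / E.D₁ w u y ∧
      0 < E.b₂ w z / E.D₂ w v z ∧ 0 < E.c₂ z / E.D₂ w v z := by
  simp only [mass, ne_eq, mul_eq_zero, not_or] at h
  obtain ⟨hw, hu, hv, ⟨hx, hQ⟩, ha⟩ := h
  obtain ⟨hD₁, hD₂⟩ := E.pos w u v x y z (mul_ne_zero hx hQ) ha
  have hw' := lt_of_le_of_ne (E.pw_nonneg w) (Ne.symm hw)
  have hb₁ : 0 < E.b₁ w y :=
    (mul_pos (lt_of_le_of_ne (E.pu_nonneg w u) (Ne.symm hu)) hD₁).trans_le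
      (Finset.single_le_sum (f := fun u => E.pu w u * E.D₁ w u y)
        (fun _ _ => mul_nonneg (E.pu_nonneg _ _) (E.D₁_nonneg _ _ _)) (Finset.mem_univ u))
  have hb₂ : 0 < E.b₂ w z :=
    (mul_pos (lt_of_le_of_ne (E.pv_nonneg w v) (Ne.symm hv)) hD₂).trans_le
      (Finset.single_le_sum (f := fun v => E.pv w v * E.D₂ w v z)
        (fun _ _ => mul_nonneg (E.pv_nonneg _ _) (E.D₂_nonneg _ _ _)) (Finset.mem_univ v))
  have hc₁ : 0 < E.c₁ y := (mul_pos hw' hb₁).trans_le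
    (Finset.single_le_sum (f := fun w => E.pw w * E.b₁ w y)
      (fun _ _ => mul_nonneg (E.pw_nonneg _) (E.b₁_nonneg _ _)) (Finset.mem_univ w))
  have hc₂ : 0 < E.c₂ z := (mul_pos hw' hb₂).trans_le
    (Finset.single_le_sum (f := fun w => E.pw w * E.b₂ w z)
      (fun _ _ => mul_nonneg (E.pw_nonneg _) (E.b₂_nonneg _ _)) (Finset.mem_univ w))
  exact ⟨lt_of_le_of_ne (E.a_nonneg _ _ _) (Ne.symm ha), div_pos hb₁ hD₁, div_pos hc₁ hD₁,
    div_pos hb₂ hD₂, div_pos hc₂ hD₂⟩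

theorem exists_codes [Nonempty W] [Nonempty U] [Nonempty V] [Nonempty X] (q : Channel X Y Z)
    (hQ : E.Q = q.prob) (hE : E.expect (fun _ _ _ _ _ => 1) = 1) {n₁ n₂ m₀ m₁ j m₂ : ℕ → ℕ}
    {κ : ℕ → ℝ} (hn₁ : ∀ n, 0 < n₁ n) (hn₂ : ∀ n, 0 < n₂ n) (hm₀ : ∀ n, 0 < m₀ n)
    (hm₁ : ∀ n, 0 < m₁ n) (hj : ∀ n, 0 < j n) (h₁ : ∀ n, n₁ n ≤ m₀ n * m₁ n)
    (h₂ : ∀ n, n₂ n ≤ m₂ n)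
    (haJ : ∀ n w u v, (E.pi n).a w u v + ((j n : ℝ) - 1) ≤ j n * (1 + κ n * (E.pi n).a w u v))
    (ra : IsBelowRate κ (E.expect fun w u v _ _ => Real.log (E.a w u v)))
    (rb₁ : IsBelowRate (fun n => (m₁ n : ℝ) * j n - 1)
      (E.expect fun w u _ y _ => Real.log (E.b₁ w y / E.D₁ w u y)))
    (rc₁ : IsBelowRate (fun n => ((m₀ n : ℝ) - 1) * (m₁ n * j n))
      (E.expect fun w u _ y _ => Real.log (E.c₁ y / E.D₁ w u y)))
    (rb₂ : IsBelowRate (fun n => (m₂ n : ℝ) - 1)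
      (E.expect fun w _ v _ z => Real.log (E.b₂ w z / E.D₂ w v z)))
    (rc₂ : IsBelowRate (fun n => ((m₀ n : ℝ) - 1) * m₂ n)
      (E.expect fun w _ v _ z => Real.log (E.c₂ z / E.D₂ w v z))) :
    ∃ c : ∀ n, Code X Y Z n (n₁ n) (n₂ n), Tendsto (fun n => (c n).err₁ q) atTop (𝓝 0) ∧
      Tendsto (fun n => (c n).err₂ q) atTop (𝓝 0) := by
  have ga : ∀ (w : W) (u : U) (v : V) (_ : Y) (_ : Z), 0 ≤ E.a w u v := fun w u v _ _ =>
    E.a_nonneg w u v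
  have gb₁ : ∀ (w : W) (u : U) (_ : V) (y : Y) (_ : Z), 0 ≤ E.b₁ w y / E.D₁ w u y :=
    fun w u _ y _ => div_nonneg (E.b₁_nonneg _ _) (E.D₁_nonneg _ _ _)
  have gc₁ : ∀ (w : W) (u : U) (_ : V) (y : Y) (_ : Z), 0 ≤ E.c₁ y / E.D₁ w u y :=
    fun w u _ y _ => div_nonneg (E.c₁_nonneg _) (E.D₁_nonneg _ _ _)
  have gb₂ : ∀ (w : W) (_ : U) (v : V) (_ : Y) (z : Z), 0 ≤ E.b₂ w z / E.D₂ w v z :=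
    fun w _ v _ z => div_nonneg (E.b₂_nonneg _ _) (E.D₂_nonneg _ _ _)
  have gc₂ : ∀ (w : W) (_ : U) (v : V) (_ : Y) (z : Z), 0 ≤ E.c₂ z / E.D₂ w v z :=
    fun w _ v _ z => div_nonneg (E.c₂_nonneg _) (E.D₂_nonneg _ _ _)
  have ta := E.eventually_tendsto hE _ ga (fun x y z w u v h => (E.pos_of_mass h).1) ra
  have tb₁ := E.eventually_tendsto hE _ gb₁ (fun x y z w u v h => (E.pos_of_mass h).2.1) rb₁
  have tc₁ := E.eventually_tendsto hE _ gc₁ (fun x y z w u v h => (E.pos_of_mass h).2.2.1) rc₁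
  have tb₂ := E.eventually_tendsto hE _ gb₂ (fun x y z w u v h => (E.pos_of_mass h).2.2.2.1) rb₂
  have tc₂ := E.eventually_tendsto hE _ gc₂ (fun x y z w u v h => (E.pos_of_mass h).2.2.2.2) rc₂
  have ts : ∀ᶠ s in 𝓝[>] (0 : ℝ), s ∈ Set.Ioc (0 : ℝ) 1 := Ioc_mem_nhdsGT one_pos
  -- All five limits hold for every sufficiently small s > 0, so one exponent works for all of them.
  obtain ⟨s, la, lb₁, lc₁, lb₂, lc₂, hs0, hs1⟩ :=
    (ta.and (tb₁.and (tc₁.and (tb₂.and (tc₂.and ts))))).exists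
  have hone : ∀ n, (E.pi n).expect (fun _ _ _ _ _ => 1) = 1 := fun n => by
    have := E.expect_pi n (fun _ _ _ _ _ => 1)
    simpa [hE] using this
  choose enc d₁ d₂ hc using fun n => (E.pi n).exists_code (hone n) (hn₁ n) (hn₂ n) (hm₀ n) (hm₁ n)
    (hj n) (h₁ n) (h₂ n) (ra.nonneg n) (haJ n) hs0 hs1
  let c : ∀ n, Code X Y Z n (n₁ n) (n₂ n) := fun n => ⟨enc n, d₁ n, d₂ n⟩
  have hlim := (((la.add lb₁).add lc₁).add lb₂).add lc₂
  simp only [add_zero] at hlim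
  have herr : ∀ n, (c n).err₁ q ≤ _ ∧ (c n).err₂ q ≤ _ := fun n =>
    Code.err_le_of_success q (hn₁ n) (hn₂ n) (c n) (by
      have h := hc n
      simp only [pi_b₁, pi_b₂, pi_c₁, pi_c₂] at h
      simp only [pi, hQ] at h
      simp only [← Finset.prod_div_distrib] at h
      have e1 := E.expect_pi_rpow n _ ga s
      have e2 := E.expect_pi_rpow n _ gb₁ s
      have e3 := E.expect_pi_rpow n _ gc₁ s
      have e4 := E.expect_pi_rpow n _ gb₂ s
      have e5 := E.expect_pi_rpow n _ gc₂ s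
      simp only [pi, hQ] at e1 e2 e3 e4 e5
      rw [e1, e2, e3, e4, e5] at h
      exact h)
  have herr0 : ∀ n, 0 ≤ (c n).err₁ q ∧ 0 ≤ (c n).err₂ q := fun n => by
    constructor <;>
    exact div_nonneg (Finset.sum_nonneg fun _ _ => Finset.sum_nonneg fun _ _ =>
      Finset.sum_nonneg fun _ _ => by
        split_ifs
        · exact le_rfl
        · exact Finset.prod_nonneg fun _ _ => q.prob_nonneg _ _ _) (by positivity)
  exact ⟨c, squeeze_zero (fun n => (herr0 n).1) (fun n => (herr n).1) hlim,
    squeeze_zero (fun n => (herr0 n).2) (fun n => (herr n).2) hlim⟩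

end Ensemble

end BC

namespace BC

/-! ### Conditional laws and information densities. -/

section CondLaw

variable {Ω A B C : Type*} [Fintype Ω] [Fintype A] [Fintype B] [Fintype C]

open Classical in
/-- The probability vector proportional to `s`, or the uniform one if `s` sums to zero. -/
noncomputable def normalize (s : A → ℝ) (a : A) : ℝ :=
  if ∑ b, s b = 0 then ((Fintype.card A : ℝ))⁻¹ else s a / ∑ b, s b

theorem normalize_nonneg {s : A → ℝ} (hs : ∀ a, 0 ≤ s a) (a : A) : 0 ≤ normalize s a := by
  unfold normalize
  split_ifs
  · positivity
  · exact div_nonneg (hs a) (Finset.sum_nonneg fun b _ => hs b)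

theorem sum_normalize [Nonempty A] (s : A → ℝ) : ∑ a, normalize s a = 1 := by
  unfold normalize
  split_ifs with h
  · simp
  · rw [← Finset.sum_div, div_self h]

theorem normalize_of_ne {s : A → ℝ} {t : ℝ} (hs : ∑ b, s b = t) (ht : t ≠ 0) (a : A) :
    normalize s a = s a / t := by
  rw [normalize, hs, if_neg ht]

theorem law_swap (P : Ω → ℝ) (f : Ω → A) (g : Ω → B) (a : A) (b : B) :
    law P (fun ω => (f ω, g ω)) (a, b) = law P (fun ω => (g ω, f ω)) (b, a) := by
  classical
  simp only [law, Prod.mk.injEq]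
  exact Finset.sum_congr rfl fun ω _ => by
    by_cases h1 : f ω = a <;> by_cases h2 : g ω = b <;> simp [h1, h2]

theorem law_pair_le {P : Ω → ℝ} (hP : ∀ ω, 0 ≤ P ω) (f : Ω → A) (g : Ω → B) (a : A) (b : B) :
    law P (fun ω => (f ω, g ω)) (a, b) ≤ law P g b := by
  rw [← law_prod_sum P f g b]
  exact Finset.single_le_sum (f := fun a => law P (fun ω => (f ω, g ω)) (a, b))
    (fun a _ => law_nonneg hP _ _) (Finset.mem_univ a)

theorem law_triple_le {P : Ω → ℝ} (hP : ∀ ω, 0 ≤ P ω) (f : Ω → A) (g : Ω → B) (h : Ω → C) (a : A)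
    (b : B) (c : C) :
    law P (fun ω => (f ω, g ω, h ω)) (a, b, c) ≤ law P (fun ω => (f ω, h ω)) (a, c) := by
  classical
  refine Finset.sum_le_sum fun ω _ => ?_
  have := hP ω
  by_cases h1 : f ω = a <;> by_cases h2 : g ω = b <;> by_cases h3 : h ω = c <;> simp [h1, h2, h3, this]

/-- Averaging `P(g|f,h)` over `f` given `h` yields `P(g|h)`. -/
theorem sum_normalize_mul {P : Ω → ℝ} (hP : ∀ ω, 0 ≤ P ω) (f : Ω → A) (g : Ω → B) (h : Ω → C)
    (b : B) (c : C) (hc : law P h c ≠ 0) :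
    ∑ a, normalize (fun a => law P (fun ω => (f ω, h ω)) (a, c)) a *
      (law P (fun ω => (f ω, g ω, h ω)) (a, b, c) / law P (fun ω => (f ω, h ω)) (a, c)) =
      law P (fun ω => (g ω, h ω)) (b, c) / law P h c := by
  rw [← law_prod_sum P f (fun ω => (g ω, h ω)) (b, c), Finset.sum_div]
  refine Finset.sum_congr rfl fun a _ => ?_
  rw [normalize_of_ne (law_prod_sum P f h c) hc]
  by_cases h0 : law P (fun ω => (f ω, h ω)) (a, c) = 0
  · have h1 : law P (fun ω => (f ω, g ω, h ω)) (a, b, c) = 0 :=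
      le_antisymm (h0 ▸ law_triple_le hP f g h a b c) (law_nonneg hP _ _)
    rw [h0, h1]; simp
  · field_simp

/-- The law of total probability; F is prescribed only where h has positive mass, since conditional
laws are arbitrary elsewhere. -/
theorem sum_law_mul_cond {P : Ω → ℝ} (hP : ∀ ω, 0 ≤ P ω) (g : Ω → B) (h : Ω → C) (b : B)
    (F : C → ℝ) (hF : ∀ c, law P h c ≠ 0 → F c = law P (fun ω => (g ω, h ω)) (b, c) / law P h c) :
    ∑ c, law P h c * F c = law P g b := by
  rw [← law_prod_sum P h g b]
  refine Finset.sum_congr rfl fun c _ => ?_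
  rw [law_swap]
  by_cases h0 : law P h c = 0
  · rw [h0, zero_mul]
    exact (le_antisymm (h0 ▸ law_pair_le hP g h b c) (law_nonneg hP _ _)).symm
  · rw [hF c h0, mul_div_cancel₀ _ h0]

theorem sum_mul_log_law (P : Ω → ℝ) (f : Ω → A) :
    ∑ ω, P ω * Real.log (law P f (f ω)) = -(Real.log 2 * entropy P f) := by
  rw [entropy_eq]
  have := log_two_pos.ne'
  field_simp

theorem condMutualInfo_nonneg {P : Ω → ℝ} (hP : ∀ ω, 0 ≤ P ω) (f : Ω → A) (g : Ω → B)
    (h : Ω → C) : 0 ≤ condMutualInfo P f g h :=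
  sub_nonneg.2 (condEntropy_le_condEntropy hP f g h)

/-- Mean information density in natural logarithms; the factor log 2 converts from bits. -/
theorem sum_mul_log_density {P : Ω → ℝ} (hP : ∀ ω, 0 ≤ P ω) (f : Ω → A) (g : Ω → B) (h : Ω → C) :
    ∑ ω, P ω * Real.log (law P (fun ω => (f ω, g ω, h ω)) (f ω, g ω, h ω) * law P h (h ω) /
      (law P (fun ω => (f ω, h ω)) (f ω, h ω) * law P (fun ω => (g ω, h ω)) (g ω, h ω))) =
      Real.log 2 * condMutualInfo P f g h := by
  have e : ∀ ω, P ω * Real.log (law P (fun ω => (f ω, g ω, h ω)) (f ω, g ω, h ω) *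
      law P h (h ω) / (law P (fun ω => (f ω, h ω)) (f ω, h ω) *
        law P (fun ω => (g ω, h ω)) (g ω, h ω))) =
      P ω * Real.log (law P (fun ω => (f ω, g ω, h ω)) (f ω, g ω, h ω)) +
      P ω * Real.log (law P h (h ω)) -
      P ω * Real.log (law P (fun ω => (f ω, h ω)) (f ω, h ω)) -
      P ω * Real.log (law P (fun ω => (g ω, h ω)) (g ω, h ω)) := fun ω => by
    rcases (hP ω).eq_or_lt with h0 | h0
    · simp [← h0]
    · have h1 := (h0.trans_le (le_law hP (fun ω => (f ω, g ω, h ω)) ω)).ne'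
      have h2 := (h0.trans_le (le_law hP h ω)).ne'
      have h3 := (h0.trans_le (le_law hP (fun ω => (f ω, h ω)) ω)).ne'
      have h4 := (h0.trans_le (le_law hP (fun ω => (g ω, h ω)) ω)).ne'
      rw [Real.log_div (mul_ne_zero h1 h2) (mul_ne_zero h3 h4), Real.log_mul h1 h2,
        Real.log_mul h3 h4]
      ring
  simp only [e, Finset.sum_sub_distrib, Finset.sum_add_distrib]
  rw [sum_mul_log_law P (fun ω => (f ω, g ω, h ω)), sum_mul_log_law P h,
    sum_mul_log_law P (fun ω => (f ω, h ω)), sum_mul_log_law P (fun ω => (g ω, h ω)),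
    condMutualInfo, condEntropy, condEntropy]
  ring

theorem sum_mul_log_density_right {P : Ω → ℝ} (hP : ∀ ω, 0 ≤ P ω) (f : Ω → A) (g : Ω → B)
    (h : Ω → C) :
    ∑ ω, P ω * Real.log (law P g (g ω) / (law P (fun ω => (f ω, g ω, h ω)) (f ω, g ω, h ω) /
      law P (fun ω => (f ω, h ω)) (f ω, h ω))) =
      -(Real.log 2 * (mutualInfo P h g + condMutualInfo P f g h)) := by
  have e : ∀ ω, P ω * Real.log (law P g (g ω) /
      (law P (fun ω => (f ω, g ω, h ω)) (f ω, g ω, h ω) /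
        law P (fun ω => (f ω, h ω)) (f ω, h ω))) =
      P ω * Real.log (law P g (g ω)) -
      P ω * Real.log (law P (fun ω => (f ω, g ω, h ω)) (f ω, g ω, h ω)) +
      P ω * Real.log (law P (fun ω => (f ω, h ω)) (f ω, h ω)) := fun ω => by
    rcases (hP ω).eq_or_lt with h0 | h0
    · simp [← h0]
    · have h1 := (h0.trans_le (le_law hP (fun ω => (f ω, g ω, h ω)) ω)).ne'
      have h2 := (h0.trans_le (le_law hP g ω)).ne'
      have h3 := (h0.trans_le (le_law hP (fun ω => (f ω, h ω)) ω)).ne'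
      rw [Real.log_div h2 (div_ne_zero h1 h3), Real.log_div h1 h3]
      ring
  simp only [e, Finset.sum_sub_distrib, Finset.sum_add_distrib]
  have hswap : entropy P (fun ω => (h ω, g ω)) = entropy P (fun ω => (g ω, h ω)) :=
    entropy_congr fun ω ω' => by simp only [Prod.mk.injEq]; tauto
  rw [sum_mul_log_law P (fun ω => (f ω, g ω, h ω)), sum_mul_log_law P g,
    sum_mul_log_law P (fun ω => (f ω, h ω)), condMutualInfo, mutualInfo, condEntropy, condEntropy,
    condEntropy, hswap]
  ring

end CondLaw

end BC

namespace BC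

/-! ### The ensemble attached to p(u,v,w,x). -/

section InputEnsemble

variable {U V W X Y Z : Type*} [Fintype U] [Fintype V] [Fintype W] [Fintype X] [Fintype Y]
  [Fintype Z] [Nonempty U] [Nonempty V] [Nonempty X]

theorem law_fst {A B : Type*} [Fintype A] [Fintype B] (p : A × B → ℝ) (a : A) :
    law p Prod.fst a = ∑ b, p (a, b) := by
  classical
  rw [law, Fintype.sum_prod_type, Fintype.sum_eq_single a (fun a' ha' => by simp [ha'])]
  simp

theorem sum_input_eq_law (q : Channel X Y Z) (p : (U × V × W) × X → ℝ) (u : U) (v : V) (w : W) :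
    ∑ x, p ((u, v, w), x) =
      law (joint q p) (fun ω => (ω.1.1.1, ω.1.1.2.1, ω.1.1.2.2)) (u, v, w) :=
  (law_fst p (u, v, w)).symm.trans (law_joint_input q p Prod.fst (u, v, w)).symm

/-- The ensemble of superposition codes with Marton's binning, for the joint mass function `p` of
the auxiliary variables and the input. -/
noncomputable def inputEnsemble (q : Channel X Y Z) (p : (U × V × W) × X → ℝ)
    (hp : p ∈ stdSimplex ℝ ((U × V × W) × X)) : Ensemble W U V X Y Z where
  pw := law (joint q p) (fun ω => ω.1.1.2.2)
  pu w := normalize fun u => law (joint q p) (fun ω => (ω.1.1.1, ω.1.1.2.2)) (u, w)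
  pv w := normalize fun v => law (joint q p) (fun ω => (ω.1.1.2.1, ω.1.1.2.2)) (v, w)
  px w u v := normalize fun x => p ((u, v, w), x)
  -- This is p(u,v|w)/(p(u|w)p(v|w)), the density that converts satellites independent given w to
  -- the target law; D₁ and D₂ below are p(y|u,w) and p(z|v,w).
  a w u v := law (joint q p) (fun ω => (ω.1.1.1, ω.1.1.2.1, ω.1.1.2.2)) (u, v, w) *
    law (joint q p) (fun ω => ω.1.1.2.2) w /
    (law (joint q p) (fun ω => (ω.1.1.1, ω.1.1.2.2)) (u, w) *
      law (joint q p) (fun ω => (ω.1.1.2.1, ω.1.1.2.2)) (v, w))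
  D₁ w u y := law (joint q p) (fun ω => (ω.1.1.1, ω.2.1, ω.1.1.2.2)) (u, y, w) /
    law (joint q p) (fun ω => (ω.1.1.1, ω.1.1.2.2)) (u, w)
  D₂ w v z := law (joint q p) (fun ω => (ω.1.1.2.1, ω.2.2, ω.1.1.2.2)) (v, z, w) /
    law (joint q p) (fun ω => (ω.1.1.2.1, ω.1.1.2.2)) (v, w)
  Q := q.prob
  pw_nonneg _ := law_nonneg (joint_nonneg q hp.1) _ _
  pu_nonneg _ _ := normalize_nonneg (fun _ => law_nonneg (joint_nonneg q hp.1) _ _) _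
  pv_nonneg _ _ := normalize_nonneg (fun _ => law_nonneg (joint_nonneg q hp.1) _ _) _
  px_nonneg _ _ _ _ := normalize_nonneg (fun _ => hp.1 _) _
  a_nonneg _ _ _ := div_nonneg (mul_nonneg (law_nonneg (joint_nonneg q hp.1) _ _)
    (law_nonneg (joint_nonneg q hp.1) _ _)) (mul_nonneg (law_nonneg (joint_nonneg q hp.1) _ _)
    (law_nonneg (joint_nonneg q hp.1) _ _))
  D₁_nonneg _ _ _ := div_nonneg (law_nonneg (joint_nonneg q hp.1) _ _)
    (law_nonneg (joint_nonneg q hp.1) _ _)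
  D₂_nonneg _ _ _ := div_nonneg (law_nonneg (joint_nonneg q hp.1) _ _)
    (law_nonneg (joint_nonneg q hp.1) _ _)
  Q_nonneg := q.prob_nonneg
  sum_pw := by rw [sum_law, (joint_mem_stdSimplex q hp).2]
  sum_pu _ := sum_normalize _
  sum_pv _ := sum_normalize _
  sum_px _ _ _ := sum_normalize _
  sum_a w v := by
    have hR := joint_nonneg q hp.1
    by_cases hw : law (joint q p) (fun ω => ω.1.1.2.2) w = 0
    · simp [hw]
    calc _ ≤ ∑ u, law (joint q p) (fun ω => (ω.1.1.1, ω.1.1.2.1, ω.1.1.2.2)) (u, v, w) /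
          law (joint q p) (fun ω => (ω.1.1.2.1, ω.1.1.2.2)) (v, w) := by
          refine Finset.sum_le_sum fun u _ => ?_
          rw [normalize_of_ne (law_prod_sum (joint q p) (fun ω => ω.1.1.1)
            (fun ω => ω.1.1.2.2) w) hw]
          by_cases h0 : law (joint q p) (fun ω => (ω.1.1.1, ω.1.1.2.2)) (u, w) = 0
          · rw [h0, zero_div, zero_mul]
            exact div_nonneg (law_nonneg hR _ _) (law_nonneg hR _ _)
          · refine le_of_eq ?_
            field_simp
      _ ≤ 1 := by
          rw [← Finset.sum_div, law_prod_sum (joint q p) (fun ω => ω.1.1.1)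
            (fun ω => (ω.1.1.2.1, ω.1.1.2.2)) (v, w)]
          exact div_self_le_one _
  pos w u v x y z h ha := by
    have hR := joint_nonneg q hp.1
    have h0 : joint q p (((u, v, w), x), (y, z)) ≠ 0 := fun h1 => h (by
      rcases mul_eq_zero.1 h1 with h2 | h2
      · have h3 : p ((u, v, w), x) = 0 := h2
        have h4 : ∑ x, p ((u, v, w), x) ≠ 0 := fun h4 => ha (by
          rw [← sum_input_eq_law, h4, zero_mul, zero_div])
        rw [normalize_of_ne rfl h4, h3, zero_div, zero_mul]
      · have h3 : q.prob x y z = 0 := h2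
        rw [h3, mul_zero])
    have hpos := lt_of_le_of_ne (hR _) (Ne.symm h0)
    exact ⟨div_pos (hpos.trans_le (le_law hR (fun ω => (ω.1.1.1, ω.2.1, ω.1.1.2.2)) _))
      (hpos.trans_le (le_law hR (fun ω => (ω.1.1.1, ω.1.1.2.2)) _)),
      div_pos (hpos.trans_le (le_law hR (fun ω => (ω.1.1.2.1, ω.2.2, ω.1.1.2.2)) _))
      (hpos.trans_le (le_law hR (fun ω => (ω.1.1.2.1, ω.1.1.2.2)) _))⟩

variable (q : Channel X Y Z) (p : (U × V × W) × X → ℝ) (hp : p ∈ stdSimplex ℝ ((U × V × W) × X))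

/-- The density `a` undoes the conditional independence of the satellites, so the product telescopes
to the true joint law. Expectations under the ensemble are therefore expectations under p and the
channel. -/
theorem inputEnsemble_mass (x : X) (y : Y) (z : Z) (w : W) (u : U) (v : V) :
    (inputEnsemble q p hp).mass x y z w u v = joint q p (((u, v, w), x), (y, z)) := by
  have hR := joint_nonneg q hp.1
  have hx := sum_input_eq_law q p u v w
  simp only [Ensemble.mass, inputEnsemble]
  by_cases h0 : law (joint q p) (fun ω => (ω.1.1.1, ω.1.1.2.1, ω.1.1.2.2)) (u, v, w) = 0
  · have h1 : joint q p (((u, v, w), x), (y, z)) = 0 :=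
      le_antisymm ((le_law hR (fun ω => (ω.1.1.1, ω.1.1.2.1, ω.1.1.2.2)) _).trans h0.le) (hR _)
    rw [h0, h1]
    simp
  have hpos := lt_of_le_of_ne (law_nonneg hR _ _) (Ne.symm h0)
  have huw := (hpos.trans_le (law_triple_le hR (fun ω => ω.1.1.1) (fun ω => ω.1.1.2.1)
    (fun ω => ω.1.1.2.2) u v w)).ne'
  have hvw := hpos.trans_le (law_pair_le hR (fun ω => ω.1.1.1)
    (fun ω => (ω.1.1.2.1, ω.1.1.2.2)) u (v, w))
  have hw := (hvw.trans_le (law_pair_le hR (fun ω => ω.1.1.2.1) (fun ω => ω.1.1.2.2) v w)).ne'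
  rw [normalize_of_ne hx h0, normalize_of_ne (law_prod_sum (joint q p) (fun ω => ω.1.1.1)
    (fun ω => ω.1.1.2.2) w) hw, normalize_of_ne (law_prod_sum (joint q p) (fun ω => ω.1.1.2.1)
    (fun ω => ω.1.1.2.2) w) hw]
  have hvw := hvw.ne'
  simp only [joint]
  field_simp

theorem inputEnsemble_expect (g : W → U → V → Y → Z → ℝ) :
    (inputEnsemble q p hp).expect g =
      ∑ ω, joint q p ω * g ω.1.1.2.2 ω.1.1.1 ω.1.1.2.1 ω.2.1 ω.2.2 := by
  simp only [Ensemble.expect, inputEnsemble_mass]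
  simp only [← Fintype.sum_prod_type']
  exact Fintype.sum_equiv ⟨fun t => (((t.2.2.2.2.1, t.2.2.2.2.2, t.2.2.2.1), t.1), t.2.1, t.2.2.1),
    fun ω => (ω.1.2, ω.2.1, ω.2.2, ω.1.1.2.2, ω.1.1.1, ω.1.1.2.1), fun _ => rfl, fun _ => rfl⟩ _ _
    fun _ => rfl

theorem inputEnsemble_expect_one : (inputEnsemble q p hp).expect (fun _ _ _ _ _ => 1) = 1 := by
  simp only [inputEnsemble_expect, mul_one]
  exact (joint_mem_stdSimplex q hp).2

theorem inputEnsemble_b₁ (w : W) (y : Y) (hw : law (joint q p) (fun ω => ω.1.1.2.2) w ≠ 0) :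
    (inputEnsemble q p hp).b₁ w y = law (joint q p) (fun ω => (ω.2.1, ω.1.1.2.2)) (y, w) /
      law (joint q p) (fun ω => ω.1.1.2.2) w :=
  sum_normalize_mul (joint_nonneg q hp.1) (fun ω => ω.1.1.1) (fun ω => ω.2.1)
    (fun ω => ω.1.1.2.2) y w hw

theorem inputEnsemble_b₂ (w : W) (z : Z) (hw : law (joint q p) (fun ω => ω.1.1.2.2) w ≠ 0) :
    (inputEnsemble q p hp).b₂ w z = law (joint q p) (fun ω => (ω.2.2, ω.1.1.2.2)) (z, w) /
      law (joint q p) (fun ω => ω.1.1.2.2) w :=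
  sum_normalize_mul (joint_nonneg q hp.1) (fun ω => ω.1.1.2.1) (fun ω => ω.2.2)
    (fun ω => ω.1.1.2.2) z w hw

theorem inputEnsemble_c₁ (y : Y) :
    (inputEnsemble q p hp).c₁ y = law (joint q p) (fun ω => ω.2.1) y :=
  sum_law_mul_cond (joint_nonneg q hp.1) (fun ω => ω.2.1) (fun ω => ω.1.1.2.2) y _
    fun w hw => inputEnsemble_b₁ q p hp w y hw

theorem inputEnsemble_c₂ (z : Z) :
    (inputEnsemble q p hp).c₂ z = law (joint q p) (fun ω => ω.2.2) z :=
  sum_law_mul_cond (joint_nonneg q hp.1) (fun ω => ω.2.2) (fun ω => ω.1.1.2.2) z _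
    fun w hw => inputEnsemble_b₂ q p hp w z hw

theorem inputEnsemble_log_a :
    (inputEnsemble q p hp).expect (fun w u v _ _ => Real.log ((inputEnsemble q p hp).a w u v)) =
      Real.log 2 * condMutualInfo (joint q p) (fun ω => ω.1.1.1) (fun ω => ω.1.1.2.1)
        (fun ω => ω.1.1.2.2) := by
  rw [inputEnsemble_expect]
  exact sum_mul_log_density (joint_nonneg q hp.1) (fun ω => ω.1.1.1) (fun ω => ω.1.1.2.1)
    (fun ω => ω.1.1.2.2)

/-- Here c₁/D₁ is p(y)/p(y|u,w), so the mean logarithm gives I(U,W;Y), written as I(W;Y) + I(U;Y|W).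
-/
theorem inputEnsemble_log_c₁ :
    (inputEnsemble q p hp).expect (fun w u _ y _ => Real.log ((inputEnsemble q p hp).c₁ y /
      (inputEnsemble q p hp).D₁ w u y)) = -(Real.log 2 * (infoWY q p + condMutualInfo (joint q p)
        (fun ω => ω.1.1.1) (fun ω => ω.2.1) (fun ω => ω.1.1.2.2))) := by
  simp only [inputEnsemble_expect, inputEnsemble_c₁]
  exact sum_mul_log_density_right (joint_nonneg q hp.1) (fun ω => ω.1.1.1) (fun ω => ω.2.1)
    (fun ω => ω.1.1.2.2)

theorem inputEnsemble_log_c₂ :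
    (inputEnsemble q p hp).expect (fun w _ v _ z => Real.log ((inputEnsemble q p hp).c₂ z /
      (inputEnsemble q p hp).D₂ w v z)) = -(Real.log 2 * (infoWZ q p + condMutualInfo (joint q p)
        (fun ω => ω.1.1.2.1) (fun ω => ω.2.2) (fun ω => ω.1.1.2.2))) := by
  simp only [inputEnsemble_expect, inputEnsemble_c₂]
  exact sum_mul_log_density_right (joint_nonneg q hp.1) (fun ω => ω.1.1.2.1) (fun ω => ω.2.2)
    (fun ω => ω.1.1.2.2)

/-- Here b₁/D₁ is p(y|w)/p(y|u,w), the reciprocal of the conditional information density; b₁ is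
known only where w has positive mass, hence the case split. -/
theorem inputEnsemble_log_b₁ :
    (inputEnsemble q p hp).expect (fun w u _ y _ => Real.log ((inputEnsemble q p hp).b₁ w y /
      (inputEnsemble q p hp).D₁ w u y)) = -(Real.log 2 * condMutualInfo (joint q p)
        (fun ω => ω.1.1.1) (fun ω => ω.2.1) (fun ω => ω.1.1.2.2)) := by
  rw [inputEnsemble_expect, ← sum_mul_log_density (joint_nonneg q hp.1) (fun ω => ω.1.1.1)
    (fun ω => ω.2.1) (fun ω => ω.1.1.2.2), ← Finset.sum_neg_distrib]
  refine Finset.sum_congr rfl fun ω _ => ?_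
  rcases (joint_nonneg q hp.1 ω).eq_or_lt with h0 | h0
  · simp [← h0]
  have hw := (h0.trans_le (le_law (joint_nonneg q hp.1) (fun ω => ω.1.1.2.2) ω)).ne'
  rw [inputEnsemble_b₁ q p hp _ _ hw, ← mul_neg, ← Real.log_inv]
  congr 2
  simp only [inputEnsemble, div_eq_mul_inv, mul_inv, inv_inv]
  ring

theorem inputEnsemble_log_b₂ :
    (inputEnsemble q p hp).expect (fun w _ v _ z => Real.log ((inputEnsemble q p hp).b₂ w z /
      (inputEnsemble q p hp).D₂ w v z)) = -(Real.log 2 * condMutualInfo (joint q p)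
        (fun ω => ω.1.1.2.1) (fun ω => ω.2.2) (fun ω => ω.1.1.2.2)) := by
  rw [inputEnsemble_expect, ← sum_mul_log_density (joint_nonneg q hp.1) (fun ω => ω.1.1.2.1)
    (fun ω => ω.2.2) (fun ω => ω.1.1.2.2), ← Finset.sum_neg_distrib]
  refine Finset.sum_congr rfl fun ω _ => ?_
  rcases (joint_nonneg q hp.1 ω).eq_or_lt with h0 | h0
  · simp [← h0]
  have hw := (h0.trans_le (le_law (joint_nonneg q hp.1) (fun ω => ω.1.1.2.2) ω)).ne'
  rw [inputEnsemble_b₂ q p hp _ _ hw, ← mul_neg, ← Real.log_inv]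
  congr 2
  simp only [inputEnsemble, div_eq_mul_inv, mul_inv, inv_inv]
  ring

end InputEnsemble

end BC

namespace BC

/-! ### Achievable rates of superposition coding with binning. -/

open Filter Topology

theorem two_rpow_eq_exp (r : ℝ) (n : ℕ) : (2 : ℝ) ^ ((n : ℝ) * r) = Real.exp (Real.log 2 * r * n) := by
  rw [Real.rpow_def_of_pos two_pos]
  ring_nf

theorem one_le_two_rpow {r : ℝ} (hr : 0 ≤ r) (n : ℕ) : (1 : ℝ) ≤ 2 ^ ((n : ℝ) * r) :=
  Real.one_le_rpow one_le_two (by positivity)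

theorem ceil_two_rpow_pos (r : ℝ) (n : ℕ) : 0 < ⌈(2 : ℝ) ^ ((n : ℝ) * r)⌉₊ :=
  Nat.ceil_pos.2 (by positivity)

theorem ceil_two_rpow_zero (n : ℕ) : ⌈(2 : ℝ) ^ ((n : ℝ) * 0)⌉₊ = 1 := by simp

theorem ceil_two_rpow_le {r : ℝ} (hr : 0 ≤ r) (n : ℕ) :
    (⌈(2 : ℝ) ^ ((n : ℝ) * r)⌉₊ : ℝ) ≤ 2 * 2 ^ ((n : ℝ) * r) := by
  have h1 := (Nat.ceil_lt_add_one (show (0 : ℝ) ≤ 2 ^ ((n : ℝ) * r) by positivity)).le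
  have h2 := one_le_two_rpow hr n
  linarith

theorem isBelowRate_of_le {K : ℕ → ℝ} {C r I : ℝ} (hC : 0 ≤ C) (h0 : ∀ n, 0 ≤ K n)
    (hK : ∀ n : ℕ, K n ≤ C * 2 ^ ((n : ℝ) * r)) (hr : r < I) :
    IsBelowRate K (-(Real.log 2 * I)) := by
  refine Or.inr ⟨C, Real.log 2 * r, hC, ?_, fun n => ⟨h0 n, ?_⟩⟩
  · nlinarith [log_two_pos]
  · rw [← two_rpow_eq_exp]; exact hK n

section Achievability

variable {U V W X Y Z : Type*} [Fintype U] [Fintype V] [Fintype W] [Fintype X] [Fintype Y]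
  [Fintype Z] (q : Channel X Y Z) (p : (U × V × W) × X → ℝ)
  (hp : p ∈ stdSimplex ℝ ((U × V × W) × X))

/-- The rate pairs given by superposition coding with Marton's binning. The bin rate is `rJ`, and
the message of the first receiver is split into a common part of rate `r₀` and a private part of
rate `r₁`. -/
theorem isAchievable_of_rates [Nonempty U] [Nonempty V] [Nonempty W] [Nonempty X]
    {r₀ r₁ rJ r₂ : ℝ} (h₀ : 0 ≤ r₀) (h₁ : 0 ≤ r₁) (hJ : 0 ≤ rJ) (h₂ : 0 ≤ r₂)
    (ra : condMutualInfo (joint q p) (fun ω => ω.1.1.1) (fun ω => ω.1.1.2.1)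
      (fun ω => ω.1.1.2.2) < rJ ∨ rJ = 0 ∧ ∀ w u v, (inputEnsemble q p hp).a w u v ≤ 1)
    (rb₁ : r₁ + rJ < condMutualInfo (joint q p) (fun ω => ω.1.1.1) (fun ω => ω.2.1)
      (fun ω => ω.1.1.2.2) ∨ r₁ = 0 ∧ rJ = 0)
    (rc₁ : r₀ + (r₁ + rJ) < infoWY q p + condMutualInfo (joint q p) (fun ω => ω.1.1.1)
      (fun ω => ω.2.1) (fun ω => ω.1.1.2.2) ∨ r₀ = 0)
    (rb₂ : r₂ < condMutualInfo (joint q p) (fun ω => ω.1.1.2.1) (fun ω => ω.2.2)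
      (fun ω => ω.1.1.2.2) ∨ r₂ = 0)
    (rc₂ : r₀ + r₂ < infoWZ q p + condMutualInfo (joint q p) (fun ω => ω.1.1.2.1)
      (fun ω => ω.2.2) (fun ω => ω.1.1.2.2) ∨ r₀ = 0) :
    IsAchievable q (r₀ + r₁, r₂) := by
  refine ⟨add_nonneg h₀ h₁, h₂, ?_⟩
  have hm : ∀ (r : ℝ) (n : ℕ), (1 : ℝ) ≤ ⌈(2 : ℝ) ^ ((n : ℝ) * r)⌉₊ := fun r n => by
    exact_mod_cast ceil_two_rpow_pos r n
  have hle := fun {r : ℝ} (hr : 0 ≤ r) (n : ℕ) => ceil_two_rpow_le hr n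
  have hmul : ∀ (r s : ℝ) (n : ℕ),
      (2 : ℝ) ^ ((n : ℝ) * (r + s)) = 2 ^ ((n : ℝ) * r) * 2 ^ ((n : ℝ) * s) := fun r s n => by
    rw [mul_add, Real.rpow_add two_pos]
  have hprod : ∀ {r s : ℝ}, 0 ≤ r → 0 ≤ s → ∀ n : ℕ,
      (⌈(2 : ℝ) ^ ((n : ℝ) * r)⌉₊ : ℝ) * ⌈(2 : ℝ) ^ ((n : ℝ) * s)⌉₊ ≤
        4 * 2 ^ ((n : ℝ) * (r + s)) := fun {r s} hr hs n => by
    rw [hmul]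
    calc _ ≤ (2 * (2 : ℝ) ^ ((n : ℝ) * r)) * (2 * 2 ^ ((n : ℝ) * s)) :=
          mul_le_mul (hle hr n) (hle hs n) (by positivity) (by positivity)
      _ = _ := by ring
  have hfloor : ∀ {r : ℝ}, 0 ≤ r → ∀ n : ℕ, 0 < ⌊(2 : ℝ) ^ ((n : ℝ) * r)⌋₊ := fun {r} hr n =>
    Nat.floor_pos.2 (one_le_two_rpow hr n)
  obtain ⟨κ, hκ, haJ⟩ : ∃ κ : ℕ → ℝ, IsBelowRate κ ((inputEnsemble q p hp).expect
      (fun w u v _ _ => Real.log ((inputEnsemble q p hp).a w u v))) ∧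
      ∀ n w u v, ((inputEnsemble q p hp).pi n).a w u v + ((⌈(2 : ℝ) ^ ((n : ℝ) * rJ)⌉₊ : ℝ) - 1) ≤
        ⌈(2 : ℝ) ^ ((n : ℝ) * rJ)⌉₊ * (1 + κ n * ((inputEnsemble q p hp).pi n).a w u v) := by
    rw [inputEnsemble_log_a]
    -- With binning, κ is the reciprocal of the bin size, and rJ > I(U;V|W) makes it decay fast
    -- enough. Without binning the bin size is 1 and a ≤ 1 allows κ = 0.
    rcases ra with ra | ⟨rfl, ha⟩
    · refine ⟨fun n => (⌈(2 : ℝ) ^ ((n : ℝ) * rJ)⌉₊ : ℝ)⁻¹, ?_, fun n w u v => ?_⟩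
      · have := isBelowRate_of_le (K := fun n => (⌈(2 : ℝ) ^ ((n : ℝ) * rJ)⌉₊ : ℝ)⁻¹) (r := -rJ)
          (I := -condMutualInfo (joint q p) (fun ω => ω.1.1.1) (fun ω => ω.1.1.2.1)
            (fun ω => ω.1.1.2.2)) zero_le_one (fun n => by positivity) (fun n => ?_) (neg_lt_neg ra)
        · simpa using this
        · rw [one_mul, mul_neg, Real.rpow_neg two_pos.le]
          exact inv_anti₀ (by positivity) (Nat.le_ceil _)
      · have hne : (⌈(2 : ℝ) ^ ((n : ℝ) * rJ)⌉₊ : ℝ) ≠ 0 := by linarith [hm rJ n]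
        rw [mul_add, ← mul_assoc, mul_inv_cancel₀ hne]
        linarith
    · refine ⟨fun _ => 0, Or.inl fun _ => rfl, fun n w u v => ?_⟩
      have : ((inputEnsemble q p hp).pi n).a w u v ≤ 1 := by
        simp only [Ensemble.pi]
        exact Finset.prod_le_one (fun i _ => (inputEnsemble q p hp).a_nonneg (w i) (u i) (v i))
          fun i _ => ha (w i) (u i) (v i)
      rw [ceil_two_rpow_zero]
      simpa using this
  -- Index sets are rounded up and message sets down, so the messages embed. At rate zero an index
  -- set has exactly one element, so the matching count of wrong candidates is 0, as the degenerate
  -- alternatives require.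
  refine (inputEnsemble q p hp).exists_codes q rfl (inputEnsemble_expect_one q p hp)
    (m₀ := fun n => ⌈(2 : ℝ) ^ ((n : ℝ) * r₀)⌉₊) (m₁ := fun n => ⌈(2 : ℝ) ^ ((n : ℝ) * r₁)⌉₊)
    (j := fun n => ⌈(2 : ℝ) ^ ((n : ℝ) * rJ)⌉₊) (m₂ := fun n => ⌈(2 : ℝ) ^ ((n : ℝ) * r₂)⌉₊)
    (hfloor (add_nonneg h₀ h₁)) (hfloor h₂) (ceil_two_rpow_pos r₀) (ceil_two_rpow_pos r₁)
    (ceil_two_rpow_pos rJ) (fun n => ?_) (fun n => Nat.floor_le_ceil _) haJ hκ ?_ ?_ ?_ ?_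
  · refine Nat.floor_le_of_le ?_
    rw [hmul]
    push_cast
    exact mul_le_mul (Nat.le_ceil _) (Nat.le_ceil _) (by positivity) (by positivity)
  · rw [inputEnsemble_log_b₁]
    rcases rb₁ with h | ⟨rfl, rfl⟩
    · refine isBelowRate_of_le (C := 4) (by norm_num) (fun n => ?_) (fun n => ?_) h
      · nlinarith [hm r₁ n, hm rJ n]
      · linarith [hprod h₁ hJ n]
    · exact Or.inl fun n => by simp
  · rw [inputEnsemble_log_c₁]
    rcases rc₁ with h | rfl
    · refine isBelowRate_of_le (C := 8) (by norm_num) (fun n => ?_) (fun n => ?_) h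
      · exact mul_nonneg (by linarith [hm r₀ n]) (by positivity)
      · rw [hmul]
        calc _ ≤ (2 * (2 : ℝ) ^ ((n : ℝ) * r₀)) * (4 * 2 ^ ((n : ℝ) * (r₁ + rJ))) :=
              mul_le_mul (by linarith [hle h₀ n]) (hprod h₁ hJ n) (by positivity) (by positivity)
          _ = _ := by ring
    · exact Or.inl fun n => by simp
  · rw [inputEnsemble_log_b₂]
    rcases rb₂ with h | rfl
    · refine isBelowRate_of_le (C := 2) (by norm_num) (fun n => ?_) (fun n => ?_) h
      · linarith [hm r₂ n]
      · linarith [hle h₂ n]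
    · exact Or.inl fun n => by simp
  · rw [inputEnsemble_log_c₂]
    rcases rc₂ with h | rfl
    · refine isBelowRate_of_le (C := 4) (by norm_num) (fun n => ?_) (fun n => ?_) h
      · exact mul_nonneg (by linarith [hm r₀ n]) (by positivity)
      · refine le_trans (mul_le_mul_of_nonneg_right ?_ (by positivity)) (hprod h₀ h₂ n)
        linarith
    · exact Or.inl fun n => by simp

end Achievability

end BC

namespace BC

/-! ### Marton's inner bound for the sum rate. -/

section MartonInnerBound

variable {U V W X Y Z : Type*} [Fintype U] [Fintype V] [Fintype W] [Fintype X] [Fintype Y]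
  [Fintype Z] [Nonempty U] [Nonempty V] [Nonempty W] [Nonempty X] (q : Channel X Y Z)
  {p : (U × V × W) × X → ℝ}

/-- The strict inequality leaves room for a bin rate just above I(U;V|W) together with a nonnegative
private rate for the first receiver. -/
theorem martonValue_le_optimalSumRate_of_lt (hp : p ∈ stdSimplex ℝ ((U × V × W) × X))
    (h : condMutualInfo (joint q p) (fun ω => ω.1.1.1) (fun ω => ω.1.1.2.1) (fun ω => ω.1.1.2.2) <
      condMutualInfo (joint q p) (fun ω => ω.1.1.1) (fun ω => ω.2.1) (fun ω => ω.1.1.2.2)) :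
    martonValue q p ≤ optimalSumRate q := by
  have hUV := condMutualInfo_nonneg (joint_nonneg q hp.1) (fun ω => ω.1.1.1)
    (fun ω => ω.1.1.2.1) (fun ω => ω.1.1.2.2)
  have hV := condMutualInfo_nonneg (joint_nonneg q hp.1) (fun ω => ω.1.1.2.1)
    (fun ω => ω.2.2) (fun ω => ω.1.1.2.2)
  have hY := infoWY_nonneg q hp
  have hZ := infoWZ_nonneg q hp
  refine le_of_forall_pos_le_add fun ε hε => ?_
  rw [martonValue, privateTerm]
  set iUV := condMutualInfo (joint q p) (fun ω => ω.1.1.1) (fun ω => ω.1.1.2.1)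
    (fun ω => ω.1.1.2.2) with hiUV
  set iU := condMutualInfo (joint q p) (fun ω => ω.1.1.1) (fun ω => ω.2.1)
    (fun ω => ω.1.1.2.2) with hiU
  set iV := condMutualInfo (joint q p) (fun ω => ω.1.1.2.1) (fun ω => ω.2.2)
    (fun ω => ω.1.1.2.2) with hiV
  -- The chosen rates lose δ in the common part, 2δ in the first private part and δ in the second;
  -- the last condition keeps r₁ nonnegative.
  obtain ⟨δ, hδ, hδ1, hδ2⟩ : ∃ δ : ℝ, 0 < δ ∧ 4 * δ ≤ ε ∧ 2 * δ ≤ iU - iUV :=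
    ⟨min (ε / 4) ((iU - iUV) / 2), lt_min (by linarith) (by linarith),
      by linarith [min_le_left (ε / 4) ((iU - iUV) / 2)],
      by linarith [min_le_right (ε / 4) ((iU - iUV) / 2)]⟩
  have m1 := min_le_left (infoWY q p) (infoWZ q p)
  have m2 := min_le_right (infoWY q p) (infoWZ q p)
  have key := (isAchievable_of_rates q p hp (r₀ := max 0 (min (infoWY q p) (infoWZ q p) - δ))
    (r₁ := iU - iUV - 2 * δ) (rJ := iUV + δ) (r₂ := max 0 (iV - δ)) (le_max_left _ _) (by linarith)
    (by linarith) (le_max_left _ _) (Or.inl (by linarith)) (Or.inl (by linarith)) ?_ ?_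
    ?_).add_le_optimalSumRate
  · have := le_max_right 0 (min (infoWY q p) (infoWZ q p) - δ)
    have := le_max_right 0 (iV - δ)
    linarith
  · rcases max_choice 0 (min (infoWY q p) (infoWZ q p) - δ) with h1 | h1
    · exact Or.inr h1
    · exact Or.inl (by rw [h1]; linarith)
  · rcases max_choice 0 (iV - δ) with h1 | h1
    · exact Or.inr h1
    · exact Or.inl (by rw [h1]; linarith)
  · rcases max_choice 0 (min (infoWY q p) (infoWZ q p) - δ) with h1 | h1
    · exact Or.inr h1
    · have : max 0 (iV - δ) ≤ iV := max_le hV (by linarith)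
      exact Or.inl (by rw [h1]; linarith)

/-- Superposition coding with private messages for the second receiver only. -/
theorem superposition_le_optimalSumRate (hp : p ∈ stdSimplex ℝ ((U × V × W) × X))
    (ha : ∀ w u v, (inputEnsemble q p hp).a w u v ≤ 1) :
    min (infoWY q p) (infoWZ q p) + condMutualInfo (joint q p) (fun ω => ω.1.1.2.1)
      (fun ω => ω.2.2) (fun ω => ω.1.1.2.2) ≤ optimalSumRate q := by
  have hU := condMutualInfo_nonneg (joint_nonneg q hp.1) (fun ω => ω.1.1.1)
    (fun ω => ω.2.1) (fun ω => ω.1.1.2.2)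
  have hV := condMutualInfo_nonneg (joint_nonneg q hp.1) (fun ω => ω.1.1.2.1)
    (fun ω => ω.2.2) (fun ω => ω.1.1.2.2)
  refine le_of_forall_pos_le_add fun ε hε => ?_
  set iV := condMutualInfo (joint q p) (fun ω => ω.1.1.2.1) (fun ω => ω.2.2)
    (fun ω => ω.1.1.2.2) with hiV
  have m1 := min_le_left (infoWY q p) (infoWZ q p)
  have m2 := min_le_right (infoWY q p) (infoWZ q p)
  have key := (isAchievable_of_rates q p hp (r₀ := max 0 (min (infoWY q p) (infoWZ q p) - ε / 2))
    (r₁ := 0) (rJ := 0) (r₂ := max 0 (iV - ε / 2)) (le_max_left _ _) le_rfl le_rfl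
    (le_max_left _ _) (Or.inr ⟨rfl, ha⟩) (Or.inr ⟨rfl, rfl⟩) ?_ ?_ ?_).add_le_optimalSumRate
  · have := le_max_right 0 (min (infoWY q p) (infoWZ q p) - ε / 2)
    have := le_max_right 0 (iV - ε / 2)
    linarith
  · rcases max_choice 0 (min (infoWY q p) (infoWZ q p) - ε / 2) with h1 | h1
    · exact Or.inr h1
    · exact Or.inl (by rw [h1]; linarith)
  · rcases max_choice 0 (iV - ε / 2) with h1 | h1
    · exact Or.inr h1
    · exact Or.inl (by rw [h1]; linarith)
  · rcases max_choice 0 (min (infoWY q p) (infoWZ q p) - ε / 2) with h1 | h1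
    · exact Or.inr h1
    · have : max 0 (iV - ε / 2) ≤ iV := max_le hV (by linarith)
      exact Or.inl (by rw [h1]; linarith)

/-- A constant U is independent of V, so the density is 1 where it is defined and 0 elsewhere. -/
theorem inputEnsemble_a_le_one [Subsingleton U] (hp : p ∈ stdSimplex ℝ ((U × V × W) × X))
    (w : W) (u : U) (v : V) : (inputEnsemble q p hp).a w u v ≤ 1 := by
  have hR := joint_nonneg q hp.1
  refine div_le_one_of_le₀ ?_ (mul_nonneg (law_nonneg hR _ _) (law_nonneg hR _ _))
  rw [mul_comm (law (joint q p) (fun ω => (ω.1.1.1, ω.1.1.2.2)) (u, w))]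
  refine mul_le_mul (law_pair_le hR _ _ _ _) (le_of_eq ?_) (law_nonneg hR _ _) (law_nonneg hR _ _)
  rw [← law_prod_sum (joint q p) (fun ω => ω.1.1.1) (fun ω => ω.1.1.2.2) w]
  exact Fintype.sum_subsingleton _ u

/-- If I(U;Y|W) ≤ I(U;V|W), then U does not help: replacing it by a constant does not lower the
value, and plain superposition coding suffices. -/
theorem martonValue_le_optimalSumRate (hp : p ∈ stdSimplex ℝ ((U × V × W) × X)) :
    martonValue q p ≤ optimalSumRate q := by
  rcases lt_or_ge (condMutualInfo (joint q p) (fun ω => ω.1.1.1) (fun ω => ω.1.1.2.1)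
      (fun ω => ω.1.1.2.2)) (condMutualInfo (joint q p) (fun ω => ω.1.1.1) (fun ω => ω.2.1)
      (fun ω => ω.1.1.2.2)) with h | h
  · exact martonValue_le_optimalSumRate_of_lt q hp h
  · have h1 := superposition_le_optimalSumRate q
      (p := law p (fun s => (((), s.1.2.1, s.1.2.2), s.2))) (law_mem_stdSimplex hp _)
      (inputEnsemble_a_le_one q _)
    refine le_trans ?_ h1
    simp only [martonValue, privateTerm, infoWY, infoWZ, mutualInfo, condMutualInfo, condEntropy,
      entropy_joint_law q p (fun s => (((), s.1.2.1, s.1.2.2), s.2)) (fun _ => rfl)] at h ⊢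
    linarith

end MartonInnerBound

/-- Marton's inner bound for the sum rate. -/
theorem martonSumRate_le_optimalSumRate {X Y Z : Type*} [Fintype X] [Nonempty X] [Fintype Y]
    [Fintype Z] (q : Channel X Y Z) : martonSumRate q ≤ optimalSumRate q := by
  refine (isLUB_martonSet q).2 ?_
  rintro _ ⟨a, b, c, p, hp, rfl⟩
  obtain ⟨s⟩ : Nonempty ((Fin a × Fin b × Fin c) × X) := by
    by_contra h
    rw [not_nonempty_iff] at h
    simpa using hp.2
  have : Nonempty (Fin a) := ⟨s.1.1⟩
  have : Nonempty (Fin b) := ⟨s.1.2.1⟩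
  have : Nonempty (Fin c) := ⟨s.1.2.2⟩
  exact martonValue_le_optimalSumRate q hp

end BC
-- The main theorem.
theorem mainTheorem7 {X Y Z : Type*} [Fintype X] [Nonempty X] [Fintype Y] [Fintype Z]
    (q : BC.Channel X Y Z) :
    -- the suprema that define the quantities below are finite, and `SR*(q)` is a maximum
    IsGreatest (BC.sumRates q) (BC.optimalSumRate q) ∧
    IsLUB (BC.martonSet q) (BC.martonSumRate q) ∧
    (∀ t ∈ Set.Icc (0 : ℝ) 1, IsLUB (BC.lamSet t q) (BC.lamSR t q) ∧
      ∀ p ∈ stdSimplex ℝ X, IsLUB (BC.lamSetAt t q p) (BC.lamSRAt t q p)) ∧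
    -- `0-SR(q,p(x))` and `1-SR(q,p(x))` are maxima, equal to the maxima over `p(w|x)`
    (∀ p ∈ stdSimplex ℝ X,
      IsGreatest (BC.lamSetAt 0 q p) (BC.lamSRAt 0 q p) ∧
      IsGreatest {r | ∃ (c : ℕ) (κ : X → Fin c → ℝ), (∀ x, κ x ∈ stdSimplex ℝ (Fin c)) ∧
        r = BC.boundZY q (BC.inputJoint p κ)} (BC.lamSRAt 0 q p) ∧
      IsGreatest (BC.lamSetAt 1 q p) (BC.lamSRAt 1 q p) ∧
      IsGreatest {r | ∃ (c : ℕ) (κ : X → Fin c → ℝ), (∀ x, κ x ∈ stdSimplex ℝ (Fin c)) ∧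
        r = BC.boundYZ q (BC.inputJoint p κ)} (BC.lamSRAt 1 q p)) ∧
    -- the same for `0-SR(q)` and `1-SR(q)`, with maxima over `p(w,x)`
    (IsGreatest (BC.lamSet 0 q) (BC.lamSR 0 q) ∧
      IsGreatest {r | ∃ (c : ℕ) (p : Fin c × X → ℝ), p ∈ stdSimplex ℝ (Fin c × X) ∧
        r = BC.boundZY q p} (BC.lamSR 0 q) ∧
      IsGreatest (BC.lamSet 1 q) (BC.lamSR 1 q) ∧
      IsGreatest {r | ∃ (c : ℕ) (p : Fin c × X → ℝ), p ∈ stdSimplex ℝ (Fin c × X) ∧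
        r = BC.boundYZ q p} (BC.lamSR 1 q)) ∧
    -- the upper bound on the optimal sum rate
    BC.optimalSumRate q ≤ min (BC.lamSR 0 q) (BC.lamSR 1 q) ∧
    -- if the minimum over `[0,1]` is attained at an endpoint, Marton's sum rate is optimal
    ((∃ t₀ ∈ ({0, 1} : Set ℝ), IsMinOn (fun t => BC.lamSR t q) (Set.Icc 0 1) t₀) →
      BC.martonSumRate q = BC.optimalSumRate q) := by
  refine ⟨BC.isGreatest_optimalSumRate q, BC.isLUB_martonSet q,
    fun t ht => ⟨BC.isLUB_lamSet q ht, fun p hp => BC.isLUB_lamSetAt q ht hp⟩,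
    fun p hp => ⟨(BC.exists_isGreatest_lamSetAt_zero q hp).1,
      (BC.exists_isGreatest_lamSetAt_zero q hp).2, (BC.exists_isGreatest_lamSetAt_one q hp).1,
      (BC.exists_isGreatest_lamSetAt_one q hp).2⟩,
    ⟨(BC.exists_isGreatest_lamSet_zero q).1, (BC.exists_isGreatest_lamSet_zero q).2,
      (BC.exists_isGreatest_lamSet_one q).1, (BC.exists_isGreatest_lamSet_one q).2⟩,
    BC.optimalSumRate_le q, ?_⟩
  rintro ⟨t₀, ht₀, hmin⟩
  have hle := BC.optimalSumRate_le q
  -- The chain SR ≤ SR* ≤ min(0-SR, 1-SR) ≤ t₀-SR ≤ SR closes up.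
  refine le_antisymm (BC.martonSumRate_le_optimalSumRate q)
    (le_trans ?_ (BC.lamSR_le_martonSumRate q ht₀ hmin))
  rcases ht₀ with rfl | rfl
  · exact hle.trans (min_le_left _ _)
  · exact hle.trans (min_le_right _ _)
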